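/- Let $G$ be a finite-dimensional real Lie group with Lie algebra $\mathfrak g$, basis $J_a$ of $\mathfrak g$, structure constants $[J_a,J_b]=f_{ab}{}^cJ_c$ and dual basis $P^a$ of $\mathfrak g^*$ (summation over repeated indices). Let $\mathrm{Ad}^*(u)$, $\mathrm{ad}^*(p)$ be the algebraic duals of $\mathrm{Ad}(u)$, $\mathrm{ad}(p)$, so $\langle \mathrm{Ad}^*(u)j,\xi\rangle=\langle j,\mathrm{Ad}(u)\xi\rangle$, with components $(\mathrm{Ad}^*(u)j)_a=\mathrm{Ad}^*(u)_a{}^b j_b$. Let $H=G\ltimes\mathfrak g^*$ with multiplication $(u_1,a_1)(u_2,a_2)=(u_1u_2,\,a_1+\mathrm{Ad}^*(u_1^{-1})a_2)$, and let $G\ltimes C^\infty(G)$ have the multiplication $(h_1,f_1)(h_2,f_2)=(h_1h_2,\,f_1+f_2\circ \mathrm{Ad}_{h_1^{-1}})$, where $\mathrm{Ad}_h(u)=huh^{-1}$. For $n,g\ge 0$ label the factors of $G^{n+2g}$ by $X\in\{M_1,\dots,M_n,A_1,B_1,\dots,A_g,B_g\}$, partially ordered by $M_1<\dots<M_n<A_1,B_1<\dots<A_g,B_g$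 ($A_i,B_i$ incomparable). Let $J^{R_X}_aF=\frac{d}{dt}|_{0}F(\dots,u_Xe^{tJ_a},\dots)$, $J^{L_X}_aF=\frac{d}{dt}|_{0}F(\dots,e^{-tJ_a}u_X,\dots)$ and $D^X_a=J^{R_X}_a+J^{L_X}_a$. The flower algebra is the commutative algebra $\mathcal F=S(\bigoplus_{X}\mathfrak g)\otimes C^\infty(G^{n+2g})$, generated by $C^\infty(G^{n+2g})$ and elements $j^X_a$, with the bracket $\{\ ,\ \}$ that is the skew-symmetric bilinear biderivation determined by $\{F,F'\}=0$ for $F,F'\in C^\infty(G^{n+2g})$ and $$\{j^X_a,j^X_b\}=-f_{ab}{}^cj^X_c,\qquad \{j^X_a,j^Y_b\}=-(\delta_a^{\ d}-\mathrm{Ad}^*(u_X)_a{}^d)f_{db}{}^cj^Y_c\ (X<Y),\qquad \{j^{A_i}_a,j^{B_i}_b\}=-f_{ab}{}^cj^{B_i}_c,$$ $$\{j^X_a,F\}=-V^X_aF-(\delta_a^{\ b}-\mathrm{Ad}^*(u_X)_a{}^b)\sum_{Y>X}D^Y_bF,$$ where $V^{M_i}_a=D^{M_i}_a$, $V^{A_i}_a=D^{A_i}_a+D^{B_i}_a+\mathrm{Ad}^*(u_{B_i}^{-1}u_{A_i})_a{}^bJ_b^{R_{B_i}}$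 and $V^{B_i}_a=J_a^{L_{A_i}}+D^{B_i}_a$. Put $u_{K_i}=u_{B_i}u_{A_i}^{-1}u_{B_i}^{-1}u_{A_i}$ and $\Phi_\infty(u)=u_{tot}=u_{K_g}\cdots u_{K_1}u_{M_n}\cdots u_{M_1}$. An element $(h,f)\in G\ltimes C^\infty(G)$ acts on $\mathcal F$ by the algebra homomorphism with $$F\mapsto F\circ \mathrm{Ad}^{n+2g}_{h^{-1}},\qquad j^X_a\mapsto \mathrm{Ad}^*(h)_a{}^b\,\big(j^X_b+\{j^X_b,f\circ\Phi_\infty\}\big),$$ where $\mathrm{Ad}^{n+2g}_h$ conjugates every component by $h$. Suppose that $\exp:\mathfrak g\to G$ is bijective, with inverse $\log$. Then: 1. $\{\ ,\ \}$ is a Poisson bracket on $\mathcal F$. 2. For every $u\in G$ the linear map $T(u)=\frac{1-\mathrm{Ad}^*(u)}{\mathrm{ad}^*(\log u)}:\mathfrak g^*\to\mathfrak g^*$, that is the entire function $\frac{1-e^z}{z}=-\sum_{k\ge0}\frac{z^k}{(k+1)!}$ evaluated at $z=\mathrm{ad}^*(\log u)$, is invertible, and $T(u)\,\mathrm{ad}^*(\log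 u)=1-\mathrm{Ad}^*(u)$. 3. For $q\in\mathfrak g^*$ the function $\iota(q)(u)=\langle q,\log u\rangle$ is smooth, and $(h,q)\mapsto(h,\iota(q))$ is an injective group homomorphism $H\to G\ltimes C^\infty(G)$. 4. The restriction along this homomorphism of the above action is a group action $\rho$ of $H$ on $\mathcal F$ by algebra automorphisms that preserve the Poisson bracket. For $(h,q)\in H$ let $x=x(u)=T(u)^{-1}q$, which is a smooth function of $u\in G$. Then $$\rho(h,q):\quad F\mapsto F\circ\mathrm{Ad}^{n+2g}_{h^{-1}},\qquad j^X_a\mapsto \mathrm{Ad}^*(h)_a{}^b\,j^X_b-\big(\mathrm{Ad}^*(h)-\mathrm{Ad}^*(u_Xh)\big)_a{}^b\,x_b(u_{tot}),\qquad q=T(u_{tot})\,x(u_{tot}).$$ 5. This is global conjugation with a translation vector depending on $u_{tot}$: if elements of $\mathcal F$ are regarded as functions on $H^{n+2g}$ through the parametrisation $(u_X,-\mathrm{Ad}^*(u_X^{-1})j_X)$ of the $X$-th copy of $H$, then $(\rho(h,q)\varphi)(m)=\varphi\big((h,x)^{-1}\,m\,(h,x)\big)$ for all $\varphi\in\mathcal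 F$ and $m\in H^{n+2g}$, where every component of $m$ is conjugated and $x=x(u_{tot}(m))$. -/

import Mathlib

open scoped Manifold ContDiff TensorProduct

noncomputable section

namespace Flower

open Set Function MvPolynomial

/-! ### Finite powers of a manifold -/

section PiManifold

variable {ι : Type*} [Fintype ι]
  {E : Type*} [NormedAddCommGroup E] [NormedSpace ℝ E]
  {M : Type*} [TopologicalSpace M] [ChartedSpace E M]
  {E' : Type*} [NormedAddCommGroup E'] [NormedSpace ℝ E'] {H' : Type*} [TopologicalSpace H']
  {J : ModelWithCorners ℝ E' H'} {N : Type*} [TopologicalSpace N] [ChartedSpace H' N]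

variable (E ι) in
/-- The model space of the product manifold `ι → M`. -/
abbrev piModel : ModelWithCorners ℝ (ι → E) (ModelPi fun _ : ι => E) :=
  ModelWithCorners.pi fun _ : ι => 𝓘(ℝ, E)

instance piIsManifold [IsManifold 𝓘(ℝ, E) ∞ M] : IsManifold (piModel ι E) ∞ (ι → M) := by
  apply isManifold_of_contDiffOn
  rintro e e' ⟨c, hc, rfl⟩ ⟨c', hc', rfl⟩
  rw [contDiffOn_pi]
  intro i
  have h := (mem_groupoid_of_pregroupoid.mp
    ((contDiffGroupoid ∞ 𝓘(ℝ, E)).compatible (hc i (mem_univ i)) (hc' i (mem_univ i)))).1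
  have h2 : ContDiffOn ℝ ∞ ((c i).symm.trans (c' i)) ((c i).symm.trans (c' i)).source := by
    simpa [contDiffPregroupoid] using h
  have h3 : ContDiffOn ℝ ∞ (fun e : ι → E => ((c i).symm.trans (c' i)) (e i))
      ((piModel ι E).symm ⁻¹' ((OpenPartialHomeomorph.pi c).symm.trans
        (OpenPartialHomeomorph.pi c')).source ∩ range (piModel ι E)) := by
    refine ContDiffOn.comp (t := ((c i).symm.trans (c' i)).source) h2
      (ContDiff.contDiffOn (contDiff_apply ℝ E i)) fun y hy => ?_
    exact ⟨hy.1.1 i (mem_univ i), hy.1.2 i (mem_univ i)⟩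
  exact h3

theorem contMDiff_proj (i : ι) :
    ContMDiff (piModel ι E) 𝓘(ℝ, E) ∞ (fun u : ι → M => u i) := by
  intro x
  rw [contMDiffAt_iff]
  refine ⟨(continuous_apply i).continuousAt, ?_⟩
  have h : ContDiffWithinAt ℝ ∞ (fun e : ι → E => e i) (range (piModel ι E))
      (extChartAt (piModel ι E) x x) := (contDiff_apply ℝ E i).contDiffWithinAt
  have key : ∀ e ∈ (extChartAt (piModel ι E) x).target,
      (extChartAt 𝓘(ℝ, E) (x i) ∘ (fun u : ι → M => u i) ∘ (extChartAt (piModel ι E) x).symm) e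
        = e i := by
    intro e he
    have hi : e i ∈ (extChartAt 𝓘(ℝ, E) (x i)).target := by
      have h2 : e i ∈ (chartAt E (x i)).target := he.2 i (mem_univ i)
      simpa using h2
    exact (extChartAt 𝓘(ℝ, E) (x i)).right_inv hi
  refine h.congr_of_eventuallyEq ?_ (key _ (mem_extChartAt_target x))
  filter_upwards [extChartAt_target_mem_nhdsWithin (I := piModel ι E) x] with e he
  exact key e he

theorem contMDiff_to_pi {f : N → ι → M}
    (hf : ∀ i, ContMDiff J 𝓘(ℝ, E) ∞ (fun x => f x i)) :
    ContMDiff J (piModel ι E) ∞ f := by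
  intro x
  rw [contMDiffAt_iff]
  refine ⟨continuousAt_pi.2 fun i => (hf i x).continuousAt, ?_⟩
  rw [contDiffWithinAt_pi]
  intro i
  exact (contMDiffAt_iff.1 (hf i x)).2

theorem contMDiff_deriv_real [IsManifold J 1 N] [IsManifold 𝓘(ℝ, E) 1 M] (g : M)
    (f : N → M → ℝ) (hf : ContMDiff (J.prod 𝓘(ℝ, E)) 𝓘(ℝ, ℝ) ∞ (uncurry f))
    (ξ : TangentSpace 𝓘(ℝ, E) g) :
    ContMDiff J 𝓘(ℝ, ℝ) ∞ (fun x => (mfderiv 𝓘(ℝ, E) 𝓘(ℝ, ℝ) (f x) g ξ : ℝ)) := by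
  intro x₀
  have h := ContMDiffAt.mfderiv (m := ∞) (n := ∞) (x₀ := x₀) f (fun _ => g) (hf _)
    contMDiffAt_const (by simp)
  have h2 := h.clm_apply (contMDiffAt_const (c := (show E from ξ)))
  refine h2.congr_of_eventuallyEq (Filter.Eventually.of_forall fun x => ?_)
  have h3 := inTangentCoordinates_eq (I := 𝓘(ℝ, E)) (I' := 𝓘(ℝ, ℝ)) (fun _ : N => g)
    (fun x => f x g) (fun x => mfderiv 𝓘(ℝ, E) 𝓘(ℝ, ℝ) (f x) g) (x₀ := x₀) (x := x)
    (mem_chart_source E g) (mem_univ _)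
  show _ = (inTangentCoordinates 𝓘(ℝ, E) 𝓘(ℝ, ℝ) (fun x => g) (fun x => f x g)
    (fun x => mfderiv 𝓘(ℝ, E) 𝓘(ℝ, ℝ) (f x) g) x₀ x) (show E from ξ)
  rw [h3]
  have h4 := (tangentBundleCore 𝓘(ℝ, E) M).coordChange_self (achart E g) g (by simp) ξ
  rw [tangentBundleCore_coordChange_model_space]
  exact congrArg (mfderiv 𝓘(ℝ, E) 𝓘(ℝ, ℝ) (f x) g) h4.symm

theorem contMDiff_deriv_fixed [IsManifold J 1 N] [IsManifold 𝓘(ℝ, E) 1 M] (g : M)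
    (f : N → M → M) (hf : ContMDiff (J.prod 𝓘(ℝ, E)) 𝓘(ℝ, E) ∞ (uncurry f))
    (hg : ∀ x, f x g = g) (ξ : TangentSpace 𝓘(ℝ, E) g) :
    ContMDiff J 𝓘(ℝ, E) ∞ (fun x => (mfderiv 𝓘(ℝ, E) 𝓘(ℝ, E) (f x) g ξ : E)) := by
  intro x₀
  have h := ContMDiffAt.mfderiv (m := ∞) (n := ∞) (x₀ := x₀) f (fun _ => g) (hf _)
    contMDiffAt_const (by simp)
  have h2 := h.clm_apply (contMDiffAt_const (c := (show E from ξ)))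
  refine h2.congr_of_eventuallyEq (Filter.Eventually.of_forall fun x => ?_)
  have h3 := inTangentCoordinates_eq (I := 𝓘(ℝ, E)) (I' := 𝓘(ℝ, E)) (fun _ : N => g)
    (fun x => f x g) (fun x => mfderiv 𝓘(ℝ, E) 𝓘(ℝ, E) (f x) g) (x₀ := x₀) (x := x)
    (mem_chart_source E g) (by simp [hg])
  show _ = (inTangentCoordinates 𝓘(ℝ, E) 𝓘(ℝ, E) (fun x => g) (fun x => f x g)
    (fun x => mfderiv 𝓘(ℝ, E) 𝓘(ℝ, E) (f x) g) x₀ x) (show E from ξ)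
  rw [h3]
  have h4 := (tangentBundleCore 𝓘(ℝ, E) M).coordChange_self (achart E g) g (by simp)
  have h5 : ∀ p q : M, p = g → q = g → ∀ v : E,
      (tangentBundleCore 𝓘(ℝ, E) M).coordChange (achart E p) (achart E q) p v = v := by
    rintro p q rfl rfl v
    exact h4 v
  refine Eq.trans ?_ (h5 _ _ (hg x) (hg x₀) _).symm
  exact congrArg (mfderiv 𝓘(ℝ, E) 𝓘(ℝ, E) (f x) g) (h4 ξ).symm

end PiManifold

/-! ### Lie groups: Lie algebra, exponential map, (co)adjoint action -/

section Lie

variable {E : Type*} [NormedAddCommGroup E] [NormedSpace ℝ E]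
  {G : Type*} [TopologicalSpace G] [ChartedSpace E G] [Group G]

variable (E G) in
/-- The Lie algebra `𝔤` of `G`: the tangent space at `1` with the bracket of left-invariant
vector fields. -/
abbrev LieAlg : Type _ := GroupLieAlgebra 𝓘(ℝ, E) G

variable (E G) in
/-- The dual `𝔤*`. -/
abbrev CoLieAlg : Type _ := LieAlg E G →L[ℝ] ℝ

instance [FiniteDimensional ℝ E] : FiniteDimensional ℝ (LieAlg E G) :=
  inferInstanceAs (FiniteDimensional ℝ E)

instance : T2Space (LieAlg E G) := inferInstanceAs (T2Space E)

variable [LieGroup 𝓘(ℝ, E) ∞ G]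

instance : LieGroup 𝓘(ℝ, E) (minSmoothness ℝ 3) G := by
  simp only [minSmoothness_of_isRCLikeNormedField]
  infer_instance

/-- `exp ξ = γ 1`, where `γ` is the integral curve through `1` of the left-invariant vector
field given by `ξ`. -/
def lieExp (ξ : LieAlg E G) : G :=
  Classical.epsilon fun g => ∃ γ : ℝ → G, γ 0 = 1 ∧
    IsMIntegralCurve (I := 𝓘(ℝ, E)) γ (mulInvariantVectorField ξ) ∧ γ 1 = g

/-- The inverse of `exp` (meaningful when `exp` is bijective). -/
def lieLog (u : G) : LieAlg E G := invFun lieExp u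

/-- `Ad(u)`: the derivative at `1` of `g ↦ u g u⁻¹`. -/
def Ad (u : G) : LieAlg E G →L[ℝ] LieAlg E G :=
  (mfderiv 𝓘(ℝ, E) 𝓘(ℝ, E) (fun g : G => u * g * u⁻¹) 1 :
    TangentSpace 𝓘(ℝ, E) (1 : G) →L[ℝ] TangentSpace 𝓘(ℝ, E) (u * 1 * u⁻¹))

/-- `Ad*(u)`, the algebraic dual of `Ad(u)`: `⟨Ad*(u) j, ξ⟩ = ⟨j, Ad(u) ξ⟩`. -/
def AdStar (u : G) : CoLieAlg E G →L[ℝ] CoLieAlg E G :=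
  ContinuousLinearMap.precomp ℝ (Ad u)

theorem contMDiff_conj :
    ContMDiff (𝓘(ℝ, E).prod 𝓘(ℝ, E)) 𝓘(ℝ, E) ∞ (uncurry fun u g : G => u * g * u⁻¹) :=
  (contMDiff_fst.mul contMDiff_snd).mul contMDiff_fst.inv

theorem contMDiff_conj_left (u : G) :
    ContMDiff 𝓘(ℝ, E) 𝓘(ℝ, E) ∞ (fun g : G => u * g * u⁻¹) :=
  (contMDiff_const.mul contMDiff_id).mul contMDiff_const

theorem Ad_one : Ad (E := E) (1 : G) = ContinuousLinearMap.id ℝ _ := by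
  have h : (fun g : G => 1 * g * 1⁻¹) = id := by ext; simp
  show (mfderiv 𝓘(ℝ, E) 𝓘(ℝ, E) (fun g : G => 1 * g * 1⁻¹) 1 : E →L[ℝ] E) = _
  rw [h]
  exact mfderiv_id

theorem Ad_mul (u v : G) : Ad (E := E) (u * v) = (Ad u).comp (Ad v) := by
  have hd : ∀ w : G, MDifferentiable 𝓘(ℝ, E) 𝓘(ℝ, E) (fun g : G => w * g * w⁻¹) := fun w =>
    (contMDiff_conj_left (E := E) w).mdifferentiable (by simp)
  have h : ∀ p : G, p = 1 →
      HasMFDerivAt 𝓘(ℝ, E) 𝓘(ℝ, E) (fun g : G => u * g * u⁻¹) p (Ad (E := E) u) := by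
    rintro p rfl
    exact (hd u 1).hasMFDerivAt
  have h1 := (h (v * 1 * v⁻¹) (by simp)).comp (1 : G) (hd v 1).hasMFDerivAt
  have h2 : (fun g : G => u * g * u⁻¹) ∘ (fun g : G => v * g * v⁻¹) =
      fun g => u * v * g * (u * v)⁻¹ := by
    ext g; simp [mul_assoc]
  rw [h2] at h1
  exact h1.mfderiv

theorem AdStar_one : AdStar (E := E) (1 : G) = ContinuousLinearMap.id ℝ _ := by
  ext q ξ
  simp [AdStar, Ad_one]

theorem AdStar_mul (u v : G) :
    AdStar (E := E) (u * v) = (AdStar v).comp (AdStar u) := by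
  ext q ξ
  simp [AdStar, Ad_mul]

/-- `ad*(p)`, the algebraic dual of `ad(p)`. -/
def adStar [FiniteDimensional ℝ E] (p : LieAlg E G) : CoLieAlg E G →L[ℝ] CoLieAlg E G :=
  ContinuousLinearMap.precomp ℝ (LinearMap.toContinuousLinearMap (LieAlgebra.ad ℝ (LieAlg E G) p))

/-- `T(u) = (1 - Ad*(u)) / ad*(p)` for `u = exp p`, that is the entire function
`(1 - e^z) / z = - ∑ z^k / (k+1)!` evaluated at `z = ad*(p)`. -/
def T [FiniteDimensional ℝ E] (u : G) : CoLieAlg E G →L[ℝ] CoLieAlg E G :=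
  -∑' k : ℕ, (((k + 1).factorial : ℝ)⁻¹ • adStar (lieLog u) ^ k)

variable (E G) in
/-- The group `H = G ⋉ 𝔤*`. -/
@[ext] structure Gauge where
  u : G
  a : CoLieAlg E G

instance : Mul (Gauge E G) := ⟨fun x y => ⟨x.u * y.u, x.a + AdStar x.u⁻¹ y.a⟩⟩
instance : One (Gauge E G) := ⟨⟨1, 0⟩⟩
instance : Inv (Gauge E G) := ⟨fun x => ⟨x.u⁻¹, -AdStar x.u x.a⟩⟩

theorem Gauge.mul_def (x y : Gauge E G) : x * y = ⟨x.u * y.u, x.a + AdStar x.u⁻¹ y.a⟩ := rfl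
theorem Gauge.one_def : (1 : Gauge E G) = ⟨1, 0⟩ := rfl
theorem Gauge.inv_def (x : Gauge E G) : x⁻¹ = ⟨x.u⁻¹, -AdStar x.u x.a⟩ := rfl

instance : Group (Gauge E G) :=
  Group.ofLeftAxioms
    (fun x y z => by
      simp [Gauge.mul_def, AdStar_mul, mul_assoc, add_assoc])
    (fun x => by simp [Gauge.mul_def, Gauge.one_def, AdStar_one])
    (fun x => by simp [Gauge.mul_def, Gauge.one_def, Gauge.inv_def])

/-- The map `g ↦ u g u⁻¹` as a smooth map. -/
def conjMap (u : G) : C^∞⟮𝓘(ℝ, E), G; 𝓘(ℝ, E), G⟯ := ⟨_, contMDiff_conj_left u⟩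

theorem comp_conjMap_apply (f : C^∞⟮𝓘(ℝ, E), G; 𝓘(ℝ, ℝ), ℝ⟯) (u g : G) :
    f.comp (conjMap u) g = f (u * g * u⁻¹) := rfl

variable (E G) in
/-- The group `G ⋉ C^∞(G)`. -/
@[ext] structure GenGauge where
  h : G
  f : C^∞⟮𝓘(ℝ, E), G; 𝓘(ℝ, ℝ), ℝ⟯

instance : Mul (GenGauge E G) := ⟨fun x y => ⟨x.h * y.h, x.f + y.f.comp (conjMap x.h⁻¹)⟩⟩
instance : One (GenGauge E G) := ⟨⟨1, 0⟩⟩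
instance : Inv (GenGauge E G) := ⟨fun x => ⟨x.h⁻¹, -x.f.comp (conjMap x.h)⟩⟩

theorem GenGauge.mul_def (x y : GenGauge E G) :
    x * y = ⟨x.h * y.h, x.f + y.f.comp (conjMap x.h⁻¹)⟩ := rfl
theorem GenGauge.one_def : (1 : GenGauge E G) = ⟨1, 0⟩ := rfl
theorem GenGauge.inv_def (x : GenGauge E G) : x⁻¹ = ⟨x.h⁻¹, -x.f.comp (conjMap x.h)⟩ := rfl

instance : Group (GenGauge E G) :=
  Group.ofLeftAxioms
    (fun x y z => by
      ext
      · simp [GenGauge.mul_def, mul_assoc]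
      · simp only [GenGauge.mul_def, ContMDiffMap.coe_add, Pi.add_apply, comp_conjMap_apply,
          mul_assoc, add_assoc, mul_inv_rev, inv_inv])
    (fun x => by
      ext
      · simp [GenGauge.mul_def, GenGauge.one_def]
      · rw [GenGauge.mul_def, ContMDiffMap.coe_add, Pi.add_apply, comp_conjMap_apply]
        simp [GenGauge.one_def])
    (fun x => by
      ext
      · simp [GenGauge.mul_def, GenGauge.one_def, GenGauge.inv_def]
      · simp [GenGauge.mul_def, GenGauge.one_def, GenGauge.inv_def])

end Lie

/-! ### Smooth functions on `G^{n+2g}` and invariant vector fields -/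

/-- The labels `M_1, …, M_n, A_1, B_1, …, A_g, B_g` of the holonomies. -/
abbrev Hol (n g : ℕ) : Type := Fin n ⊕ (Fin g ⊕ Fin g)

abbrev Hol.M {n g : ℕ} (i : Fin n) : Hol n g := Sum.inl i
abbrev Hol.A {n g : ℕ} (i : Fin g) : Hol n g := Sum.inr (Sum.inl i)
abbrev Hol.B {n g : ℕ} (i : Fin g) : Hol n g := Sum.inr (Sum.inr i)

/-- The strict partial order `M_1 < … < M_n < A_1, B_1 < … < A_g, B_g`
(`A_i` and `B_i` are not comparable). -/
def Prec {n g : ℕ} : Hol n g → Hol n g → Prop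
  | Sum.inl i, Sum.inl j => i < j
  | Sum.inl _, Sum.inr _ => True
  | Sum.inr _, Sum.inl _ => False
  | Sum.inr x, Sum.inr y => Sum.elim id id x < Sum.elim id id y

section Functions

variable (E : Type*) [NormedAddCommGroup E] [NormedSpace ℝ E]
  (G : Type*) [TopologicalSpace G] [ChartedSpace E G] [Group G]
  (n g : ℕ)

/-- `C^∞(G^{n+2g})`. -/
abbrev Fn : Type _ := C^∞⟮piModel (Hol n g) E, Hol n g → G; 𝓘(ℝ, ℝ), ℝ⟯

variable {E G n g} [LieGroup 𝓘(ℝ, E) ∞ G]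

/-- The derivation `F ↦ (d/dt) F(m(u, e^{tξ}))|_{t=0}` for a smooth map `m` with `m(u, 1) = u`. -/
def derAlong (m : (Hol n g → G) → G → (Hol n g → G))
    (hm : ContMDiff ((piModel (Hol n g) E).prod 𝓘(ℝ, E)) (piModel (Hol n g) E) ∞ (uncurry m))
    (hm1 : ∀ u, m u 1 = u) (ξ : LieAlg E G) : Derivation ℝ (Fn E G n g) (Fn E G n g) :=
  have hd : ∀ (F : Fn E G n g) (u : Hol n g → G),
      MDifferentiableAt 𝓘(ℝ, E) 𝓘(ℝ, ℝ) (fun y => F (m u y)) 1 := fun F u =>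
    ((F.contMDiff.comp hm).comp (contMDiff_const.prodMk contMDiff_id :
      ContMDiff 𝓘(ℝ, E) _ ∞ (fun y : G => (u, y)))).mdifferentiable (by simp) 1
  Derivation.mk'
    { toFun := fun F => ⟨fun u => mfderiv 𝓘(ℝ, E) 𝓘(ℝ, ℝ) (fun y => F (m u y)) 1 ξ,
        contMDiff_deriv_real 1 (fun u y => F (m u y)) (F.contMDiff.comp hm) ξ⟩
      map_add' := fun F F' => by
        ext u
        exact congrArg (fun D : E →L[ℝ] ℝ => D ξ) (mfderiv_add (hd F u) (hd F' u))
      map_smul' := fun c F => by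
        ext u
        exact congrArg (fun D : E →L[ℝ] ℝ => D ξ) (const_smul_mfderiv (hd F u) c) }
    (fun F F' => by
      ext u
      have h := congrArg (fun D : E →L[ℝ] ℝ => D ξ)
        ((hd F u).hasMFDerivAt.mul (hd F' u).hasMFDerivAt).mfderiv
      simp only [hm1] at h
      exact h)

theorem contMDiff_rightMul (X : Hol n g) :
    ContMDiff ((piModel (Hol n g) E).prod 𝓘(ℝ, E)) (piModel (Hol n g) E) ∞
      (uncurry fun (u : Hol n g → G) (y : G) => update u X (u X * y)) := by
  refine contMDiff_to_pi fun Y => ?_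
  by_cases h : Y = X
  · subst h
    have h1 : ContMDiff ((piModel (Hol n g) E).prod 𝓘(ℝ, E)) 𝓘(ℝ, E) ∞
        (fun p : (Hol n g → G) × G => p.1 Y * p.2) :=
      ((contMDiff_proj (M := G) Y).comp contMDiff_fst).mul contMDiff_snd
    simpa [uncurry] using h1
  · have h1 : ContMDiff ((piModel (Hol n g) E).prod 𝓘(ℝ, E)) 𝓘(ℝ, E) ∞
        (fun p : (Hol n g → G) × G => p.1 Y) := (contMDiff_proj Y).comp contMDiff_fst
    simpa [uncurry, h] using h1

theorem contMDiff_leftMul (X : Hol n g) :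
    ContMDiff ((piModel (Hol n g) E).prod 𝓘(ℝ, E)) (piModel (Hol n g) E) ∞
      (uncurry fun (u : Hol n g → G) (y : G) => update u X (y⁻¹ * u X)) := by
  refine contMDiff_to_pi fun Y => ?_
  by_cases h : Y = X
  · subst h
    have h1 : ContMDiff ((piModel (Hol n g) E).prod 𝓘(ℝ, E)) 𝓘(ℝ, E) ∞
        (fun p : (Hol n g → G) × G => p.2⁻¹ * p.1 Y) :=
      contMDiff_snd.inv.mul ((contMDiff_proj (M := G) Y).comp contMDiff_fst)
    simpa [uncurry] using h1
  · have h1 : ContMDiff ((piModel (Hol n g) E).prod 𝓘(ℝ, E)) 𝓘(ℝ, E) ∞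
        (fun p : (Hol n g → G) × G => p.1 Y) := (contMDiff_proj Y).comp contMDiff_fst
    simpa [uncurry, h] using h1

/-- `J^{R_X}_ξ F(u) = (d/dt) F(…, u_X e^{tξ}, …)|_{t=0}`. -/
def JR (X : Hol n g) (ξ : LieAlg E G) : Derivation ℝ (Fn E G n g) (Fn E G n g) :=
  derAlong (fun u y => update u X (u X * y)) (contMDiff_rightMul X) (by simp) ξ

/-- `J^{L_X}_ξ F(u) = (d/dt) F(…, e^{-tξ} u_X, …)|_{t=0}`. -/
def JL (X : Hol n g) (ξ : LieAlg E G) : Derivation ℝ (Fn E G n g) (Fn E G n g) :=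
  derAlong (fun u y => update u X (y⁻¹ * u X)) (contMDiff_leftMul X) (by simp) ξ

/-- Global conjugation `Ad_h^{n+2g}` of all holonomies by `h`. -/
def conjAll (h : G) :
    C^∞⟮piModel (Hol n g) E, Hol n g → G; piModel (Hol n g) E, Hol n g → G⟯ :=
  ⟨fun u X => h * u X * h⁻¹, contMDiff_to_pi fun X =>
    (contMDiff_const.mul (contMDiff_proj X)).mul contMDiff_const⟩

/-- The algebra homomorphism `F ↦ F ∘ Ad_h^{n+2g}`. -/
def pullConj (h : G) : Fn E G n g →ₐ[ℝ] Fn E G n g where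
  toFun F := F.comp (conjAll h)
  map_one' := rfl
  map_mul' _ _ := rfl
  map_zero' := rfl
  map_add' _ _ := rfl
  commutes' _ := rfl

theorem contMDiff_list_prod_map {α : Type*} (l : List α) (w : α → (Hol n g → G) → G)
    (hw : ∀ a, ContMDiff (piModel (Hol n g) E) 𝓘(ℝ, E) ∞ (w a)) :
    ContMDiff (piModel (Hol n g) E) 𝓘(ℝ, E) ∞ (fun u => (l.map fun a => w a u).prod) := by
  induction l with
  | nil => simpa using contMDiff_const
  | cons a l ih =>
    simp only [List.map_cons, List.prod_cons]
    exact (hw a).mul ih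

/-- `u_{K_i} = u_{B_i} u_{A_i}⁻¹ u_{B_i}⁻¹ u_{A_i}`. -/
def uK (u : Hol n g → G) (i : Fin g) : G :=
  u (Hol.B i) * (u (Hol.A i))⁻¹ * (u (Hol.B i))⁻¹ * u (Hol.A i)

/-- `Φ_∞(u) = u_tot = u_{K_g} ⋯ u_{K_1} u_{M_n} ⋯ u_{M_1}`. -/
def uTot (u : Hol n g → G) : G :=
  ((List.finRange g).reverse.map fun i => uK u i).prod *
    ((List.finRange n).reverse.map fun i => u (Hol.M i)).prod

theorem contMDiff_uTot :
    ContMDiff (piModel (Hol n g) E) 𝓘(ℝ, E) ∞ (uTot : (Hol n g → G) → G) := by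
  refine (contMDiff_list_prod_map _ (fun i u => uK u i) fun i => ?_).mul
    (contMDiff_list_prod_map _ (fun i u => u (Hol.M i)) fun i => contMDiff_proj _)
  exact (((contMDiff_proj _).mul (contMDiff_proj _).inv).mul (contMDiff_proj _).inv).mul
    (contMDiff_proj _)

/-- `Φ_∞` as a smooth map. -/
def Phi : C^∞⟮piModel (Hol n g) E, Hol n g → G; 𝓘(ℝ, E), G⟯ := ⟨uTot, contMDiff_uTot⟩

end Functions

/-! ### The flower algebra -/

section FlowerAlgebra

variable {E : Type*} [NormedAddCommGroup E] [NormedSpace ℝ E] [FiniteDimensional ℝ E]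
  {G : Type*} [TopologicalSpace G] [ChartedSpace E G] [Group G] [LieGroup 𝓘(ℝ, E) ∞ G]
  {n g : ℕ} {κ : Type*} [Fintype κ] [DecidableEq κ]

variable (E G n g κ) in
/-- The flower algebra `S(⨁ 𝔤) ⊗ C^∞(G^{n+2g})` as a commutative algebra: the polynomials with
coefficients in `C^∞(G^{n+2g})` in the variables `j^X_a`, where `a` runs over the index set `κ`
of a basis of `𝔤`. -/
abbrev FlowerAlg : Type _ := MvPolynomial (Hol n g × κ) (Fn E G n g)

/-- `FlowerAlg` is `S(⨁ 𝔤) ⊗ C^∞(G^{n+2g})`, with `S(⨁ 𝔤)` written as the polynomials in the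
`j^X_a`. -/
def flowerAlgEquivTensor :
    (Fn E G n g ⊗[ℝ] MvPolynomial (Hol n g × κ) ℝ) ≃ₐ[Fn E G n g] FlowerAlg E G n g κ :=
  MvPolynomial.algebraTensorAlgEquiv ℝ (Fn E G n g)

/-- The components `Ad*(h)_a^b`, that is `Ad*(h) P^b = ∑ a, Ad*(h)_a^b P^a` for the basis `P`
of `𝔤*` dual to `J`. -/
def adCoef (J : Module.Basis κ ℝ (LieAlg E G)) (h : G) (a b : κ) : ℝ := J.repr (Ad h (J a)) b

/-- The function `u ↦ Ad*(w(u))_a^b` for a smooth map `w : G^{n+2g} → G`. -/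
def adFn (J : Module.Basis κ ℝ (LieAlg E G)) (w : (Hol n g → G) → G)
    (hw : ContMDiff (piModel (Hol n g) E) 𝓘(ℝ, E) ∞ w) (a b : κ) : Fn E G n g :=
  ⟨fun u => adCoef J (w u) a b, by
    have h1 := contMDiff_deriv_fixed (E := E) (1 : G) (fun u g : G => u * g * u⁻¹) contMDiff_conj
      (by simp) (J a)
    have h2 := (LinearMap.toContinuousLinearMap (J.coord b :
      LieAlg E G →ₗ[ℝ] ℝ) : E →L[ℝ] ℝ).contMDiff.comp (h1.comp hw)
    exact h2⟩

/-- The structure constants: `[J_a, J_b] = ∑ c, f_{ab}^c J_c`. -/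
def strc (J : Module.Basis κ ℝ (LieAlg E G)) (a b c : κ) : ℝ := J.repr ⁅J a, J b⁆ c

variable (J : Module.Basis κ ℝ (LieAlg E G))

/-- The function `δ_a^b - Ad*(u_X)_a^b`. -/
def oneSubAd (X : Hol n g) (a b : κ) : Fn E G n g :=
  (if a = b then 1 else 0) - adFn J (fun u => u X) (contMDiff_proj X) a b

/-- The generator `j^X_a`. -/
abbrev gen (X : Hol n g) (a : κ) : FlowerAlg E G n g κ := MvPolynomial.X (X, a)

open Classical in
/-- For `X < Y` the bracket `{j^X_a, j^Y_b} = - ∑ (δ_a^d - Ad*(u_X)_a^d) f_{db}^c j^Y_c`, for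
`X = A_i`, `Y = B_i` the bracket `{j^X_a, j^Y_b} = - ∑ f_{ab}^c j^Y_c`, and `0` otherwise. -/
def upperBracket (p q : Hol n g × κ) : FlowerAlg E G n g κ :=
  if Prec p.1 q.1 then
    -∑ d, ∑ c, MvPolynomial.C (strc J d q.2 c • oneSubAd J p.1 p.2 d) * gen q.1 c
  else if ∃ i, p.1 = Hol.A i ∧ q.1 = Hol.B i then
    -∑ c, strc J p.2 q.2 c • gen q.1 c
  else 0

/-- The brackets `{j^X_a, j^Y_b}` of the generators. -/
def genBracket (p q : Hol n g × κ) : FlowerAlg E G n g κ :=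
  if p.1 = q.1 then -∑ c, strc J p.2 q.2 c • gen p.1 c
  else upperBracket J p q - upperBracket J q p

/-- `J^{R_X}_a + J^{L_X}_a`. -/
def conjField (X : Hol n g) (a : κ) : Derivation ℝ (Fn E G n g) (Fn E G n g) :=
  JR X (J a) + JL X (J a)

open Classical in
/-- `∑ b, (δ_a^b - Ad*(u_X)_a^b) ∑_{Y > X} (J^{R_Y}_b + J^{L_Y}_b)`. -/
def tailField (X : Hol n g) (a : κ) : Derivation ℝ (Fn E G n g) (Fn E G n g) :=
  ∑ b, oneSubAd J X a b • ∑ Y with Prec X Y, conjField J Y b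

theorem contMDiff_invBA (i : Fin g) : ContMDiff (piModel (Hol n g) E) 𝓘(ℝ, E) ∞
    (fun u : Hol n g → G => (u (Hol.B i))⁻¹ * u (Hol.A i)) :=
  (contMDiff_proj _).inv.mul (contMDiff_proj _)

/-- The derivation `F ↦ {j^X_a, F}` of `C^∞(G^{n+2g})`. -/
def genField : Hol n g → κ → Derivation ℝ (Fn E G n g) (Fn E G n g)
  | Sum.inl i, a => -conjField J (Hol.M i) a - tailField J (Hol.M i) a
  | Sum.inr (Sum.inl i), a =>
      -conjField J (Hol.A i) a - conjField J (Hol.B i) a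
        - ∑ b, adFn J (fun u : Hol n g → G => (u (Hol.B i))⁻¹ * u (Hol.A i)) (contMDiff_invBA i) a b • JR (Hol.B i) (J b)
        - tailField J (Hol.A i) a
  | Sum.inr (Sum.inr i), a =>
      -JL (Hol.A i) (J a) - conjField J (Hol.B i) a - tailField J (Hol.B i) a

/-- A derivation of `C^∞(G^{n+2g})` applied to the coefficients of a polynomial. -/
def onCoeffs (D : Derivation ℝ (Fn E G n g) (Fn E G n g)) (φ : FlowerAlg E G n g κ) :
    FlowerAlg E G n g κ :=
  ∑ m ∈ φ.support, MvPolynomial.monomial m (D (φ.coeff m))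

/-- The Poisson bracket of the flower algebra: the biderivation with the above values on the
generators, and with `{F, F'} = 0` for `F, F' ∈ C^∞(G^{n+2g})`. -/
def bracket (φ ψ : FlowerAlg E G n g κ) : FlowerAlg E G n g κ :=
  (∑ p, ∑ q, genBracket J p q * pderiv p φ * pderiv q ψ) +
    ∑ p : Hol n g × κ, (pderiv p φ * onCoeffs (genField J p.1 p.2) ψ
      - pderiv p ψ * onCoeffs (genField J p.1 p.2) φ)

theorem onCoeffs_C (D : Derivation ℝ (Fn E G n g) (Fn E G n g)) (F : Fn E G n g) :
    onCoeffs D (MvPolynomial.C F : FlowerAlg E G n g κ) = MvPolynomial.C (D F) := by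
  classical
  by_cases hF : F = 0
  · subst hF; simp [onCoeffs]
  · rw [onCoeffs, MvPolynomial.support_C, if_neg hF]
    rw [Finset.sum_singleton, MvPolynomial.coeff_zero_C]
    rfl

theorem onCoeffs_X (D : Derivation ℝ (Fn E G n g) (Fn E G n g)) (p : Hol n g × κ) :
    onCoeffs D (MvPolynomial.X p : FlowerAlg E G n g κ) = 0 := by
  classical
  refine Finset.sum_eq_zero fun m _ => ?_
  rw [MvPolynomial.coeff_X]
  split_ifs <;> simp

theorem bracket_gen_gen (p q : Hol n g × κ) :
    bracket J (MvPolynomial.X p) (MvPolynomial.X q) = genBracket J p q := by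
  simp [bracket, onCoeffs_X, Pi.single_apply]

theorem bracket_gen_C (X : Hol n g) (a : κ) (F : Fn E G n g) :
    bracket J (gen X a) (MvPolynomial.C F) = MvPolynomial.C (genField J X a F) := by
  simp [bracket, onCoeffs_X, onCoeffs_C, Pi.single_apply]

theorem bracket_C_C (F F' : Fn E G n g) :
    bracket J (MvPolynomial.C F : FlowerAlg E G n g κ) (MvPolynomial.C F') = 0 := by
  simp [bracket]

/-- The action of `(h, f) ∈ G ⋉ C^∞(G)` on the flower algebra: `F ↦ F ∘ Ad_{h⁻¹}^{n+2g}` and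
`j^X_a ↦ ∑ b, Ad*(h)_a^b (j^X_b + {j^X_b, f ∘ Φ_∞})`. -/
def genAct (k : GenGauge E G) : FlowerAlg E G n g κ →ₐ[ℝ] FlowerAlg E G n g κ :=
  MvPolynomial.aevalTower
    ((IsScalarTower.toAlgHom ℝ (Fn E G n g) (FlowerAlg E G n g κ)).comp (pullConj k.h⁻¹))
    (fun p => ∑ b, adCoef J k.h p.2 b •
      (gen p.1 b + bracket J (gen p.1 b) (MvPolynomial.C (k.f.comp Phi))))

/-- Evaluation of an element of the flower algebra at a point of `H^{n+2g}`, where `j^X_a` is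
the `a`-th component of the vector `j_X` in the parametrisation `(u_X, -Ad*(u_X⁻¹) j_X)`. -/
def evalAt (m : Hol n g → Gauge E G) : FlowerAlg E G n g κ →ₐ[ℝ] ℝ :=
  MvPolynomial.aevalTower
    { toFun := fun F : Fn E G n g => F fun X => (m X).u
      map_one' := rfl
      map_mul' := fun _ _ => rfl
      map_zero' := rfl
      map_add' := fun _ _ => rfl
      commutes' := fun _ => rfl }
    (fun p => (-AdStar (m p.1).u (m p.1).a) (J p.2))

end FlowerAlgebra

/-- `br` is a Poisson bracket on the commutative algebra `P`. -/
structure IsPoissonBracket {P : Type*} [CommRing P] [Algebra ℝ P] (br : P → P → P) : Prop where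
  add_left : ∀ x y z, br (x + y) z = br x z + br y z
  smul_left : ∀ (c : ℝ) x y, br (c • x) y = c • br x y
  skew : ∀ x y, br x y = -br y x
  leibniz : ∀ x y z, br x (y * z) = br x y * z + y * br x z
  jacobi : ∀ x y z, br x (br y z) + br y (br z x) + br z (br x y) = 0

end Flower

end

open Flower

/-! A tangent vector to G at u is recorded by the ζ in 𝔤 for which u moves to e^{tζ}u (`HasRD`). In
this right trivialisation a product c·d moves by ζ + Ad(c)ζ', and Ad(c)η varies by [ζ, Ad(c)η].
These two rules turn the geometric claims into identities in 𝔤.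

Poisson bracket. The Jacobi identity is not checked directly. The substitution j^X(ξ) ↦ ∑_Y
k^Y(S_{XY}(u)ξ) carries the flower bracket to one in which different k^Y commute, {k^Y(ξ), k^Y(η)} =
-k^Y([ξ,η]), and k^Y acts on functions by conjugation of u_{M_i} or by left translation of u_{A_i},
u_{B_i} (`decoupleHom_bracket`). That bracket is Poisson because it encodes independent
infinitesimal actions of 𝔤, one for each holonomy (`jac_decBracket`). At every u the operator S(u)
is invertible, being block triangular for the order of the holonomies; so the substitution is
injective (`decoupleHom_injective`) and the Jacobi identity pulls back.

Exponential map. The velocity of s ↦ exp(-sξ)exp(s(ξ+η)) is linear in η, and integrating it gives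
the derivative of exp at ξ: it is `expQuot` of ad ξ, that is (e^{ad ξ}-1)/ad ξ (`hasRD_expE`). If
this operator kills η, then Ad(exp ξ)η = η, so exp ξ commutes with exp(tη); injectivity of exp
forces Ad(exp(tη))ξ = ξ, hence [ξ,η] = 0, and then the operator fixes η, so η = 0
(`expQuot_adE_injective`). Thus T(u), minus the transpose of this operator at ξ = log u, is
invertible, log is smooth by the inverse function theorem, and the derivative of ⟨q, log⟩ in
right-invariant directions is -T(u)⁻¹q (`dR_logE`).

Action. The vector field of j^X(ξ) conjugates the holonomies above X, fixes those below, and moves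
u_tot with velocity (1-Ad(u_X))ξ (`hasVar_uTot`). Hence {j^X(ξ), ⟨q, log u_tot⟩} = -⟨x(u_tot),
(1-Ad(u_X))ξ⟩, which is the shift of j_X under conjugation in H (`conj_vector`). For the invariance
of the bracket write (h,f) = (1,f)(h,0). The factor (h,0) acts by simultaneous conjugation, under
which all the data are equivariant. The factor (1,f) acts on generators by j ↦ j + {j, f∘Φ_∞}, the
exponential of {·, f∘Φ_∞}, which stops there because functions commute; the Jacobi identity makes it
a Poisson map (`genAct_bracket`). -/

noncomputable section

namespace Flower

open Set Function MvPolynomial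

/-! ### Calculus on manifolds: parametrised derivatives and symmetry of mixed derivatives -/

section Calculus

variable {E : Type*} [NormedAddCommGroup E] [NormedSpace ℝ E]
  {V : Type*} [NormedAddCommGroup V] [NormedSpace ℝ V]
  {M : Type*} [TopologicalSpace M] [ChartedSpace E M]

theorem two_le_infty : (2 : WithTop ℕ∞) ≤ ∞ := WithTop.coe_le_coe.2 (le_top : (2 : ℕ∞) ≤ ⊤)

theorem one_add_one_le_infty : (1 + 1 : WithTop ℕ∞) ≤ ∞ := by
  rw [one_add_one_eq_two]; exact two_le_infty

theorem mfderiv_eq_fderiv_chart {f : M → V} {x : M}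
    (hf : MDifferentiableAt 𝓘(ℝ, E) 𝓘(ℝ, V) f x) :
    (mfderiv 𝓘(ℝ, E) 𝓘(ℝ, V) f x : E →L[ℝ] V) =
      fderiv ℝ (f ∘ (extChartAt 𝓘(ℝ, E) x).symm) (extChartAt 𝓘(ℝ, E) x x) := by
  rw [hf.mfderiv]
  simp only [modelWithCornersSelf_coe, range_id, fderivWithin_univ]
  rfl

variable (E) in
/-- The derivative at `x` of a map to a normed space, as a map between the model spaces. -/
def mderiv (f : M → V) (x : M) : E →L[ℝ] V := mfderiv 𝓘(ℝ, E) 𝓘(ℝ, V) f x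

/-- The base point `g` is fixed and the target is a vector space, so the tangent coordinate changes
that enter `ContMDiffAt.mfderiv` are identities. -/
theorem contMDiff_mfderiv_clm {E' : Type*} [NormedAddCommGroup E'] [NormedSpace ℝ E']
    {H' : Type*} [TopologicalSpace H'] {I' : ModelWithCorners ℝ E' H'} {N : Type*}
    [TopologicalSpace N] [ChartedSpace H' N] [IsManifold I' 1 N] [IsManifold 𝓘(ℝ, E) 1 M] (g : M)
    (f : N → M → V) (hf : ContMDiff (I'.prod 𝓘(ℝ, E)) 𝓘(ℝ, V) ∞ (uncurry f)) :
    ContMDiff I' 𝓘(ℝ, E →L[ℝ] V) ∞ (fun x => mderiv E (f x) g) := by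
  intro x₀
  have h := ContMDiffAt.mfderiv (m := ∞) (n := ∞) (x₀ := x₀) f (fun _ => g) (hf _)
    contMDiffAt_const (by simp)
  refine h.congr_of_eventuallyEq (Filter.Eventually.of_forall fun x => ?_)
  have h3 := inTangentCoordinates_eq (I := 𝓘(ℝ, E)) (I' := 𝓘(ℝ, V)) (fun _ : N => g)
    (fun x => f x g) (fun x => mfderiv 𝓘(ℝ, E) 𝓘(ℝ, V) (f x) g) (x₀ := x₀) (x := x)
    (mem_chart_source E g) (mem_univ _)
  refine Eq.trans ?_ h3.symm
  rw [tangentBundleCore_coordChange_model_space]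
  ext ξ
  have h4 := (tangentBundleCore 𝓘(ℝ, E) M).coordChange_self (achart E g) g (by simp) ξ
  exact congrArg (mfderiv 𝓘(ℝ, E) 𝓘(ℝ, V) (f x) g) h4.symm

theorem contMDiff_mfderiv_apply {E' : Type*} [NormedAddCommGroup E'] [NormedSpace ℝ E']
    {H' : Type*} [TopologicalSpace H'] {I' : ModelWithCorners ℝ E' H'} {N : Type*}
    [TopologicalSpace N] [ChartedSpace H' N] [IsManifold I' 1 N] [IsManifold 𝓘(ℝ, E) 1 M] (g : M)
    (f : N → M → V) (hf : ContMDiff (I'.prod 𝓘(ℝ, E)) 𝓘(ℝ, V) ∞ (uncurry f)) (ξ : E) :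
    ContMDiff I' 𝓘(ℝ, V) ∞
      (fun x => ((mfderiv 𝓘(ℝ, E) 𝓘(ℝ, V) (f x) g : E →L[ℝ] V) ξ : V)) :=
  (contMDiff_mfderiv_clm g f hf).clm_apply contMDiff_const

theorem hasMFDerivAt_clm_apply {W : Type*} [NormedAddCommGroup W] [NormedSpace ℝ W]
    {A : M → W →L[ℝ] V} {w : M → W} {x : M} {A' : E →L[ℝ] W →L[ℝ] V} {w' : E →L[ℝ] W}
    (hA : HasMFDerivAt 𝓘(ℝ, E) 𝓘(ℝ, W →L[ℝ] V) A x A')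
    (hw : HasMFDerivAt 𝓘(ℝ, E) 𝓘(ℝ, W) w x w') :
    HasMFDerivAt 𝓘(ℝ, E) 𝓘(ℝ, V) (fun y => A y (w y)) x
      ((A x).comp w' + A'.flip (w x) : E →L[ℝ] V) := by
  refine ⟨hA.1.clm_apply hw.1, ?_⟩
  have h1 : HasFDerivAt (A ∘ (extChartAt 𝓘(ℝ, E) x).symm) A' (extChartAt 𝓘(ℝ, E) x x) := by
    have := hA.2
    simp only [modelWithCornersSelf_coe, range_id] at this
    exact hasFDerivWithinAt_univ.1 this
  have h2 : HasFDerivAt (w ∘ (extChartAt 𝓘(ℝ, E) x).symm) w' (extChartAt 𝓘(ℝ, E) x x) := by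
    have := hw.2
    simp only [modelWithCornersSelf_coe, range_id] at this
    exact hasFDerivWithinAt_univ.1 this
  have h3 := h1.clm_apply h2
  simp only [comp_apply, extChartAt_to_inv] at h3
  exact h3.hasFDerivWithinAt

/-- With one fixed chart for each variable, the iterated manifold derivative becomes a mixed second
derivative of a single function on E × E. Only smoothness near the slice `y = b` is needed to
differentiate first in `y` and then in `x`. -/
theorem mfderiv_mfderiv_eq_chart [IsManifold 𝓘(ℝ, E) ∞ M] (a b : M) (f : M → M → V)
    (hf : ContMDiff (𝓘(ℝ, E).prod 𝓘(ℝ, E)) 𝓘(ℝ, V) ∞ (uncurry f)) (ξ η : E)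
    (φ : E × E → V) (hφ : φ = fun p => f ((extChartAt 𝓘(ℝ, E) a).symm p.1)
      ((extChartAt 𝓘(ℝ, E) b).symm p.2)) :
    ContDiffAt ℝ ∞ φ (extChartAt 𝓘(ℝ, E) a a, extChartAt 𝓘(ℝ, E) b b) ∧
    (mfderiv 𝓘(ℝ, E) 𝓘(ℝ, V)
      (fun x => (mfderiv 𝓘(ℝ, E) 𝓘(ℝ, V) (fun y => f x y) b : E →L[ℝ] V) η) a : E →L[ℝ] V) ξ =
    fderiv ℝ (fderiv ℝ φ) (extChartAt 𝓘(ℝ, E) a a, extChartAt 𝓘(ℝ, E) b b) (ξ, 0) (0, η) := by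
  have : IsManifold 𝓘(ℝ, E) 1 M := IsManifold.of_le (n := ∞) (by simp)
  set e := extChartAt 𝓘(ℝ, E) a with he
  set e' := extChartAt 𝓘(ℝ, E) b with he'
  have hsm : ∀ x ∈ e.target, ContDiffAt ℝ ∞ φ (x, e' b) := by
    intro x hx
    have h1 : ContMDiffAt 𝓘(ℝ, E) 𝓘(ℝ, E) ∞ e.symm x :=
      (contMDiffOn_extChartAt_symm a).contMDiffAt (extChartAt_target_mem_nhds' hx)
    have h2 : ContMDiffAt 𝓘(ℝ, E) 𝓘(ℝ, E) ∞ e'.symm (e' b) :=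
      (contMDiffOn_extChartAt_symm b).contMDiffAt (extChartAt_target_mem_nhds b)
    have h3 : ContMDiffAt 𝓘(ℝ, E × E) (𝓘(ℝ, E).prod 𝓘(ℝ, E)) ∞
        (fun p : E × E => (e.symm p.1, e'.symm p.2)) (x, e' b) :=
      (ContMDiffAt.comp (x, e' b) h1 contDiff_fst.contMDiff.contMDiffAt).prodMk
        (ContMDiffAt.comp (x, e' b) h2 contDiff_snd.contMDiff.contMDiffAt)
    rw [hφ]
    exact (ContMDiffAt.comp (x, e' b) (hf _) h3).contDiffAt
  have ha : e a ∈ e.target := mem_extChartAt_target a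
  refine ⟨hsm _ ha, ?_⟩
  have hd : MDifferentiableAt 𝓘(ℝ, E) 𝓘(ℝ, V)
      (fun x => (mfderiv 𝓘(ℝ, E) 𝓘(ℝ, V) (fun y => f x y) b : E →L[ℝ] V) η) a :=
    (contMDiff_mfderiv_apply b f hf η).mdifferentiable (by simp) a
  rw [mfderiv_eq_fderiv_chart hd]
  have hev : ((fun x => (mfderiv 𝓘(ℝ, E) 𝓘(ℝ, V) (fun y => f x y) b : E →L[ℝ] V) η) ∘ e.symm)
      =ᶠ[nhds (e a)] fun x => fderiv ℝ φ (x, e' b) (0, η) := by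
    filter_upwards [extChartAt_target_mem_nhds a] with x hx
    have h1 : MDifferentiableAt 𝓘(ℝ, E) 𝓘(ℝ, V) (fun y => f (e.symm x) y) b :=
      (hf.comp (contMDiff_const.prodMk contMDiff_id : ContMDiff 𝓘(ℝ, E) (𝓘(ℝ, E).prod 𝓘(ℝ, E)) ∞
        (fun y : M => (e.symm x, y)))).mdifferentiable (by simp) b
    have h2 : HasFDerivAt (fun y : E => ((x, y) : E × E)) (ContinuousLinearMap.inr ℝ E E) (e' b) :=
      hasFDerivAt_prodMk_right x (e' b)
    have h3 := ((hsm x hx).differentiableAt (by simp)).hasFDerivAt.comp (e' b) h2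
    have h4 : (fun y => f (e.symm x) y) ∘ e'.symm = φ ∘ (fun y : E => ((x, y) : E × E)) := by
      ext y; rw [hφ]; rfl
    show (mfderiv 𝓘(ℝ, E) 𝓘(ℝ, V) (fun y => f (e.symm x) y) b : E →L[ℝ] V) η = _
    rw [mfderiv_eq_fderiv_chart h1, ← he', h4, h3.fderiv]
    rfl
  rw [hev.fderiv_eq]
  have h5 : DifferentiableAt ℝ (fderiv ℝ φ) (e a, e' b) :=
    ((hsm _ ha).fderiv_right (m := 1) one_add_one_le_infty).differentiableAt (by simp)
  have h6 : HasFDerivAt (fun x : E => ((x, e' b) : E × E)) (ContinuousLinearMap.inl ℝ E E) (e a) :=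
    hasFDerivAt_prodMk_left (e a) (e' b)
  have h7 := ((ContinuousLinearMap.apply ℝ V ((0, η) : E × E)).hasFDerivAt).comp (e a)
    (h5.hasFDerivAt.comp (e a) h6)
  have h8 := h7.fderiv
  have h9 : (⇑((ContinuousLinearMap.apply ℝ V) ((0, η) : E × E)) ∘
      fderiv ℝ φ ∘ fun x : E => ((x, e' b) : E × E)) = fun x => fderiv ℝ φ (x, e' b) (0, η) := rfl
  rw [h9] at h8
  rw [h8]
  rfl

/-- Schwarz's theorem in the charts; the reversed order of differentiation is the same computation
for `φ` composed with the swap of E × E. All commutator formulas below come from this symmetry. -/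
theorem mfderiv_mfderiv_symm [IsManifold 𝓘(ℝ, E) ∞ M] (a b : M) (f : M → M → V)
    (hf : ContMDiff (𝓘(ℝ, E).prod 𝓘(ℝ, E)) 𝓘(ℝ, V) ∞ (uncurry f)) (ξ η : E) :
    (mfderiv 𝓘(ℝ, E) 𝓘(ℝ, V)
      (fun x => (mfderiv 𝓘(ℝ, E) 𝓘(ℝ, V) (fun y => f x y) b : E →L[ℝ] V) η) a : E →L[ℝ] V) ξ =
    (mfderiv 𝓘(ℝ, E) 𝓘(ℝ, V)
      (fun y => (mfderiv 𝓘(ℝ, E) 𝓘(ℝ, V) (fun x => f x y) a : E →L[ℝ] V) ξ) b : E →L[ℝ] V) η := by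
  obtain ⟨h1, h2⟩ := mfderiv_mfderiv_eq_chart a b f hf ξ η _ rfl
  have hf' : ContMDiff (𝓘(ℝ, E).prod 𝓘(ℝ, E)) 𝓘(ℝ, V) ∞ (uncurry fun y x => f x y) :=
    hf.comp (contMDiff_snd.prodMk contMDiff_fst)
  obtain ⟨-, h4⟩ := mfderiv_mfderiv_eq_chart b a (fun y x => f x y) hf' η ξ _ rfl
  rw [h2, h4]
  set φ : E × E → V := fun p => f ((extChartAt 𝓘(ℝ, E) a).symm p.1)
      ((extChartAt 𝓘(ℝ, E) b).symm p.2) with hφ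
  set S := (ContinuousLinearEquiv.prodComm ℝ E E)
  have h5 : (fun p : E × E => f ((extChartAt 𝓘(ℝ, E) a).symm p.2)
      ((extChartAt 𝓘(ℝ, E) b).symm p.1)) = φ ∘ S := rfl
  have h6 : fderiv ℝ (φ ∘ S) = fun p => (fderiv ℝ φ (S p)).comp (S : E × E →L[ℝ] E × E) := by
    ext1 p
    exact S.comp_right_fderiv
  have h7 : DifferentiableAt ℝ (fderiv ℝ φ) (extChartAt 𝓘(ℝ, E) a a, extChartAt 𝓘(ℝ, E) b b) :=
    (h1.fderiv_right (m := 1) one_add_one_le_infty).differentiableAt (by simp)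
  have h8 : HasFDerivAt (fun p => (fderiv ℝ φ (S p)).comp (S : E × E →L[ℝ] E × E)) _
      (extChartAt 𝓘(ℝ, E) b b, extChartAt 𝓘(ℝ, E) a a) :=
    (((ContinuousLinearMap.compL ℝ (E × E) (E × E) V).flip
      (S : E × E →L[ℝ] E × E)).hasFDerivAt).comp _
      (HasFDerivAt.comp (extChartAt 𝓘(ℝ, E) b b, extChartAt 𝓘(ℝ, E) a a)
        (g := fderiv ℝ φ) (f := S) h7.hasFDerivAt S.hasFDerivAt)
  rw [h5, h6, h8.fderiv]
  exact h1.isSymmSndFDerivAt (by simpa using two_le_infty) (ξ, 0) (0, η)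

end Calculus

/-! ### Right logarithmic derivatives -/

section Lie
variable {E : Type*} [NormedAddCommGroup E] [NormedSpace ℝ E]
  {G : Type*} [TopologicalSpace G] [ChartedSpace E G] [Group G] [LieGroup 𝓘(ℝ, E) ∞ G]
  {EN : Type*} [NormedAddCommGroup EN] [NormedSpace ℝ EN] {HN : Type*} [TopologicalSpace HN]
  {I : ModelWithCorners ℝ EN HN} {N : Type*} [TopologicalSpace N] [ChartedSpace HN N]
  {V : Type*} [NormedAddCommGroup V] [NormedSpace ℝ V]

/-- The derivative is typed as a map of model spaces, because the tangent spaces at `f x` and `f' x`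
are different types and a direct rewrite of the function would not typecheck. -/
theorem hasMFDerivAt_of_eq {f f' : N → G} {x : N} {L : EN →L[ℝ] E}
    (h : HasMFDerivAt I 𝓘(ℝ, E) f x L) (hf : ∀ y, f' y = f y) :
    HasMFDerivAt I 𝓘(ℝ, E) f' x L := by
  obtain rfl := funext hf
  exact h

theorem hasMFDerivAt_mul_of_one {a b : N → G} {x : N} {A B : EN →L[ℝ] E} (ha : a x = 1)
    (hb : b x = 1) (hA : HasMFDerivAt I 𝓘(ℝ, E) a x A) (hB : HasMFDerivAt I 𝓘(ℝ, E) b x B) :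
    HasMFDerivAt I 𝓘(ℝ, E) (fun y => a y * b y) x (A + B : EN →L[ℝ] E) := by
  have hd : MDifferentiable (𝓘(ℝ, E).prod 𝓘(ℝ, E)) 𝓘(ℝ, E) (fun p : G × G => p.1 * p.2) :=
    (contMDiff_mul 𝓘(ℝ, E) ∞).mdifferentiable (by simp)
  have h1 : HasMFDerivAt (𝓘(ℝ, E).prod 𝓘(ℝ, E)) 𝓘(ℝ, E) (fun p : G × G => p.1 * p.2) (1, 1)
      (ContinuousLinearMap.fst ℝ E E + ContinuousLinearMap.snd ℝ E E : E × E →L[ℝ] E) := by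
    have h2 := (hd (1, 1)).hasMFDerivAt
    have h3 := mfderiv_prod_eq_add (hd (1, 1))
    have h4 : (fun z : G × G => z.1 * (1 : G)) = Prod.fst := by ext; simp
    have h5 : (fun z : G × G => (1 : G) * z.2) = Prod.snd := by ext; simp
    have h6 : (mfderiv (𝓘(ℝ, E).prod 𝓘(ℝ, E)) 𝓘(ℝ, E) (fun p : G × G => p.1 * p.2) (1, 1) :
        E × E →L[ℝ] E) = ContinuousLinearMap.fst ℝ E E + ContinuousLinearMap.snd ℝ E E := by
      rw [h3]
      dsimp only
      rw [h4, h5, mfderiv_fst, mfderiv_snd]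
      rfl
    rwa [h6] at h2
  have h7 : ∀ p : G × G, p = (1, 1) →
      HasMFDerivAt (𝓘(ℝ, E).prod 𝓘(ℝ, E)) 𝓘(ℝ, E) (fun p : G × G => p.1 * p.2) p
      (ContinuousLinearMap.fst ℝ E E + ContinuousLinearMap.snd ℝ E E : E × E →L[ℝ] E) := by
    rintro p rfl; exact h1
  have h8 := (h7 (a x, b x) (by rw [ha, hb])).comp x (hA.prodMk hB)
  convert! h8 using 1

theorem hasMFDerivAt_inv_one :
    HasMFDerivAt 𝓘(ℝ, E) 𝓘(ℝ, E) (fun y : G => y⁻¹) 1 (-ContinuousLinearMap.id ℝ E : E →L[ℝ] E) := by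
  have hd : MDifferentiableAt 𝓘(ℝ, E) 𝓘(ℝ, E) (fun y : G => y⁻¹) 1 :=
    (contMDiff_inv 𝓘(ℝ, E) ∞).mdifferentiable (by simp) 1
  have h := hd.hasMFDerivAt
  have h1 := hasMFDerivAt_mul_of_one (a := fun y : G => y) (b := fun y : G => y⁻¹) (x := 1) rfl
    (by simp) (hasMFDerivAt_id 1) h
  have h2 : (fun y : G => y * y⁻¹) = fun _ => 1 := by ext; simp
  rw [h2] at h1
  have h3 := hasMFDerivAt_unique h1 (hasMFDerivAt_const (1 : G) (1 : G))
  have h4 : (mfderiv 𝓘(ℝ, E) 𝓘(ℝ, E) (fun y : G => y⁻¹) 1 : E →L[ℝ] E) =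
      -ContinuousLinearMap.id ℝ E := (neg_eq_of_add_eq_zero_right h3).symm
  rwa [h4] at h

theorem hasMFDerivAt_Ad (u : G) {p : G} (hp : p = 1) :
    HasMFDerivAt 𝓘(ℝ, E) 𝓘(ℝ, E) (fun g : G => u * g * u⁻¹) p (Ad (E := E) u) := by
  subst hp
  exact ((contMDiff_conj_left (E := E) u).mdifferentiable (by simp) 1).hasMFDerivAt

/-- `c` has right logarithmic derivative `L` at `x`: the derivative of `y ↦ c y * (c x)⁻¹`. -/
def HasRD (I : ModelWithCorners ℝ EN HN) (c : N → G) (x : N) (L : EN →L[ℝ] LieAlg E G) : Prop :=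
  HasMFDerivAt I 𝓘(ℝ, E) (fun y => c y * (c x)⁻¹) x (L : EN →L[ℝ] E)

theorem HasRD.unique {c : N → G} {x : N} {L L' : EN →L[ℝ] LieAlg E G} (h : HasRD I c x L)
    (h' : HasRD I c x L') : L = L' :=
  hasMFDerivAt_unique (f := fun y => c y * (c x)⁻¹) (I' := 𝓘(ℝ, E)) h h'

theorem hasRD_const (g : G) (x : N) : HasRD (E := E) I (fun _ => g) x 0 := by
  unfold HasRD
  exact hasMFDerivAt_const _ _

/-- The quotient c(y)d(y)(c(x)d(x))⁻¹ is the product of c(y)c(x)⁻¹ and the conjugate by c(x) of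
d(y)d(x)⁻¹. Both factors are `1` at `x`, where multiplication has derivative addition. -/
theorem HasRD.mul {c d : N → G} {x : N} {L L' : EN →L[ℝ] LieAlg E G} (h : HasRD I c x L)
    (h' : HasRD I d x L') : HasRD I (fun y => c y * d y) x (L + (Ad (c x)).comp L') := by
  have h1 := (hasMFDerivAt_Ad (E := E) (c x) (p := d x * (d x)⁻¹) (by simp)).comp x h'
  have h2 := hasMFDerivAt_mul_of_one (by simp) (by simp) h h1
  exact hasMFDerivAt_of_eq h2 fun y => by simp [mul_assoc]

theorem HasRD.inv {c : N → G} {x : N} {L : EN →L[ℝ] LieAlg E G} (h : HasRD I c x L) :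
    HasRD I (fun y => (c y)⁻¹) x (-(Ad (c x)⁻¹).comp L) := by
  have h0 : ∀ p : G, p = 1 → HasMFDerivAt 𝓘(ℝ, E) 𝓘(ℝ, E) (fun y : G => y⁻¹) p
      (-ContinuousLinearMap.id ℝ E : E →L[ℝ] E) := by
    rintro p rfl; exact hasMFDerivAt_inv_one
  have h1 := (h0 (c x * (c x)⁻¹) (by simp)).comp x h
  have h2 := (hasMFDerivAt_Ad (E := E) (c x)⁻¹
    (p := ((fun y : G => y⁻¹) ∘ fun y => c y * (c x)⁻¹) x) (by simp)).comp x h1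
  have h3 : (-(Ad (c x)⁻¹).comp L : EN →L[ℝ] LieAlg E G) = (Ad (c x)⁻¹).comp (-L) := by
    ext v
    simp
  rw [h3]
  exact hasMFDerivAt_of_eq h2 fun y => by simp [mul_assoc]

theorem HasRD.comp {EN' : Type*} [NormedAddCommGroup EN'] [NormedSpace ℝ EN'] {HN' : Type*}
    [TopologicalSpace HN'] {I' : ModelWithCorners ℝ EN' HN'} {N' : Type*} [TopologicalSpace N']
    [ChartedSpace HN' N'] {c : N → G} {d : N' → N} {x : N'} {L : EN →L[ℝ] LieAlg E G}
    {D : EN' →L[ℝ] EN} (h : HasRD I c (d x) L) (h' : HasMFDerivAt I' I d x D) :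
    HasRD I' (fun y => c (d y)) x (L.comp D) :=
  HasMFDerivAt.comp x h h'

theorem hasRD_id : HasRD 𝓘(ℝ, E) (fun y : G => y) 1 (ContinuousLinearMap.id ℝ _) :=
  hasMFDerivAt_of_eq (L := ContinuousLinearMap.id ℝ E) (hasMFDerivAt_id (I := 𝓘(ℝ, E)) (1 : G))
    fun y => by simp

theorem hasRD_of_one {c : N → G} {x : N} (hx : c x = 1) {L : EN →L[ℝ] E}
    (h : HasMFDerivAt I 𝓘(ℝ, E) c x L) : HasRD I c x L :=
  hasMFDerivAt_of_eq h fun y => by simp [hx]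

variable (E) in
/-- The derivative of `f` at `g` in right-invariant directions: `ζ ↦ (d/dt) f(e^{tζ} g)`. -/
def dR (f : G → V) (g : G) : E →L[ℝ] V := mderiv E (fun y : G => f (y * g)) 1

theorem contMDiff_mul_const (g : G) : ContMDiff 𝓘(ℝ, E) 𝓘(ℝ, E) ∞ (fun y : G => y * g) :=
  contMDiff_id.mul contMDiff_const

/-- Chain rule through f(c(y)) = f((c(y)c(x)⁻¹)·c(x)), so that the inner map takes the value `1` at
`x`. -/
theorem HasRD.comp_fun {f : G → V} {c : N → G} {x : N} {L : EN →L[ℝ] LieAlg E G}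
    (h : HasRD I c x L) (hf : MDifferentiableAt 𝓘(ℝ, E) 𝓘(ℝ, V) f (c x)) :
    HasMFDerivAt I 𝓘(ℝ, V) (fun y => f (c y)) x ((dR E f (c x)).comp (L : EN →L[ℝ] E) : EN →L[ℝ] V) := by
  have h0 : ∀ p : G, p = 1 → HasMFDerivAt 𝓘(ℝ, E) 𝓘(ℝ, V) (fun y : G => f (y * c x)) p
      (dR E f (c x) : E →L[ℝ] V) := by
    rintro p rfl
    have h1 : MDifferentiableAt 𝓘(ℝ, E) 𝓘(ℝ, E) (fun y : G => y * c x) 1 :=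
      (contMDiff_mul_const (E := E) (c x)).mdifferentiable (by simp) 1
    have h2 : ∀ q : G, q = c x → MDifferentiableAt 𝓘(ℝ, E) 𝓘(ℝ, V) f q := by
      rintro q rfl; exact hf
    exact (MDifferentiableAt.comp (1 : G) (h2 (1 * c x) (by simp)) h1).hasMFDerivAt
  have h1 := (h0 (c x * (c x)⁻¹) (by simp)).comp x h
  have h2 : (fun y => f (c y)) = (fun y => f (y * c x)) ∘ fun y => c y * (c x)⁻¹ := by
    ext y; simp
  rw [h2]
  exact h1

theorem HasRD.hasDerivAt_comp {f : G → V} {c : ℝ → G} {s : ℝ} {v : LieAlg E G}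
    (h : HasRD 𝓘(ℝ, ℝ) c s (ContinuousLinearMap.toSpanSingleton ℝ v))
    (hf : MDifferentiableAt 𝓘(ℝ, E) 𝓘(ℝ, V) f (c s)) :
    HasDerivAt (fun t => f (c t)) (dR E f (c s) v) s := by
  have h1 : HasFDerivAt (fun t => f (c t)) (((dR E f (c s)).comp
      (ContinuousLinearMap.toSpanSingleton ℝ (v : E)) : ℝ →L[ℝ] V)) s := (h.comp_fun hf).hasFDerivAt
  have h2 := h1.hasDerivAt
  have h3 : ((dR E f (c s)).comp (ContinuousLinearMap.toSpanSingleton ℝ (v : E)) : ℝ →L[ℝ] V) 1 =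
    dR E f (c s) v := congrArg (dR E f (c s)) (one_smul ℝ v)
  rwa [h3] at h2

end Lie

/-! ### The Lie bracket as the derivative of the adjoint action -/

section Lie
variable {E : Type*} [NormedAddCommGroup E] [NormedSpace ℝ E] [FiniteDimensional ℝ E]
  {G : Type*} [TopologicalSpace G] [T2Space G] [ChartedSpace E G] [Group G] [LieGroup 𝓘(ℝ, E) ∞ G]
  {EN : Type*} [NormedAddCommGroup EN] [NormedSpace ℝ EN] {HN : Type*} [TopologicalSpace HN]
  {I : ModelWithCorners ℝ EN HN} {N : Type*} [TopologicalSpace N] [ChartedSpace HN N]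

variable (E G) in
/-- A globally defined smooth map that agrees with the chart at `1` near `1`. -/
theorem exists_coord : ∃ χ : G → E, ContMDiff 𝓘(ℝ, E) 𝓘(ℝ, E) ∞ χ ∧
    χ =ᶠ[nhds 1] extChartAt 𝓘(ℝ, E) (1 : G) := by
  obtain ⟨f⟩ : Nonempty (SmoothBumpFunction 𝓘(ℝ, E) (1 : G)) := inferInstance
  refine ⟨fun y => f y • extChartAt 𝓘(ℝ, E) (1 : G) y,
    f.contMDiff_smul (contMDiffOn_extChartAt), ?_⟩
  filter_upwards [f.eventuallyEq_one] with y hy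
  rw [hy]; simp

variable (E G) in
/-- A smooth map `G → E` that agrees with the chart at `1` near `1`. -/
def coord : G → E := (exists_coord E G).choose

theorem contMDiff_coord : ContMDiff 𝓘(ℝ, E) 𝓘(ℝ, E) ∞ (coord E G) :=
  (exists_coord E G).choose_spec.1

theorem coord_eventuallyEq : coord E G =ᶠ[nhds 1] extChartAt 𝓘(ℝ, E) (1 : G) :=
  (exists_coord E G).choose_spec.2

theorem mdifferentiable_coord : MDifferentiable 𝓘(ℝ, E) 𝓘(ℝ, E) (coord E G) :=
  contMDiff_coord.mdifferentiable (by simp)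

theorem mfderiv_coord_one :
    mderiv E (coord E G) 1 = ContinuousLinearMap.id ℝ E := by
  rw [mderiv, coord_eventuallyEq.mfderiv_eq, mfderiv_extChartAt_self]
  rfl

theorem dR_coord_one : dR E (coord E G) 1 = ContinuousLinearMap.id ℝ E := by
  unfold dR
  have h : (fun y : G => coord E G (y * 1)) = coord E G := by ext; simp
  rw [h]; exact mfderiv_coord_one

theorem hasRD_mul_left (g : G) : HasRD 𝓘(ℝ, E) (fun y : G => g * y) 1 (Ad g) := by
  have h := (hasRD_const (E := E) (I := 𝓘(ℝ, E)) g (1 : G)).mul (hasRD_id (E := E) (G := G))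
  have h2 : (0 + (Ad g).comp (ContinuousLinearMap.id ℝ (LieAlg E G)) :
    LieAlg E G →L[ℝ] LieAlg E G) = Ad g := by ext; simp
  rw [← h2]; exact h

variable (E) in
/-- The derivative at `g` in the left-invariant direction `η` of the coordinate map. -/
def coordL (η : E) (g : G) : E :=
  mderiv E (fun y : G => coord E G (g * y)) 1 η

variable (E) in
/-- `Ad(u)` as a map of the model space. -/
def AdE (u : G) : E →L[ℝ] E := Ad u

/-- The left-invariant direction η at g is the right-invariant direction Ad(g)η, since g e^{tη} =
e^{tAd(g)η} g. -/
theorem coordL_eq (η : LieAlg E G) (g : G) : coordL E η g = dR E (coord E G) g (Ad g η) := by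
  have h := (hasRD_mul_left (E := E) g).comp_fun (f := coord E G)
    (mdifferentiable_coord (g * 1))
  have h2 := congrArg (fun L : E →L[ℝ] E => L η) h.mfderiv
  simp only [mul_one] at h2
  exact h2

theorem contMDiff_coordL (η : LieAlg E G) : ContMDiff 𝓘(ℝ, E) 𝓘(ℝ, E) ∞ (coordL E η : G → E) :=
  contMDiff_mfderiv_apply (1 : G) (fun g y => coord E G (g * y))
    (contMDiff_coord.comp (contMDiff_mul 𝓘(ℝ, E) ∞)) η

theorem contMDiff_dR {V : Type*} [NormedAddCommGroup V] [NormedSpace ℝ V] {f : G → V}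
    (hf : ContMDiff 𝓘(ℝ, E) 𝓘(ℝ, V) ∞ f) :
    ContMDiff 𝓘(ℝ, E) 𝓘(ℝ, E →L[ℝ] V) ∞ (fun g => dR E f g) :=
  contMDiff_mfderiv_clm (1 : G) (fun g y => f (y * g))
    (hf.comp (contMDiff_snd.mul contMDiff_fst))

/-- The bracket of left-invariant fields is computed in the chart at `1`. There the field of η has
components `coordL E η`, so the bracket is DW·V − DV·W, where V and W take the values ξ and η at the
base point. -/
theorem lie_eq_coordL (ξ η : LieAlg E G) :
    (⁅ξ, η⁆ : LieAlg E G) = (mderiv E (coordL E η : G → E) 1) ξ -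
      (mderiv E (coordL E ξ : G → E) 1) η := by
  set e := extChartAt 𝓘(ℝ, E) (1 : G) with he
  have hloc : ∀ η : LieAlg E G, (VectorField.mpullbackWithin 𝓘(ℝ, E) 𝓘(ℝ, E) e.symm
      (mulInvariantVectorField η) (range 𝓘(ℝ, E)) : E → E) =ᶠ[nhds (e 1)]
      (coordL E η : G → E) ∘ e.symm := by
    intro η
    -- Equality near each nearby g, not only at g, since the derivatives of the two maps at g are
    -- compared.
    have h1 : ∀ᶠ g in nhds (1 : G), coord E G =ᶠ[nhds g] e :=
      eventually_eventually_nhds.2 coord_eventuallyEq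
    have h2 : Filter.Tendsto e.symm (nhds (e 1)) (nhds (1 : G)) := by
      have := (continuousAt_extChartAt_symm (I := 𝓘(ℝ, E)) (1 : G))
      unfold ContinuousAt at this
      rwa [extChartAt_to_inv] at this
    filter_upwards [h2.eventually h1, extChartAt_target_mem_nhds (I := 𝓘(ℝ, E)) (1 : G)] with x hx hxt
    rw [VectorField.mpullbackWithin_apply, ContinuousLinearMap.inverse_eq
      (mfderivWithin_extChartAt_symm_comp_mfderiv_extChartAt hxt)
      (mfderiv_extChartAt_comp_mfderivWithin_extChartAt_symm hxt)]
    have h3 : HasMFDerivAt 𝓘(ℝ, E) 𝓘(ℝ, E) (fun y : G => e.symm x * y) 1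
        (mfderiv 𝓘(ℝ, E) 𝓘(ℝ, E) (fun y : G => e.symm x * y) 1) :=
      ((contMDiff_mul_left (I := 𝓘(ℝ, E)) (n := ∞) (a := e.symm x)).mdifferentiable (by simp) 1).hasMFDerivAt
    have h4 : ∀ q, q = e.symm x → HasMFDerivAt 𝓘(ℝ, E) 𝓘(ℝ, E) (coord E G) q
        (mfderiv 𝓘(ℝ, E) 𝓘(ℝ, E) e (e.symm x) : E →L[ℝ] E) := by
      rintro q rfl
      have := (mdifferentiable_coord (E := E) (e.symm x)).hasMFDerivAt
      rwa [hx.mfderiv_eq] at this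
    have h5 := (h4 (e.symm x * 1) (mul_one _)).comp (1 : G) h3
    exact (congrArg (fun L : E →L[ℝ] E => L η) h5.mfderiv).symm
  rw [GroupLieAlgebra.bracket_def, ← VectorField.mlieBracketWithin_univ,
    VectorField.mlieBracketWithin_apply, mfderiv_extChartAt_self]
  have h0 : ((extChartAt 𝓘(ℝ, E) (1 : G)).symm ⁻¹' univ ∩ range 𝓘(ℝ, E)) = (univ : Set E) := by simp
  rw [h0]
  have hd : ∀ η : LieAlg E G, fderiv ℝ (VectorField.mpullbackWithin 𝓘(ℝ, E) 𝓘(ℝ, E) e.symm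
      (mulInvariantVectorField η) (range 𝓘(ℝ, E)) : E → E) (e 1) =
      (mderiv E (coordL E η : G → E) 1) := by
    intro η
    rw [(hloc η).fderiv_eq, mderiv, mfderiv_eq_fderiv_chart
      ((contMDiff_coordL η).mdifferentiable (by simp) 1)]
  have hv : ∀ η : LieAlg E G, (VectorField.mpullbackWithin 𝓘(ℝ, E) 𝓘(ℝ, E) e.symm
      (mulInvariantVectorField η) (range 𝓘(ℝ, E)) : E → E) (e 1) = η := by
    intro η
    rw [(hloc η).eq_of_nhds, comp_apply, extChartAt_to_inv, coordL_eq, dR_coord_one, Ad_one]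
    rfl
  have hfin : VectorField.lieBracketWithin ℝ (VectorField.mpullbackWithin 𝓘(ℝ, E) 𝓘(ℝ, E) e.symm
      (mulInvariantVectorField ξ) (range 𝓘(ℝ, E)) : E → E)
      (VectorField.mpullbackWithin 𝓘(ℝ, E) 𝓘(ℝ, E) e.symm
      (mulInvariantVectorField η) (range 𝓘(ℝ, E)) : E → E) univ (e 1) =
      (mderiv E (coordL E η : G → E) 1) ξ -
      (mderiv E (coordL E ξ : G → E) 1) η := by
    have hlb : ∀ V W : E → E, VectorField.lieBracketWithin ℝ V W univ (e 1) =
        fderiv ℝ W (e 1) (V (e 1)) - fderiv ℝ V (e 1) (W (e 1)) := fun V W => by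
      rw [VectorField.lieBracketWithin_univ, VectorField.lieBracket]
    refine (hlb _ _).trans ?_
    rw [hd, hd, hv, hv]
  rw [← hfin]
  exact congrArg (fun L : E →L[ℝ] E => L _) (ContinuousLinearMap.inverse_id (R := ℝ) (M := E))

/-- The bracket `⁅·, η⁆` as a continuous linear map. -/
def lieRight (η : LieAlg E G) : LieAlg E G →L[ℝ] LieAlg E G :=
  LinearMap.toContinuousLinearMap
    { toFun := fun ξ => ⁅ξ, η⁆
      map_add' := fun _ _ => add_lie _ _ _
      map_smul' := fun _ _ => smul_lie _ _ _ }

/-- Differentiate coordL η (g) = dR χ (g)(Ad(g)η) at `1`, with χ the coordinate map: the result is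
the derivative of Ad(·)η plus a second derivative of χ. The latter is also the derivative of coordL
ξ along η, so it cancels in `lie_eq_coordL`. -/
theorem hasMFDerivAt_Ad_apply_one (η : LieAlg E G) :
    HasMFDerivAt 𝓘(ℝ, E) 𝓘(ℝ, E) (fun g : G => AdE E g η) 1 (lieRight η : E →L[ℝ] E) := by
  have hd : MDifferentiableAt 𝓘(ℝ, E) 𝓘(ℝ, E) (fun g : G => AdE E g η) 1 :=
    (contMDiff_deriv_fixed (E := E) (1 : G) (fun u g : G => u * g * u⁻¹) contMDiff_conj
      (by simp) η).mdifferentiable (by simp) 1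
  set D : E →L[ℝ] E := mfderiv 𝓘(ℝ, E) 𝓘(ℝ, E) (fun g : G => AdE E g η) 1 with hD
  have h := hd.hasMFDerivAt
  have hA := (((contMDiff_dR (contMDiff_coord (E := E) (G := G))).mdifferentiable
    (by simp)) 1).hasMFDerivAt
  have h1 := hasMFDerivAt_clm_apply (w := fun g : G => AdE E g η) hA h
  have h2 : (fun g : G => dR E (coord E G) g (AdE E g η)) = coordL E η := by
    ext g; exact (coordL_eq η g).symm
  rw [h2] at h1
  have hA2 := hasMFDerivAt_clm_apply (W := E) (w := fun _ : G => (η : E)) (w' := 0) hA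
    (hasMFDerivAt_const _ _)
  have key : ∀ ξ : LieAlg E G, D (ξ : E) = lieRight η ξ := by
    intro ξ
    have h3 := congrArg (fun L : E →L[ℝ] E => L ξ) h1.mfderiv
    have h4 := congrArg (fun L : E →L[ℝ] E => L ξ) hA2.mfderiv
    -- For χ(yg), differentiating first in y gives the right-invariant derivative of χ, and first in
    -- g the left-invariant one.
    have h5 := mfderiv_mfderiv_symm (1 : G) (1 : G) (fun g y => coord E G (y * g))
      (contMDiff_coord.comp (contMDiff_snd.mul contMDiff_fst)) ξ η
    have h6 := lie_eq_coordL ξ η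
    have h7 : (mderiv E (coordL E ξ : G → E) 1) η = _ := h5.symm
    have h8 : ∀ v : E, dR E (coord E G) 1 v = v := by
      intro v; rw [dR_coord_one]; rfl
    have h9 : AdE E (1 : G) η = η :=
      congrArg (fun L : LieAlg E G →L[ℝ] LieAlg E G => L η) Ad_one
    set A' : E →L[ℝ] E →L[ℝ] E := mderiv E (fun g : G => dR E (coord E G) g) 1
    have h3' : (mderiv E (coordL E η : G → E) 1) ξ =
      dR E (coord E G) 1 (D ξ) + A' ξ (AdE E (1 : G) η) := h3
    have h4' : (mderiv E (coordL E ξ : G → E) 1) η =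
      dR E (coord E G) 1 ((0 : E →L[ℝ] E) ξ) + A' ξ η := h7.trans h4
    rw [h8] at h3' h4'
    rw [h9] at h3'
    have h10 : (⁅ξ, η⁆ : LieAlg E G) = (D ξ + A' ξ η - (0 + A' ξ η) : E) := by
      rw [h6, h3', h4']; rfl
    refine Eq.trans ?_ h10.symm
    abel
  have h11 : D = (lieRight η : E →L[ℝ] E) := ContinuousLinearMap.ext key
  rw [← h11]; exact h

theorem HasRD.Ad_apply {c : N → G} {x : N} {L : EN →L[ℝ] LieAlg E G} (h : HasRD I c x L)
    (η : LieAlg E G) : HasMFDerivAt I 𝓘(ℝ, E) (fun y => AdE E (c y) η) x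
      ((lieRight (Ad (c x) η)).comp L : EN →L[ℝ] E) := by
  have h0 : ∀ p : G, p = 1 → HasMFDerivAt 𝓘(ℝ, E) 𝓘(ℝ, E) (fun g : G => AdE E g (AdE E (c x) η)) p
      (lieRight (Ad (c x) η) : E →L[ℝ] E) := by
    rintro p rfl; exact hasMFDerivAt_Ad_apply_one _
  have h1 := (h0 (c x * (c x)⁻¹) (by simp)).comp x h
  have h2 : (fun y => AdE E (c y) η) = (fun g : G => AdE E g (AdE E (c x) η)) ∘
      fun y => c y * (c x)⁻¹ := by
    ext1 y
    have h3 : Ad (E := E) (c y) = (Ad (c y * (c x)⁻¹)).comp (Ad (c x)) := by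
      rw [← Ad_mul]; simp
    simp only [comp_apply]
    exact congrArg (fun L : LieAlg E G →L[ℝ] LieAlg E G => L η) h3
  rw [h2]
  exact h1

theorem Ad_inv_Ad (u : G) (ξ : LieAlg E G) : Ad u⁻¹ (Ad u ξ) = ξ := by
  have := congrArg (fun L : LieAlg E G →L[ℝ] LieAlg E G => L ξ) (Ad_mul (E := E) u⁻¹ u)
  simpa [Ad_one] using this.symm

theorem Ad_Ad_inv (u : G) (ξ : LieAlg E G) : Ad u (Ad u⁻¹ ξ) = ξ := by
  simpa using Ad_inv_Ad u⁻¹ ξ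

/-- Differentiate Ad(u y u⁻¹)Ad(u)η = Ad(u)Ad(y)η at y = 1 in the direction ξ. -/
theorem Ad_lie (u : G) (ξ η : LieAlg E G) : Ad u ⁅ξ, η⁆ = ⁅Ad u ξ, Ad u η⁆ := by
  have h1 : HasRD 𝓘(ℝ, E) (fun g : G => u * g * u⁻¹) 1 (Ad u) := by
    exact hasRD_of_one (by simp) (hasMFDerivAt_Ad (E := E) u rfl)
  have h2 := h1.Ad_apply (AdE E u η)
  have h3 : (fun y : G => AdE E (u * y * u⁻¹) (AdE E u η)) = fun y : G => AdE E u (AdE E y η) := by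
    ext y
    have h4 := congrArg (fun L : LieAlg E G →L[ℝ] LieAlg E G => L (Ad u η))
      ((Ad_mul (E := E) (u * y) u⁻¹).trans
        (congrArg (fun L : LieAlg E G →L[ℝ] LieAlg E G => L.comp (Ad u⁻¹)) (Ad_mul u y)))
    refine Eq.trans h4 ?_
    exact congrArg (fun w => Ad u (Ad y w)) (Ad_inv_Ad u η)
  rw [h3] at h2
  have h4 : HasMFDerivAt 𝓘(ℝ, E) 𝓘(ℝ, E) (fun y : G => AdE E u (AdE E y η)) 1
    ((AdE E u).comp (lieRight η : E →L[ℝ] E) : E →L[ℝ] E) :=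
    HasMFDerivAt.comp (1 : G) ((AdE E u).hasMFDerivAt) (hasMFDerivAt_Ad_apply_one η)
  have h5 := congrArg (fun L : E →L[ℝ] E => L ξ) (hasMFDerivAt_unique h4 h2)
  have h6 : Ad u ⁅ξ, η⁆ = ⁅Ad u ξ, Ad (u * 1 * u⁻¹) (Ad u η)⁆ := h5
  rw [h6]
  simp [Ad_one]

end Lie

/-! ### The entire function (e^z - 1)/z on a Banach algebra -/

section ExpQuot

variable {𝔸 : Type*} [NormedRing 𝔸] [NormedAlgebra ℝ 𝔸] [CompleteSpace 𝔸]

/-- The entire function `(e^z - 1) / z = ∑ z^k / (k+1)!` on a Banach algebra. -/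
def expQuot (A : 𝔸) : 𝔸 := ∑' k : ℕ, ((k + 1).factorial : ℝ)⁻¹ • A ^ k

theorem summable_expQuot (A : 𝔸) :
    Summable fun k : ℕ => ((k + 1).factorial : ℝ)⁻¹ • A ^ k := by
  -- The term k = 0 is dropped because ‖A^0‖ = ‖1‖ need not be bounded by 1.
  refine (summable_nat_add_iff 1).1 (Summable.of_norm_bounded (Real.summable_pow_div_factorial ‖A‖ |>.mul_left ‖A‖) fun k => ?_)
  rw [norm_smul, norm_inv, Real.norm_natCast]
  have h1 : ‖A ^ (k + 1)‖ ≤ ‖A‖ ^ (k + 1) := norm_pow_le' _ (Nat.succ_pos k)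
  have h2 : ((k + 1 + 1).factorial : ℝ)⁻¹ ≤ (k.factorial : ℝ)⁻¹ :=
    inv_anti₀ (by positivity) (by exact_mod_cast Nat.factorial_le (by omega))
  calc ((k + 1 + 1).factorial : ℝ)⁻¹ * ‖A ^ (k + 1)‖ ≤ (k.factorial : ℝ)⁻¹ * ‖A‖ ^ (k + 1) := by
        gcongr
    _ = ‖A‖ * (‖A‖ ^ k / k.factorial) := by rw [pow_succ]; ring

theorem expQuot_mul (A : 𝔸) : expQuot A * A = NormedSpace.exp A - 1 := by
  have h1 := NormedSpace.exp_series_hasSum_exp' (𝕂 := ℝ) A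
  have h2 := (hasSum_nat_add_iff' 1).2 h1
  simp only [Finset.range_one, Finset.sum_singleton, Nat.factorial_zero, Nat.cast_one, inv_one,
    pow_zero, one_smul] at h2
  rw [← h2.tsum_eq, expQuot, ← (summable_expQuot A).tsum_mul_right]
  exact tsum_congr fun k => by rw [smul_mul_assoc, pow_succ]

theorem mul_expQuot (A : 𝔸) : A * expQuot A = NormedSpace.exp A - 1 := by
  rw [← expQuot_mul, expQuot, ← (summable_expQuot A).tsum_mul_right,
    ← (summable_expQuot A).tsum_mul_left]
  exact tsum_congr fun k => by rw [smul_mul_assoc, mul_smul_comm, pow_mul_comm']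

/-- The power series has infinite radius of convergence by the ratio test, so its sum is analytic on
the whole algebra. -/
theorem contDiff_expQuot : ContDiff ℝ ∞ (expQuot : 𝔸 → 𝔸) := by
  have h1 : (expQuot : 𝔸 → 𝔸) =
      FormalMultilinearSeries.ofScalarsSum (fun k : ℕ => ((k + 1).factorial : ℝ)⁻¹) := by
    rw [FormalMultilinearSeries.ofScalarsSum_eq_tsum]; rfl
  have h2 : (FormalMultilinearSeries.ofScalars 𝔸
      (fun k : ℕ => ((k + 1).factorial : ℝ)⁻¹)).radius = ⊤ := by
    refine FormalMultilinearSeries.ofScalars_radius_eq_top_of_tendsto 𝔸 _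
      (Filter.Eventually.of_forall fun n => by positivity) ?_
    have h3 : (fun n : ℕ => ‖((n.succ + 1).factorial : ℝ)⁻¹‖ / ‖((n + 1).factorial : ℝ)⁻¹‖) =
        fun n : ℕ => 1 / ((((n + 1 : ℕ) : ℝ)) + 1) := by
      ext n
      rw [norm_inv, norm_inv, Real.norm_natCast, Real.norm_natCast, Nat.factorial_succ (n.succ)]
      have : ((n + 1).factorial : ℝ) ≠ 0 := by positivity
      push_cast
      field_simp
    rw [h3]
    exact (tendsto_one_div_add_atTop_nhds_zero_nat (𝕜 := ℝ)).comp (Filter.tendsto_add_atTop_nat 1)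
  have h4 := (FormalMultilinearSeries.ofScalars 𝔸
      (fun k : ℕ => ((k + 1).factorial : ℝ)⁻¹)).hasFPowerSeriesOnBall (by rw [h2]; simp)
  rw [h1]
  have h5 : AnalyticOnNhd ℝ
      (FormalMultilinearSeries.ofScalarsSum (E := 𝔸) (fun k : ℕ => ((k + 1).factorial : ℝ)⁻¹)) univ := by
    have := h4.analyticOnNhd
    rw [h2, Metric.eball_top] at this
    exact this
  exact h5.contDiff

/-- The function s·expQuot(sA) is the primitive of e^{sA} that vanishes at 0; the series is
differentiated term by term. -/
theorem hasDerivAt_smul_expQuot (A : 𝔸) (s : ℝ) :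
    HasDerivAt (fun s : ℝ => s • expQuot (s • A)) (NormedSpace.exp (s • A)) s := by
  set g : ℕ → ℝ → 𝔸 := fun n y => (((n + 1).factorial : ℝ)⁻¹ * y ^ (n + 1)) • A ^ n with hg
  -- Any radius above |s| would do: the derivatives are dominated on the ball around 0, which
  -- contains s, and at the reference point 0 every term of the series vanishes.
  set R : ℝ := |s| + 1 with hR
  have hR0 : 0 ≤ R := by positivity
  have h1 : (fun s : ℝ => s • expQuot (s • A)) = fun y => ∑' n, g n y := by
    ext y
    rw [expQuot, ← (summable_expQuot (y • A)).tsum_const_smul]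
    exact tsum_congr fun n => by
      simp only [hg, smul_pow, smul_smul]
      congr 1
      ring
  have h2 : NormedSpace.exp (s • A) = ∑' n : ℕ, ((n.factorial : ℝ)⁻¹ * s ^ n) • A ^ n := by
    rw [NormedSpace.exp_eq_tsum ℝ]
    exact tsum_congr fun n => by rw [smul_pow, smul_smul]
  rw [h1, h2]
  have hu : Summable fun n : ℕ => (‖(1 : 𝔸)‖ + 1) * ((R * ‖A‖) ^ n / n.factorial) :=
    (Real.summable_pow_div_factorial _).mul_left _
  refine hasDerivAt_tsum_of_isPreconnected (g := g)
    (g' := fun n y => ((n.factorial : ℝ)⁻¹ * y ^ n) • A ^ n) (y := s) hu Metric.isOpen_ball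
    (convex_ball (0 : ℝ) R).isPreconnected (y₀ := 0) (fun n y _ => ?_) (fun n y hy => ?_)
    (Metric.mem_ball_self (by positivity)) ?_
    (show s ∈ Metric.ball (0 : ℝ) R by
      rw [Metric.mem_ball, dist_zero_right, Real.norm_eq_abs, hR]; exact lt_add_one _)
  · have h3 := ((hasDerivAt_pow (n + 1) y).const_mul ((n + 1).factorial : ℝ)⁻¹).smul_const (A ^ n)
    convert! h3 using 2
    rw [Nat.factorial_succ]
    have : (n.factorial : ℝ) ≠ 0 := by positivity
    push_cast
    field_simp
  · have hy' : |y| ≤ R := by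
      have := Metric.mem_ball.1 hy
      rw [dist_zero_right, Real.norm_eq_abs] at this
      exact this.le
    have h4 : ‖A ^ n‖ ≤ (‖(1 : 𝔸)‖ + 1) * ‖A‖ ^ n := by
      rcases Nat.eq_zero_or_pos n with rfl | hn
      · simp
      · refine (norm_pow_le' A hn).trans ?_
        have : 0 ≤ ‖A‖ ^ n := by positivity
        nlinarith [norm_nonneg (1 : 𝔸)]
    rw [norm_smul, norm_mul, norm_inv, Real.norm_natCast, norm_pow, Real.norm_eq_abs]
    calc (n.factorial : ℝ)⁻¹ * |y| ^ n * ‖A ^ n‖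
        ≤ (n.factorial : ℝ)⁻¹ * R ^ n * ((‖(1 : 𝔸)‖ + 1) * ‖A‖ ^ n) := by gcongr
      _ = (‖(1 : 𝔸)‖ + 1) * ((R * ‖A‖) ^ n / n.factorial) := by rw [mul_pow]; ring
  · have : (fun n => g n 0) = fun _ => 0 := by
      ext n; simp [hg]
    rw [this]
    exact summable_zero

end ExpQuot

/-! ### One-parameter subgroups and injectivity of the differential of exp -/

section Exp
variable {E : Type*} [NormedAddCommGroup E] [NormedSpace ℝ E] [FiniteDimensional ℝ E]
  {G : Type*} [TopologicalSpace G] [T2Space G] [ChartedSpace E G] [Group G] [LieGroup 𝓘(ℝ, E) ∞ G]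

theorem mfderiv_mul_left_mulInvariantVectorField (g h k : G) (hk : k = g * h) (ξ : LieAlg E G) :
    (mfderiv 𝓘(ℝ, E) 𝓘(ℝ, E) (fun y : G => g * y) h : E →L[ℝ] E) (mulInvariantVectorField ξ h) =
      mulInvariantVectorField ξ k := by
  subst hk
  have h1 : HasMFDerivAt 𝓘(ℝ, E) 𝓘(ℝ, E) (fun y : G => h * y) 1
      (mfderiv 𝓘(ℝ, E) 𝓘(ℝ, E) (fun y : G => h * y) 1) :=
    ((contMDiff_mul_left (I := 𝓘(ℝ, E)) (n := ∞) (a := h)).mdifferentiable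
      (by simp) 1).hasMFDerivAt
  have h2 : ∀ q, q = h → HasMFDerivAt 𝓘(ℝ, E) 𝓘(ℝ, E) (fun y : G => g * y) q
      (mfderiv 𝓘(ℝ, E) 𝓘(ℝ, E) (fun y : G => g * y) h : E →L[ℝ] E) := by
    rintro q rfl
    exact ((contMDiff_mul_left (I := 𝓘(ℝ, E)) (n := ∞) (a := g)).mdifferentiable
      (by simp) _).hasMFDerivAt
  have h3 := (h2 (h * 1) (mul_one _)).comp (1 : G) h1
  have h4 : (fun y : G => g * y) ∘ (fun y : G => h * y) = fun y => g * h * y := by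
    ext y; simp [mul_assoc]
  rw [h4] at h3
  exact (congrArg (fun L : E →L[ℝ] E => L ξ) h3.mfderiv).symm

theorem isMIntegralCurveOn_mul_left {γ : ℝ → G} {ξ : LieAlg E G} {s : Set ℝ}
    (h : IsMIntegralCurveOn (I := 𝓘(ℝ, E)) γ (mulInvariantVectorField ξ) s) (g : G) :
    IsMIntegralCurveOn (I := 𝓘(ℝ, E)) (fun t => g * γ t) (mulInvariantVectorField ξ) s := by
  intro t ht
  have h1 : HasMFDerivAt 𝓘(ℝ, E) 𝓘(ℝ, E) (fun y : G => g * y) (γ t)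
      (mfderiv 𝓘(ℝ, E) 𝓘(ℝ, E) (fun y : G => g * y) (γ t)) :=
    ((contMDiff_mul_left (I := 𝓘(ℝ, E)) (n := ∞) (a := g)).mdifferentiable
      (by simp) _).hasMFDerivAt
  have h2 := h1.comp_hasMFDerivWithinAt t (h t ht)
  have h3 : (((1 : ℝ →L[ℝ] ℝ).smulRight (mulInvariantVectorField ξ (g * γ t) : E)) : ℝ →L[ℝ] E) =
      (mfderiv 𝓘(ℝ, E) 𝓘(ℝ, E) (fun y : G => g * y) (γ t) : E →L[ℝ] E).comp
        ((1 : ℝ →L[ℝ] ℝ).smulRight (mulInvariantVectorField ξ (γ t) : E)) := by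
    refine ContinuousLinearMap.ext fun r => ?_
    have h4 := mfderiv_mul_left_mulInvariantVectorField g (γ t) _ rfl ξ
    exact (congrArg (fun w : E => r • w) h4.symm).trans
      ((mfderiv 𝓘(ℝ, E) 𝓘(ℝ, E) (fun y : G => g * y) (γ t) : E →L[ℝ] E).map_smul r
        (mulInvariantVectorField ξ (γ t) : E)).symm
  exact Eq.mpr (congrArg (fun L : ℝ →L[ℝ] E =>
    HasMFDerivWithinAt 𝓘(ℝ, ℝ) 𝓘(ℝ, E) (fun t => g * γ t) s t L) h3) h2

theorem contMDiff_invariantField (ξ : LieAlg E G) : ContMDiff 𝓘(ℝ, E) 𝓘(ℝ, E).tangent 1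
    (fun g : G => (mulInvariantVectorField ξ g : TangentBundle 𝓘(ℝ, E) G)) :=
  (contMDiff_mulInvariantVectorField ξ).of_le
    (by rw [minSmoothness_of_isRCLikeNormedField]; exact one_le_two)

/-- Left translates of one local integral curve give the same existence time ε at every point of G;
a uniform existence time gives a curve on all of ℝ. -/
theorem exists_isMIntegralCurve_one (ξ : LieAlg E G) : ∃ γ : ℝ → G, γ 0 = 1 ∧
    IsMIntegralCurve (I := 𝓘(ℝ, E)) γ (mulInvariantVectorField ξ) := by
  have hv := contMDiff_invariantField (E := E) (G := G) ξ
  obtain ⟨γ, h0, hγ⟩ := exists_isMIntegralCurveAt_of_contMDiffAt_boundaryless (I := 𝓘(ℝ, E)) 0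
    (hv.contMDiffAt (x := (1 : G)))
  obtain ⟨ε, hε, hγ⟩ := isMIntegralCurveAt_iff'.1 hγ
  rw [Real.ball_eq_Ioo, zero_sub, zero_add] at hγ
  refine exists_isMIntegralCurve_of_isMIntegralCurveOn hv hε (fun x => ?_) 1
  exact ⟨fun t => x * γ t, by simp [h0], isMIntegralCurveOn_mul_left hγ x⟩

/-- Uniqueness of integral curves makes the choice in `lieExp` irrelevant. -/
theorem lieExp_eq {γ : ℝ → G} {ξ : LieAlg E G} (h0 : γ 0 = 1)
    (h : IsMIntegralCurve (I := 𝓘(ℝ, E)) γ (mulInvariantVectorField ξ)) : lieExp ξ = γ 1 := by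
  have h1 : ∃ g : G, ∃ γ : ℝ → G, γ 0 = 1 ∧
    IsMIntegralCurve (I := 𝓘(ℝ, E)) γ (mulInvariantVectorField ξ) ∧ γ 1 = g := ⟨_, γ, h0, h, rfl⟩
  obtain ⟨γ', h0', h', h1'⟩ := Classical.epsilon_spec h1
  have h2 := isMIntegralCurve_Ioo_eq_of_contMDiff_boundaryless (t₀ := 0)
    (contMDiff_invariantField ξ) h h' (by rw [h0, h0'])
  rw [h2, h1']
  rfl

theorem lieExp_smul_eq {γ : ℝ → G} {ξ : LieAlg E G} (h0 : γ 0 = 1)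
    (h : IsMIntegralCurve (I := 𝓘(ℝ, E)) γ (mulInvariantVectorField ξ)) (t : ℝ) :
    lieExp (t • ξ) = γ t := by
  have h1 := h.comp_mul t
  rw [← mulInvariantVectorField_smul] at h1
  rw [lieExp_eq (by simp [h0]) h1]
  simp

theorem isMIntegralCurve_lieExp (ξ : LieAlg E G) :
    IsMIntegralCurve (I := 𝓘(ℝ, E)) (fun t : ℝ => (lieExp (t • ξ) : G))
      (mulInvariantVectorField ξ) := by
  obtain ⟨γ, h0, h⟩ := exists_isMIntegralCurve_one ξ
  have h1 : (fun t : ℝ => (lieExp (t • ξ) : G)) = γ := funext fun t => lieExp_smul_eq h0 h t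
  rw [h1]; exact h

theorem lieExp_zero : (lieExp (0 : LieAlg E G) : G) = 1 := by
  obtain ⟨γ, h0, h⟩ := exists_isMIntegralCurve_one (0 : LieAlg E G)
  have := lieExp_smul_eq h0 h 0
  rwa [zero_smul, h0] at this

variable (G) in
/-- The linear map `ℝ → 𝔤` with `1 ↦ ξ`. -/
def spanR (ξ : LieAlg E G) : ℝ →L[ℝ] LieAlg E G := ContinuousLinearMap.toSpanSingleton ℝ ξ

theorem mulInvariantVectorField_eq_Ad (ξ : LieAlg E G) (g : G) :
    (mfderiv 𝓘(ℝ, E) 𝓘(ℝ, E) (fun y : G => y * g⁻¹) g : E →L[ℝ] E) (mulInvariantVectorField ξ g) =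
      AdE E g ξ := by
  have h1 : HasMFDerivAt 𝓘(ℝ, E) 𝓘(ℝ, E) (fun y : G => g * y) 1
      (mfderiv 𝓘(ℝ, E) 𝓘(ℝ, E) (fun y : G => g * y) 1) :=
    ((contMDiff_mul_left (I := 𝓘(ℝ, E)) (n := ∞) (a := g)).mdifferentiable
      (by simp) 1).hasMFDerivAt
  have h2 : ∀ q, q = g → HasMFDerivAt 𝓘(ℝ, E) 𝓘(ℝ, E) (fun y : G => y * g⁻¹) q
      (mfderiv 𝓘(ℝ, E) 𝓘(ℝ, E) (fun y : G => y * g⁻¹) g : E →L[ℝ] E) := by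
    rintro q rfl
    exact ((contMDiff_mul_const (E := E) _).mdifferentiable (by simp) _).hasMFDerivAt
  have h3 := (h2 (g * 1) (mul_one _)).comp (1 : G) h1
  exact (congrArg (fun L : E →L[ℝ] E => L ξ) h3.mfderiv).symm

/-- Undoes the trivialisation: B is the derivative at `1` of right multiplication by `c x`, the
inverse of right multiplication by `(c x)⁻¹`. -/
theorem HasRD.hasMFDerivAt_mul_const {EN : Type*} [NormedAddCommGroup EN] [NormedSpace ℝ EN]
    {HN : Type*} [TopologicalSpace HN] {I : ModelWithCorners ℝ EN HN} {N : Type*}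
    [TopologicalSpace N] [ChartedSpace HN N] {c : N → G} {x : N} {L : EN →L[ℝ] LieAlg E G}
    (h : HasRD I c x L) : ∃ B : E →L[ℝ] E, HasMFDerivAt I 𝓘(ℝ, E) c x (B.comp (L : EN →L[ℝ] E)) ∧
      B.comp (mfderiv 𝓘(ℝ, E) 𝓘(ℝ, E) (fun y : G => y * (c x)⁻¹) (c x)) =
        ContinuousLinearMap.id ℝ E := by
  set g := c x with hg
  have h2 : ∀ q, q = g → HasMFDerivAt 𝓘(ℝ, E) 𝓘(ℝ, E) (fun y : G => y * g⁻¹) q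
      (mfderiv 𝓘(ℝ, E) 𝓘(ℝ, E) (fun y : G => y * g⁻¹) g : E →L[ℝ] E) := by
    rintro q rfl
    exact ((contMDiff_mul_const (E := E) _).mdifferentiable (by simp) _).hasMFDerivAt
  have h1 : ∀ q, q = 1 → HasMFDerivAt 𝓘(ℝ, E) 𝓘(ℝ, E) (fun y : G => y * g) q
      (mfderiv 𝓘(ℝ, E) 𝓘(ℝ, E) (fun y : G => y * g) 1 : E →L[ℝ] E) := by
    rintro q rfl
    exact ((contMDiff_mul_const (E := E) g).mdifferentiable (by simp) _).hasMFDerivAt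
  refine ⟨mfderiv 𝓘(ℝ, E) 𝓘(ℝ, E) (fun y : G => y * g) 1, ?_, ?_⟩
  · have h3 := (h1 (c x * (c x)⁻¹) (by simp)).comp x h
    exact hasMFDerivAt_of_eq h3 fun y => by simp [hg]
  · have h3 := (h1 (g * g⁻¹) (by simp)).comp g (h2 g rfl)
    have h4 : (fun y : G => y * g) ∘ (fun y : G => y * g⁻¹) = id := by ext y; simp
    rw [h4] at h3
    exact hasMFDerivAt_unique h3 (hasMFDerivAt_id g)

/-- The velocity of γ is the left-invariant vector ξ, whose right trivialisation at γ(t) is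
Ad(γ(t))ξ. -/
theorem isMIntegralCurve_iff_hasRD {γ : ℝ → G} {ξ : LieAlg E G} :
    IsMIntegralCurve (I := 𝓘(ℝ, E)) γ (mulInvariantVectorField ξ) ↔
      ∀ t, HasRD 𝓘(ℝ, ℝ) γ t (spanR G (Ad (γ t) ξ)) := by
  refine forall_congr' fun t => ⟨fun h => ?_, fun h => ?_⟩
  · have h2 : HasMFDerivAt 𝓘(ℝ, E) 𝓘(ℝ, E) (fun y : G => y * (γ t)⁻¹) (γ t)
        (mfderiv 𝓘(ℝ, E) 𝓘(ℝ, E) (fun y : G => y * (γ t)⁻¹) (γ t)) :=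
      ((contMDiff_mul_const (E := E) (γ t)⁻¹).mdifferentiable (by simp) _).hasMFDerivAt
    have h3 := h2.comp t h
    have h4 : (spanR G (Ad (γ t) ξ) : ℝ →L[ℝ] E) =
        (mfderiv 𝓘(ℝ, E) 𝓘(ℝ, E) (fun y : G => y * (γ t)⁻¹) (γ t) : E →L[ℝ] E).comp
          ((1 : ℝ →L[ℝ] ℝ).smulRight (mulInvariantVectorField ξ (γ t) : E)) := by
      refine ContinuousLinearMap.ext fun r => ?_
      exact (congrArg (fun w : E => r • w) (mulInvariantVectorField_eq_Ad ξ (γ t)).symm).trans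
        ((mfderiv 𝓘(ℝ, E) 𝓘(ℝ, E) (fun y : G => y * (γ t)⁻¹) (γ t) : E →L[ℝ] E).map_smul r
          (mulInvariantVectorField ξ (γ t) : E)).symm
    exact Eq.mpr (congrArg (fun L : ℝ →L[ℝ] E => HasMFDerivAt 𝓘(ℝ, ℝ) 𝓘(ℝ, E)
      (fun s => γ s * (γ t)⁻¹) t L) h4) h3
  · obtain ⟨B, h1, h2⟩ := h.hasMFDerivAt_mul_const
    have h4 : ((1 : ℝ →L[ℝ] ℝ).smulRight (mulInvariantVectorField ξ (γ t) : E) : ℝ →L[ℝ] E) =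
        B.comp (spanR G (Ad (γ t) ξ) : ℝ →L[ℝ] E) := by
      refine ContinuousLinearMap.ext fun r => ?_
      have h5 : (mulInvariantVectorField ξ (γ t) : E) = B (AdE E (γ t) ξ) := by
        rw [← mulInvariantVectorField_eq_Ad]
        exact congrArg (fun L : E →L[ℝ] E => L (mulInvariantVectorField ξ (γ t))) h2.symm
      exact (congrArg (fun w : E => r • w) h5).trans (B.map_smul r _).symm
    exact Eq.mpr (congrArg (fun L : ℝ →L[ℝ] E => HasMFDerivAt 𝓘(ℝ, ℝ) 𝓘(ℝ, E) γ t L) h4) h1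

theorem eq_lieExp {γ : ℝ → G} {ξ : LieAlg E G} (h0 : γ 0 = 1)
    (h : ∀ t, HasRD 𝓘(ℝ, ℝ) γ t (spanR G (Ad (γ t) ξ))) (t : ℝ) : γ t = lieExp (t • ξ) :=
  (lieExp_smul_eq h0 (isMIntegralCurve_iff_hasRD.2 h) t).symm

variable (E G) in
/-- `ad(ξ)` as a continuous linear map of the model space. -/
def adE (ξ : E) : E →L[ℝ] E :=
  LinearMap.toContinuousLinearMap (LieAlgebra.ad ℝ (LieAlg E G) (ξ : LieAlg E G))

theorem HasRD.hasDerivAt_AdE {c : ℝ → G} {s : ℝ} {v : LieAlg E G}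
    (h : HasRD 𝓘(ℝ, ℝ) c s (spanR G v)) (η : LieAlg E G) :
    HasDerivAt (fun t => AdE E (c t) η) (adE E G v (AdE E (c s) η)) s := by
  obtain ⟨L, hL, h1⟩ : ∃ L : ℝ →L[ℝ] E, HasFDerivAt (fun t => AdE E (c t) η) L s ∧
      L 1 = adE E G v (AdE E (c s) η) :=
    ⟨_, (h.Ad_apply η).hasFDerivAt, congrArg (lieRight (Ad (c s) η)) (one_smul ℝ v)⟩
  rw [← h1]
  exact hL.hasDerivAt

/-- The derivative of Ad(exp(tξ))ξ is the bracket of this vector with itself. Consequently the right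
logarithmic derivative of exp(tξ) is the constant ξ. -/
theorem Ad_lieExp_smul_self (ξ : LieAlg E G) (t : ℝ) : Ad (lieExp (t • ξ) : G) ξ = ξ := by
  have h := isMIntegralCurve_iff_hasRD.1 (isMIntegralCurve_lieExp (E := E) (G := G) ξ)
  have h1 : ∀ s : ℝ, HasDerivAt (fun t : ℝ => AdE E (lieExp (t • ξ) : G) ξ) 0 s := by
    intro s
    have h2 := (h s).hasDerivAt_AdE ξ
    have h3 : adE E G (Ad (lieExp (s • ξ) : G) ξ) (AdE E (lieExp (s • ξ) : G) ξ) = 0 :=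
      lie_self (Ad (lieExp (s • ξ) : G) ξ)
    rwa [h3] at h2
  have h4 := is_const_of_deriv_eq_zero (fun s => (h1 s).differentiableAt)
    (fun s => (h1 s).deriv) t 0
  refine Eq.trans h4 ?_
  show Ad (lieExp ((0 : ℝ) • ξ) : G) ξ = ξ
  rw [zero_smul, lieExp_zero, Ad_one]; rfl

theorem hasRD_lieExp_smul (ξ : LieAlg E G) (t : ℝ) :
    HasRD 𝓘(ℝ, ℝ) (fun t : ℝ => (lieExp (t • ξ) : G)) t (spanR G ξ) := by
  have h := isMIntegralCurve_iff_hasRD.1 (isMIntegralCurve_lieExp (E := E) (G := G) ξ) t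
  rwa [Ad_lieExp_smul_self] at h

/-- The vector e^{-t ad ξ}Ad(exp(tξ))η has derivative zero in t and equals η at t = 0. -/
theorem AdE_lieExp_smul (ξ : LieAlg E G) (t : ℝ) :
    AdE E (lieExp (t • ξ) : G) = NormedSpace.exp (t • adE E G ξ) := by
  ext η
  have h1 : ∀ s : ℝ, HasDerivAt (fun t : ℝ => NormedSpace.exp ((-t) • adE E G ξ)
      (AdE E (lieExp (t • ξ) : G) η)) 0 s := by
    intro s
    have h2 := (hasRD_lieExp_smul ξ s).hasDerivAt_AdE η
    have h3 : HasDerivAt (fun t : ℝ => NormedSpace.exp ((-t) • adE E G ξ))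
        (-(NormedSpace.exp ((-s) • adE E G ξ) * adE E G ξ)) s := by
      have := HasDerivAt.scomp s (hasDerivAt_exp_smul_const (𝕂 := ℝ) (adE E G ξ) (-s)) (hasDerivAt_neg s)
      rw [neg_one_smul] at this; exact this
    have h4 := h3.clm_apply h2
    convert! h4 using 1
    simp
  have h4 := is_const_of_deriv_eq_zero (fun s => (h1 s).differentiableAt)
    (fun s => (h1 s).deriv) t 0
  simp only [neg_zero, zero_smul, NormedSpace.exp_zero, lieExp_zero] at h4
  have h5 : AdE E (1 : G) η = η := congrArg (fun L : LieAlg E G →L[ℝ] LieAlg E G => L η) Ad_one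
  rw [h5] at h4
  have h6 := congrArg (fun w : E => (NormedSpace.exp (t • adE E G ξ) : E →L[ℝ] E) w) h4
  have h7 : NormedSpace.exp (t • adE E G ξ) * NormedSpace.exp ((-t) • adE E G ξ) = 1 := by
    letI := NormedAlgebra.restrictScalars ℚ ℝ (E →L[ℝ] E)
    rw [← NormedSpace.exp_add_of_commute
      ((Commute.refl (adE E G ξ)).smul_left t |>.smul_right (-t)), ← add_smul, add_neg_cancel,
      zero_smul, NormedSpace.exp_zero]
  have h8 := congrArg (fun L : E →L[ℝ] E => L (AdE E (lieExp (t • ξ) : G) η)) h7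
  exact h8.symm.trans h6

theorem lieExp_Ad (g : G) (ξ : LieAlg E G) : lieExp (Ad g ξ) = g * lieExp ξ * g⁻¹ := by
  have h := fun t => ((hasRD_const (E := E) (I := 𝓘(ℝ, ℝ)) g t).mul
    (hasRD_lieExp_smul ξ t)).mul (hasRD_const (E := E) (I := 𝓘(ℝ, ℝ)) g⁻¹ t)
  have h1 := eq_lieExp (γ := fun t : ℝ => g * lieExp (t • ξ) * g⁻¹) (ξ := Ad g ξ)
    (by simp [lieExp_zero]) (fun t => ?_) 1
  · simpa using h1.symm
  · have h2 : ((0 : ℝ →L[ℝ] LieAlg E G) + (Ad g).comp (spanR G ξ) +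
        (Ad (g * lieExp (t • ξ))).comp (0 : ℝ →L[ℝ] LieAlg E G)) = spanR G (Ad (g * lieExp (t • ξ) * g⁻¹) (Ad g ξ)) := by
      ext
      simp only [spanR, Ad_mul, ContinuousLinearMap.comp_apply, Ad_inv_Ad]
      rw [Ad_lieExp_smul_self]
      simp
    rw [← h2]
    exact h t

/-- If Ad(exp ξ) fixes η, then exp ξ commutes with every exp(tη), so exp(Ad(exp(tη))ξ) = exp ξ.
Injectivity of exp removes the outer exponential, and the derivative at t = 0 is [η, ξ] = 0. -/
theorem lie_eq_zero_of_Ad_lieExp (hinj : Injective (lieExp : LieAlg E G → G)) {ξ η : LieAlg E G}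
    (h : Ad (lieExp ξ) η = η) : ⁅ξ, η⁆ = 0 := by
  have h1 : ∀ t : ℝ, Ad (lieExp (t • η)) ξ = ξ := by
    intro t
    apply hinj
    have h2 : lieExp ξ * lieExp (t • η) * (lieExp ξ)⁻¹ = (lieExp (t • η) : G) := by
      rw [← lieExp_Ad, map_smul, h]
    rw [lieExp_Ad]
    calc lieExp (t • η) * lieExp ξ * (lieExp (t • η))⁻¹
        = (lieExp ξ * lieExp (t • η) * (lieExp ξ)⁻¹) * lieExp ξ * (lieExp (t • η))⁻¹ := by rw [h2]
      _ = (lieExp ξ : G) := by group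
  have h3 := (hasRD_lieExp_smul (G := G) η 0).hasDerivAt_AdE ξ
  have h4 : (fun t : ℝ => AdE E (lieExp (t • η) : G) ξ) = fun _ => (ξ : E) := funext h1
  rw [h4] at h3
  have h5 := h3.unique (hasDerivAt_const _ _)
  have h6 : ⁅η, ξ⁆ = 0 := by
    have h7 : ∀ g : G, g = 1 → adE E G η (AdE E g ξ) = ⁅η, ξ⁆ := by
      rintro g rfl
      exact congrArg (adE E G η) (congrArg (fun L : LieAlg E G →L[ℝ] LieAlg E G => L ξ) Ad_one)
    exact (h7 _ (by rw [zero_smul, lieExp_zero])).symm.trans h5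
  rw [← lie_skew, h6, neg_zero]

/-- A kernel vector η satisfies (e^{ad ξ} - 1)η = ad ξ · expQuot(ad ξ)η = 0, so Ad(exp ξ) fixes it
and [ξ, η] = 0; but then expQuot(ad ξ) fixes η as well. -/
theorem expQuot_adE_injective (hinj : Injective (lieExp : LieAlg E G → G)) (ξ : LieAlg E G) :
    Injective (expQuot (adE E G ξ) : E →L[ℝ] E) := by
  rw [injective_iff_map_eq_zero]
  intro η hη
  have h1 := congrArg (fun L : E →L[ℝ] E => L η) (mul_expQuot (adE E G ξ))
  have h2 : NormedSpace.exp (adE E G ξ) η = η := by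
    have h3 : adE E G ξ (expQuot (adE E G ξ) η) = NormedSpace.exp (adE E G ξ) η - η := h1
    rw [hη, map_zero] at h3
    exact (sub_eq_zero.1 h3.symm)
  have h3 : Ad (lieExp ξ : G) η = η := by
    have h4 := AdE_lieExp_smul (G := G) ξ 1
    rw [one_smul, one_smul] at h4
    rw [← h4] at h2
    exact h2
  have h4 : adE E G ξ η = 0 := lie_eq_zero_of_Ad_lieExp hinj h3
  -- Since ad ξ kills η, only the term k = 0 survives, with coefficient 1/1!.
  have h5 : expQuot (adE E G ξ) η = η := by
    have h6 := (summable_expQuot (adE E G ξ)).hasSum.mapL (ContinuousLinearMap.apply ℝ E (η : E))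
    have h7 : ∀ k : ℕ, k ≠ 0 → (ContinuousLinearMap.apply ℝ E (η : E))
        (((k + 1).factorial : ℝ)⁻¹ • adE E G ξ ^ k) = 0 := by
      intro k hk
      obtain ⟨k, rfl⟩ := Nat.exists_eq_succ_of_ne_zero hk
      rw [Nat.succ_eq_add_one, pow_succ, ← smul_mul_assoc]
      exact (congrArg (((k + 1 + 1).factorial : ℝ)⁻¹ • adE E G ξ ^ k) h4).trans
        (ContinuousLinearMap.map_zero (((k + 1 + 1).factorial : ℝ)⁻¹ • adE E G ξ ^ k))
    have h8 := h6.unique (hasSum_single 0 h7)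
    refine Eq.trans h8 ?_
    simp
  rw [← h5, hη]

end Exp

section ExpQuot
variable {𝔸 : Type*} [NormedRing 𝔸] [NormedAlgebra ℝ 𝔸] [CompleteSpace 𝔸]

/-- Formally e^A(e^{-A}-1)/(-A) = (e^A-1)/A, but A need not be invertible. Instead
e^{sA}·s·expQuot(-sA) and s·expQuot(sA) vanish at s = 0 and have the same derivative e^{sA}. -/
theorem exp_mul_expQuot_neg (A : 𝔸) : NormedSpace.exp A * expQuot (-A) = expQuot A := by
  let _ := NormedAlgebra.restrictScalars ℚ ℝ 𝔸
  have hinv : ∀ B : 𝔸, NormedSpace.exp B * NormedSpace.exp (-B) = 1 := fun B => by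
    rw [← NormedSpace.exp_add_of_commute ((Commute.refl B).neg_right), add_neg_cancel,
      NormedSpace.exp_zero]
  have h : ∀ s : ℝ, HasDerivAt (fun s : ℝ => NormedSpace.exp (s • A) * (s • expQuot (s • -A)) -
      s • expQuot (s • A)) 0 s := by
    intro s
    have h1 := (hasDerivAt_exp_smul_const (𝕂 := ℝ) A s).mul (hasDerivAt_smul_expQuot (-A) s)
    have h2 := h1.sub (hasDerivAt_smul_expQuot A s)
    have h3 : A * (s • expQuot (s • -A)) = 1 - NormedSpace.exp (s • -A) := by
      have h4 := mul_expQuot (s • -A)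
      rw [smul_mul_assoc, neg_mul, smul_neg, ← mul_smul_comm] at h4
      rw [← neg_eq_iff_eq_neg.2 h4.symm.symm.symm]
      abel_nf
    convert! h2 using 1
    rw [mul_assoc, h3, mul_sub, mul_one, smul_neg, hinv]
    abel
  have h1 := is_const_of_deriv_eq_zero (fun s => (h s).differentiableAt) (fun s => (h s).deriv) 1 0
  simp only [one_smul, zero_smul, mul_zero, sub_zero] at h1
  exact sub_eq_zero.1 h1

end ExpQuot

/-! ### The differential of exp, smoothness of exp and of log -/

section Exp
variable {E : Type*} [NormedAddCommGroup E] [NormedSpace ℝ E] [FiniteDimensional ℝ E]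
  {G : Type*} [TopologicalSpace G] [T2Space G] [ChartedSpace E G] [Group G] [LieGroup 𝓘(ℝ, E) ∞ G]

theorem exists_norm_dR_le {V : Type*} [NormedAddCommGroup V] [NormedSpace ℝ V] {f : G → V}
    (hf : ContMDiff 𝓘(ℝ, E) 𝓘(ℝ, V) ∞ f) (hc : HasCompactSupport f) :
    ∃ C, ∀ g, ‖dR E f g‖ ≤ C := by
  refine (contMDiff_dR hf).continuous.bounded_above_of_compact_support
    (HasCompactSupport.intro' hc.isCompact (isClosed_tsupport f) fun g hg => ?_)
  have h1 : f =ᶠ[nhds g] 0 := notMem_tsupport_iff_eventuallyEq.1 hg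
  have h2 : Filter.Tendsto (fun y : G => y * g) (nhds 1) (nhds g) := by
    have := (contMDiff_mul_const (E := E) g).continuous.tendsto 1
    rwa [one_mul] at this
  have h3 : (fun y : G => f (y * g)) =ᶠ[nhds 1] fun _ => 0 := h2.eventually h1
  rw [dR, mderiv, h3.mfderiv_eq, mfderiv_const]
  rfl

/-- Continuity is a separate hypothesis because `coord` is a chart only near `1` and does not
control points far away. -/
theorem hasMFDerivAt_of_coord {c : E → G} {x : E} {L : E →L[ℝ] E} (hx : c x = 1)
    (hc : ContinuousAt c x) (h : HasFDerivAt (fun y => coord E G (c y)) L x) :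
    HasMFDerivAt 𝓘(ℝ, E) 𝓘(ℝ, E) c x L := by
  refine ⟨hc, ?_⟩
  have hc' : Filter.Tendsto c (nhds x) (nhds 1) := hx ▸ hc
  have h1 : (fun y => coord E G (c y)) =ᶠ[nhds x] fun y => extChartAt 𝓘(ℝ, E) (1 : G) (c y) :=
    hc'.eventually coord_eventuallyEq
  have h2 := h.congr_of_eventuallyEq h1.symm
  unfold writtenInExtChartAt
  rw [hx]
  exact h2.hasFDerivWithinAt

variable (E G) in
/-- The exponential map as a map on the model space. -/
def expE (ξ : E) : G := lieExp (ξ : LieAlg E G)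

variable (E G) in
/-- The map `∑ ad(ξ)^k / (k+1)!` on the model space. -/
def expQuotE (ξ : E) : E →L[ℝ] E := expQuot (adE E G ξ)

theorem lieExp_smul_neg (ξ : LieAlg E G) (t : ℝ) :
    (lieExp (t • -ξ) : G) = (lieExp (t • ξ))⁻¹ := by
  refine (eq_lieExp (γ := fun t : ℝ => (lieExp (t • ξ) : G)⁻¹) (by simp [lieExp_zero])
    (fun s => ?_) t).symm
  have h := (hasRD_lieExp_smul (G := G) ξ s).inv
  have h2 : -(Ad (lieExp (s • ξ) : G)⁻¹).comp (spanR G ξ) =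
      spanR G (Ad (lieExp (s • ξ) : G)⁻¹ (-ξ)) := by
    ext; simp [spanR]
  rw [← h2]
  exact h

theorem expE_neg (ξ : E) : expE E G (-ξ) = (expE E G ξ)⁻¹ := by
  have h := lieExp_smul_neg (G := G) (ξ : LieAlg E G) 1
  have h1 : ∀ η : LieAlg E G, (lieExp ((1 : ℝ) • η) : G) = lieExp η := fun η => by rw [one_smul]
  exact (h1 _).symm.trans (h.trans (congrArg _ (h1 _)))

theorem expE_zero : expE E G 0 = 1 := lieExp_zero

variable (E G) in
/-- The curve `s ↦ exp(-sξ) exp(s(ξ+η))`. -/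
def expCurve (ξ η : E) (s : ℝ) : G := expE E G (s • -ξ) * expE E G (s • (ξ + η))

theorem expCurve_zero (ξ η : E) : expCurve E G ξ η 0 = 1 := by
  simp [expCurve, expE_zero]

theorem expCurve_one (ξ η : E) :
    expCurve E G ξ η 1 = (expE E G ξ)⁻¹ * expE E G (ξ + η) := by
  simp [expCurve, expE_neg]

/-- The product rule gives -ξ + Ad(exp(-sξ))(ξ+η), and Ad(exp(-sξ)) fixes ξ. The velocity is
therefore exactly linear in η. -/
theorem hasRD_expCurve (ξ η : LieAlg E G) (s : ℝ) :
    HasRD 𝓘(ℝ, ℝ) (expCurve E G ξ η) s (spanR G (Ad (lieExp (s • -ξ)) η)) := by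
  have h := (hasRD_lieExp_smul (G := G) (-ξ) s).mul (hasRD_lieExp_smul (ξ + η) s)
  have h2 : spanR G (-ξ) + (Ad (lieExp (s • -ξ))).comp (spanR G (ξ + η)) =
      spanR G (Ad (lieExp (s • -ξ)) η) := by
    ext
    have h3 := Ad_lieExp_smul_self (G := G) (-ξ) s
    rw [map_neg, neg_inj, smul_neg] at h3
    simp [spanR, h3]
  rw [← h2]
  exact h

theorem AdE_expE_smul (ξ : E) (t : ℝ) :
    AdE E (expE E G (t • ξ)) = NormedSpace.exp (t • adE E G ξ) :=
  AdE_lieExp_smul (G := G) (ξ : LieAlg E G) t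

theorem exists_bound_Ad_lieExp (ξ : E) : ∃ K, 0 ≤ K ∧ ∀ s ∈ Icc (0 : ℝ) 1,
    ∀ η : E, ‖AdE E (expE E G (s • ξ)) η‖ ≤ K * ‖η‖ := by
  have hc : Continuous fun s : ℝ => NormedSpace.exp (s • adE E G ξ) :=
    continuous_iff_continuousAt.2 fun s =>
      (hasDerivAt_exp_smul_const (𝕂 := ℝ) (adE E G ξ) s).continuousAt
  obtain ⟨K, hK⟩ := isCompact_Icc.exists_bound_of_continuousOn (s := Icc (0 : ℝ) 1) hc.continuousOn
  refine ⟨K, (norm_nonneg _).trans (hK 0 (by simp)), fun s hs η => ?_⟩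
  rw [AdE_expE_smul]
  exact (NormedSpace.exp (s • adE E G ξ) : E →L[ℝ] E).le_of_opNorm_le (hK s hs) η

/-- Without a metric on G, smallness of the curve is measured by a bump function f supported in U.
It is 1 at the start of the curve and changes at rate at most C·K·‖η‖ < 1, so it cannot vanish up to
s = 1. -/
theorem eventually_expCurve_mem (ξ : E) {U : Set G} (hU : U ∈ nhds (1 : G)) :
    ∀ᶠ η in nhds (0 : E), ∀ s ∈ Icc (0 : ℝ) 1, expCurve E G ξ η s ∈ U := by
  obtain ⟨f, -, hfU⟩ := (SmoothBumpFunction.nhds_basis_support (I := 𝓘(ℝ, E)) hU).mem_iff.1 hU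
  obtain ⟨C, hC⟩ := exists_norm_dR_le (V := ℝ) f.contMDiff f.hasCompactSupport
  obtain ⟨K, hK0, hK⟩ := exists_bound_Ad_lieExp (G := G) (-ξ)
  have hC0 : 0 ≤ C := (norm_nonneg _).trans (hC 1)
  have hlim : ∀ᶠ η in nhds (0 : E), C * (K * ‖η‖) < 1 := by
    have : ContinuousAt (fun η : E => C * (K * ‖η‖)) 0 := by fun_prop
    exact this.eventually_lt continuousAt_const (by simp)
  filter_upwards [hlim] with η hη s hs
  apply hfU
  have h1 : ∀ s ∈ Icc (0 : ℝ) 1, HasDerivWithinAt (fun s => f (expCurve E G ξ η s))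
      (dR E f (expCurve E G ξ η s) (AdE E (expE E G (s • -ξ)) η)) (Icc 0 1) s :=
    fun s _ => (HasRD.hasDerivAt_comp (V := ℝ) (f := f) (hasRD_expCurve (G := G) (ξ : LieAlg E G) η s)
      (f.contMDiff.mdifferentiable (by simp) _)).hasDerivWithinAt
  have h2 := norm_image_sub_le_of_norm_deriv_le_segment' (C := C * (K * ‖η‖)) h1
    (fun s hs => ((dR E f _).le_of_opNorm_le (hC _) _).trans
      (mul_le_mul_of_nonneg_left (hK s (Ico_subset_Icc_self hs) η) hC0)) s hs
  rw [expCurve_zero, f.eq_one] at h2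
  intro h3
  simp only [h3] at h2
  have h4 : C * (K * ‖η‖) * (s - 0) ≤ C * (K * ‖η‖) := by
    rw [sub_zero]
    exact mul_le_of_le_one_right (by positivity) hs.2
  norm_num at h2
  linarith

/-- The coordinate of the curve is compared with ∫₀^s Ad(exp(-rξ))η dr, which is s·expQuot(-s ad
ξ)η. The derivatives in s differ by (dR χ - 1) applied to a vector of size at most K‖η‖, and dR χ is
close to 1 near the identity, so the error is o(‖η‖). -/
theorem hasFDerivAt_coord_expCurve (ξ : E) :
    HasFDerivAt (fun η : E => coord E G (expCurve E G ξ η 1))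
      (expQuotE E G (-ξ)) 0 := by
  obtain ⟨K, hK0, hK⟩ := exists_bound_Ad_lieExp (G := G) (-ξ)
  rw [hasFDerivAt_iff_isLittleO_nhds_zero, Asymptotics.isLittleO_iff]
  intro ε hε
  have hcont : ContinuousAt (fun g => dR E (coord E G) g) 1 :=
    (contMDiff_dR contMDiff_coord).continuous.continuousAt
  -- The denominator is K + 1 because K may be 0; multiplied by K‖η‖ the bound stays below ε‖η‖.
  have hU : {g : G | ‖dR E (coord E G) g - ContinuousLinearMap.id ℝ E‖ ≤ ε / (K + 1)} ∈
      nhds (1 : G) := by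
    have := hcont (Metric.closedBall_mem_nhds _ (by positivity : 0 < ε / (K + 1)))
    filter_upwards [this] with g hg
    rw [← dR_coord_one (G := G), ← dist_eq_norm]
    exact hg
  filter_upwards [eventually_expCurve_mem ξ hU] with η hη
  have h1 : ∀ s ∈ Icc (0 : ℝ) 1, HasDerivWithinAt
      (fun s => coord E G (expCurve E G ξ η s) - (s • expQuot (s • adE E G (-ξ))) η)
      (dR E (coord E G) (expCurve E G ξ η s) (AdE E (expE E G (s • -ξ)) η) -
        AdE E (expE E G (s • -ξ)) η) (Icc 0 1) s := by
    intro s _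
    have h2 : HasDerivAt (fun s => coord E G (expCurve E G ξ η s))
      (dR E (coord E G) (expCurve E G ξ η s) (AdE E (expE E G (s • -ξ)) η)) s :=
      (hasRD_expCurve (G := G) (ξ : LieAlg E G) η s).hasDerivAt_comp (mdifferentiable_coord _)
    have h3 : HasDerivAt (fun s : ℝ => (s • expQuot (s • adE E G (-ξ))) η)
      (NormedSpace.exp (s • adE E G (-ξ)) η) s := by
      have := (hasDerivAt_smul_expQuot (adE E G (-ξ)) s).clm_apply (hasDerivAt_const s η)
      simpa using! this
    rw [← AdE_expE_smul] at h3
    exact (h2.sub h3).hasDerivWithinAt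
  have h2 := norm_image_sub_le_of_norm_deriv_le_segment_01' (C := ε * ‖η‖) h1 (fun s hs => by
    have hs' := Ico_subset_Icc_self hs
    have h3 : ‖(dR E (coord E G) (expCurve E G ξ η s) - ContinuousLinearMap.id ℝ E)
      (AdE E (expE E G (s • -ξ)) η)‖ ≤ ε / (K + 1) * (K * ‖η‖) :=
      (ContinuousLinearMap.le_of_opNorm_le _ (hη s hs') _).trans
        (mul_le_mul_of_nonneg_left (hK s hs' η) (by positivity))
    refine h3.trans ?_
    rw [div_mul_eq_mul_div, div_le_iff₀ (by positivity)]
    nlinarith [mul_nonneg hε.le (norm_nonneg η)])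
  refine le_trans (le_of_eq ?_) h2
  have h4 : expCurve E G ξ 0 1 = 1 := by rw [expCurve_one]; simp
  congr 1
  simp only [one_smul, zero_smul, zero_apply, sub_zero, expCurve_zero, zero_add, h4, expQuotE]
  abel

theorem hasMFDerivAt_expCurve (ξ : E) :
    HasMFDerivAt 𝓘(ℝ, E) 𝓘(ℝ, E) (fun η : E => expCurve E G ξ η 1) 0 (expQuotE E G (-ξ)) := by
  have h4 : expCurve E G ξ 0 1 = 1 := by rw [expCurve_one]; simp
  refine hasMFDerivAt_of_coord h4 ?_ (hasFDerivAt_coord_expCurve ξ)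
  intro U hU
  have h5 : U ∈ nhds (1 : G) := by rw [← h4]; exact hU
  show ∀ᶠ η in nhds (0 : E), expCurve E G ξ η 1 ∈ U
  filter_upwards [eventually_expCurve_mem ξ h5] with η hη
  exact hη 1 (by simp)

theorem isLinearMap_adE : IsLinearMap ℝ (adE E G) :=
  ⟨fun x y => ContinuousLinearMap.ext fun η =>
      add_lie (show LieAlg E G from x) (show LieAlg E G from y) (show LieAlg E G from η),
    fun c x => ContinuousLinearMap.ext fun η =>
      smul_lie c (show LieAlg E G from x) (show LieAlg E G from η)⟩

theorem adE_neg (ξ : E) : adE E G (-ξ) = -adE E G ξ := isLinearMap_adE.map_neg ξ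

/-- exp(y)exp(ξ)⁻¹ is the conjugate by exp ξ of exp(-ξ)exp(y), the endpoint of `expCurve` for η = y
- ξ. The derivative is Ad(exp ξ) ∘ expQuot(-ad ξ), which `exp_mul_expQuot_neg` simplifies. -/
theorem hasRD_expE (ξ : E) : HasRD 𝓘(ℝ, E) (expE E G) ξ (expQuotE E G ξ) := by
  have h2 := (hasMFDerivAt_Ad (E := E) (expE E G ξ) (p := expCurve E G ξ 0 1)
    (by rw [expCurve_one]; simp)).comp (0 : E) (hasMFDerivAt_expCurve (G := G) ξ)
  have h3 : ∀ p : E, p = 0 → HasMFDerivAt 𝓘(ℝ, E) 𝓘(ℝ, E) ((fun g : G => expE E G ξ * g *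
      (expE E G ξ)⁻¹) ∘ (fun η : E => expCurve E G ξ η 1)) p
      ((AdE E (expE E G ξ)).comp (expQuotE E G (-ξ)) : E →L[ℝ] E) := by
    rintro p rfl; exact h2
  have h4 := HasMFDerivAt.comp (f := fun y : E => y - ξ) ξ (h3 (ξ - ξ) (sub_self ξ))
    ((hasFDerivAt_id (𝕜 := ℝ) ξ).sub_const ξ).hasMFDerivAt
  have h5 : (AdE E (expE E G ξ)).comp (expQuotE E G (-ξ)) = expQuotE E G ξ := by
    have h6 := AdE_expE_smul (G := G) ξ 1
    rw [one_smul, one_smul] at h6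
    rw [h6, expQuotE, expQuotE, adE_neg]
    exact exp_mul_expQuot_neg _
  have h7 : ((AdE E (expE E G ξ)).comp (expQuotE E G (-ξ))).comp (ContinuousLinearMap.id ℝ E) =
    expQuotE E G ξ := h5
  rw [← h7]
  refine hasMFDerivAt_of_eq h4 fun y => ?_
  simp [expCurve_one]

theorem contDiff_expQuotE : ContDiff ℝ ∞ (expQuotE E G) := by
  have h1 : ContDiff ℝ ∞ (adE E G) :=
    (LinearMap.toContinuousLinearMap (IsLinearMap.mk' (adE E G) isLinearMap_adE)).contDiff
  exact contDiff_expQuot.comp h1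

theorem HasRD.mul_const {EN : Type*} [NormedAddCommGroup EN] [NormedSpace ℝ EN]
    {HN : Type*} [TopologicalSpace HN] {I : ModelWithCorners ℝ EN HN} {N : Type*}
    [TopologicalSpace N] [ChartedSpace HN N] {c : N → G} {x : N} {L : EN →L[ℝ] LieAlg E G}
    (h : HasRD I c x L) (g : G) : HasRD I (fun y => c y * g) x L := by
  have h1 := h.mul (hasRD_const (E := E) (I := I) g x)
  have h2 : L + (Ad (c x)).comp (0 : EN →L[ℝ] LieAlg E G) = L := by ext; simp
  rwa [h2] at h1

variable (E G) in
/-- The exponential map near `ξ₀` in the coordinate at `1`. -/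
def expCoord (ξ₀ ξ : E) : E := coord E G (expE E G ξ * (expE E G ξ₀)⁻¹)

theorem hasFDerivAt_expCoord (ξ₀ ξ : E) : HasFDerivAt (expCoord E G ξ₀)
    ((dR E (coord E G) (expE E G ξ * (expE E G ξ₀)⁻¹)).comp (expQuotE E G ξ)) ξ := by
  have h := ((hasRD_expE (G := G) ξ).mul_const (expE E G ξ₀)⁻¹).comp_fun (f := coord E G)
    (mdifferentiable_coord _)
  exact h.hasFDerivAt

theorem continuous_expE : Continuous (expE E G) := by
  refine continuous_iff_continuousAt.2 fun ξ => ?_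
  obtain ⟨B, h, -⟩ := HasRD.hasMFDerivAt_mul_const (E := E) (hasRD_expE (G := G) ξ)
  exact h.continuousAt

theorem expE_eq_symm (ξ₀ : E) : ∀ᶠ ξ in nhds ξ₀,
    expE E G ξ = (extChartAt 𝓘(ℝ, E) (1 : G)).symm (expCoord E G ξ₀ ξ) * expE E G ξ₀ := by
  have h1 : Filter.Tendsto (fun ξ => expE E G ξ * (expE E G ξ₀)⁻¹) (nhds ξ₀) (nhds 1) := by
    have : Continuous fun ξ => expE E G ξ * (expE E G ξ₀)⁻¹ :=
      (contMDiff_mul_const (E := E) (expE E G ξ₀)⁻¹).continuous.comp continuous_expE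
    have := this.tendsto ξ₀
    rwa [mul_inv_cancel] at this
  filter_upwards [h1.eventually (coord_eventuallyEq (E := E)),
    h1.eventually (extChartAt_source_mem_nhds (I := 𝓘(ℝ, E)) (1 : G))] with ξ h2 h3
  rw [expCoord, h2, (extChartAt 𝓘(ℝ, E) (1 : G)).left_inv h3]
  simp

/-- Bootstrap: the derivative of exp in the coordinate is an expression in exp itself and the smooth
`expQuotE`, so C^k regularity of exp gives C^(k+1). -/
theorem contMDiff_expE_nat (k : ℕ) : ContMDiff 𝓘(ℝ, E) 𝓘(ℝ, E) k (expE E G) := by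
  induction k with
  | zero => exact contMDiff_zero_iff.2 continuous_expE
  | succ k ih =>
    intro ξ₀
    have hle : (k : WithTop ℕ∞) ≤ ∞ := by exact_mod_cast le_top
    have hf : ContDiff ℝ (k + 1 : ℕ) (expCoord E G ξ₀) := by
      have h1 : fderiv ℝ (expCoord E G ξ₀) = fun ξ =>
          (dR E (coord E G) (expE E G ξ * (expE E G ξ₀)⁻¹)).comp (expQuotE E G ξ) :=
        funext fun ξ => (hasFDerivAt_expCoord ξ₀ ξ).fderiv
      push_cast
      rw [contDiff_succ_iff_fderiv]
      refine ⟨fun ξ => (hasFDerivAt_expCoord ξ₀ ξ).differentiableAt, by simp, ?_⟩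
      rw [h1]
      refine ContDiff.clm_comp ?_ (contDiff_expQuotE.of_le hle)
      have h2 : ContMDiff 𝓘(ℝ, E) 𝓘(ℝ, E) k (fun ξ => expE E G ξ * (expE E G ξ₀)⁻¹) :=
        ((contMDiff_mul_const (E := E) (expE E G ξ₀)⁻¹).of_le hle).comp ih
      exact (((contMDiff_dR contMDiff_coord).of_le hle).comp h2).contDiff
    have hle' : ((k + 1 : ℕ) : WithTop ℕ∞) ≤ ∞ := by exact_mod_cast le_top
    refine ContMDiffAt.congr_of_eventuallyEq ?_ (expE_eq_symm (G := G) ξ₀)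
    have h3 : expCoord E G ξ₀ ξ₀ = extChartAt 𝓘(ℝ, E) (1 : G) 1 := by
      rw [expCoord, mul_inv_cancel, coord_eventuallyEq.eq_of_nhds]
    have h4 : ContMDiffAt 𝓘(ℝ, E) 𝓘(ℝ, E) ∞ (extChartAt 𝓘(ℝ, E) (1 : G)).symm
        (expCoord E G ξ₀ ξ₀) := by
      rw [h3]
      exact (contMDiffOn_extChartAt_symm (1 : G)).contMDiffAt (extChartAt_target_mem_nhds _)
    exact ((contMDiff_mul_const (E := E) (expE E G ξ₀)).of_le hle' _).comp ξ₀
      ((h4.of_le hle').comp ξ₀ hf.contMDiff.contMDiffAt)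

theorem contMDiff_expE : ContMDiff 𝓘(ℝ, E) 𝓘(ℝ, E) ∞ (expE E G) :=
  contMDiff_infty.2 contMDiff_expE_nat

variable (E) in
/-- The logarithm as a map to the model space. -/
def logE (u : G) : E := lieLog u

theorem logE_expE (hexp : Bijective (lieExp : LieAlg E G → G)) (ξ : E) :
    logE E (expE E G ξ) = ξ :=
  leftInverse_invFun hexp.1 (ξ : LieAlg E G)

theorem expE_logE (hexp : Bijective (lieExp : LieAlg E G → G)) (u : G) :
    expE E G (logE E u) = u :=
  rightInverse_invFun hexp.2 u

theorem expQuotE_bijective (hinj : Injective (lieExp : LieAlg E G → G)) (ξ : E) :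
    Bijective (expQuotE E G ξ) := by
  have h : Injective (expQuotE E G ξ) := expQuot_adE_injective hinj (ξ : LieAlg E G)
  exact ⟨h, (LinearMap.injective_iff_surjective (f := (expQuotE E G ξ : E →ₗ[ℝ] E))).1 h⟩

/-- Since the differential of exp is invertible everywhere, the inverse function theorem gives
smooth local inverses. Global injectivity of exp identifies them with log, so continuity of log is
not needed beforehand. -/
theorem contMDiff_logE (hexp : Bijective (lieExp : LieAlg E G → G)) :
    ContMDiff 𝓘(ℝ, E) 𝓘(ℝ, E) ∞ (logE E : G → E) := by
  intro u₀
  set ξ₀ := logE E u₀ with hξ₀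
  have hu₀ : expE E G ξ₀ = u₀ := expE_logE hexp u₀
  have hf : ContDiffAt ℝ ∞ (expCoord E G ξ₀) ξ₀ :=
    (contMDiff_coord.comp ((contMDiff_mul_const (E := E) (expE E G ξ₀)⁻¹).comp
      contMDiff_expE)).contDiff.contDiffAt
  let f' : E ≃L[ℝ] E := (LinearEquiv.ofBijective (expQuotE E G ξ₀ : E →ₗ[ℝ] E)
    (expQuotE_bijective hexp.1 ξ₀)).toContinuousLinearEquiv
  have hf' : HasFDerivAt (expCoord E G ξ₀) (f' : E →L[ℝ] E) ξ₀ := by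
    have h1 := hasFDerivAt_expCoord (G := G) ξ₀ ξ₀
    rw [mul_inv_cancel, dR_coord_one] at h1
    exact h1
  set h := hf.toOpenPartialHomeomorph (expCoord E G ξ₀) hf' (by simp) with hh
  have hsm : ContDiffAt ℝ ∞ h.symm (expCoord E G ξ₀ ξ₀) := hf.to_localInverse hf' (by simp)
  have hc : ContMDiff 𝓘(ℝ, E) 𝓘(ℝ, E) ∞ (fun u : G => coord E G (u * u₀⁻¹)) :=
    contMDiff_coord.comp (contMDiff_mul_const (E := E) u₀⁻¹)
  have h3 : expCoord E G ξ₀ ξ₀ = coord E G (u₀ * u₀⁻¹) := by rw [expCoord, hu₀]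
  have hcomp : ContMDiffAt 𝓘(ℝ, E) 𝓘(ℝ, E) ∞ (fun u : G => h.symm (coord E G (u * u₀⁻¹))) u₀ :=
    ContMDiffAt.comp u₀ (g := h.symm) (by rw [← h3]; exact hsm.contMDiffAt) hc.contMDiffAt
  refine hcomp.congr_of_eventuallyEq ?_
  have hlim1 : Filter.Tendsto (fun u : G => coord E G (u * u₀⁻¹)) (nhds u₀)
      (nhds (expCoord E G ξ₀ ξ₀)) := by rw [h3]; exact hc.continuous.tendsto u₀
  have hmem : expCoord E G ξ₀ ξ₀ ∈ h.target :=
    hf.image_mem_toOpenPartialHomeomorph_target hf' (by simp)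
  have hsymm : h.symm (expCoord E G ξ₀ ξ₀) = ξ₀ :=
    h.left_inv (hf.mem_toOpenPartialHomeomorph_source hf' (by simp))
  have hlim2 : Filter.Tendsto (fun u : G => h.symm (coord E G (u * u₀⁻¹))) (nhds u₀)
      (nhds ξ₀) := by
    have := hcomp.continuousAt.tendsto
    rwa [← h3, hsymm] at this
  have hlim3 : Filter.Tendsto (fun u : G => u * u₀⁻¹) (nhds u₀) (nhds 1) := by
    have := (contMDiff_mul_const (E := E) u₀⁻¹).continuous.tendsto u₀
    rwa [mul_inv_cancel] at this
  -- For such u the point exp(h.symm(χ(u u₀⁻¹))) has the same coordinate as u relative to u₀, inside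
  -- the chart domain, so it equals u.
  filter_upwards [hlim1.eventually (h.open_target.mem_nhds hmem),
    hlim2.eventually (expE_eq_symm (G := G) ξ₀), hlim3.eventually (coord_eventuallyEq (E := E)),
    hlim3.eventually (extChartAt_source_mem_nhds (I := 𝓘(ℝ, E)) (1 : G))] with u h4 h5 h6 h7
  have h8 : expCoord E G ξ₀ (h.symm (coord E G (u * u₀⁻¹))) = coord E G (u * u₀⁻¹) :=
    h.right_inv h4
  rw [h8, h6, (extChartAt 𝓘(ℝ, E) (1 : G)).left_inv h7, hu₀] at h5
  rw [← h6, inv_mul_cancel_right] at h5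
  exact (logE_expE hexp _).symm.trans (congrArg (logE E) h5) |>.symm

theorem HasRD.logE (hexp : Bijective (lieExp : LieAlg E G → G)) {EN : Type*}
    [NormedAddCommGroup EN] [NormedSpace ℝ EN] {HN : Type*} [TopologicalSpace HN]
    {I : ModelWithCorners ℝ EN HN} {N : Type*} [TopologicalSpace N] [ChartedSpace HN N]
    {c : N → G} {x : N} {L : EN →L[ℝ] LieAlg E G} (h : HasRD I c x L) :
    (expQuotE E G (Flower.logE E (c x))).comp
      ((dR E (Flower.logE E : G → E) (c x)).comp (L : EN →L[ℝ] E)) = L := by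
  have h1 := h.comp_fun (f := (Flower.logE E : G → E))
    ((contMDiff_logE hexp).mdifferentiable (by simp) _)
  have h2 := (hasRD_expE (G := G) (Flower.logE E (c x))).comp (d := fun y => Flower.logE E (c y)) h1
  have h3 : (fun y => expE E G (Flower.logE E (c y))) = c := funext fun y => expE_logE hexp _
  rw [h3] at h2
  exact h2.unique h

end Exp

/-! ### The operator T(u), its inverse, and the derivative of log -/

section Translation
variable {E : Type*} [NormedAddCommGroup E] [NormedSpace ℝ E] [FiniteDimensional ℝ E]
  {G : Type*} [TopologicalSpace G] [T2Space G] [ChartedSpace E G] [Group G] [LieGroup 𝓘(ℝ, E) ∞ G]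

theorem precomp_pow (A : E →L[ℝ] E) (k : ℕ) :
    (ContinuousLinearMap.precomp ℝ A : (E →L[ℝ] ℝ) →L[ℝ] (E →L[ℝ] ℝ)) ^ k =
      ContinuousLinearMap.precomp ℝ (A ^ k) := by
  induction k with
  | zero => ext q ξ; simp
  | succ k ih => rw [pow_succ', ih, pow_succ]; ext q ξ; simp

/-- Transposition reverses products, but powers of a single operator are unaffected, and it is
continuous and linear, so it passes through the series. -/
theorem tsum_precomp (A : E →L[ℝ] E) :
    ∑' k : ℕ, (((k + 1).factorial : ℝ)⁻¹ •
      (ContinuousLinearMap.precomp ℝ A : (E →L[ℝ] ℝ) →L[ℝ] (E →L[ℝ] ℝ)) ^ k) =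
    ContinuousLinearMap.precomp ℝ (expQuot A) := by
  have h := (ContinuousLinearMap.compL ℝ E E ℝ).flip.map_tsum (summable_expQuot A)
  have h1 : ∀ B : E →L[ℝ] E, (ContinuousLinearMap.compL ℝ E E ℝ).flip B =
    ContinuousLinearMap.precomp ℝ B := fun B => rfl
  rw [h1] at h
  rw [expQuot, h]
  refine tsum_congr fun k => ?_
  rw [precomp_pow, map_smul, h1]

theorem T_apply (u : G) (q : CoLieAlg E G) (ξ : LieAlg E G) :
    T u q ξ = -q (expQuotE E G (logE E u) ξ) := by
  have h := tsum_precomp (adE E G (logE E u))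
  have h1 : T u = (-∑' k : ℕ, (((k + 1).factorial : ℝ)⁻¹ •
      (ContinuousLinearMap.precomp ℝ (adE E G (logE E u)) :
        (E →L[ℝ] ℝ) →L[ℝ] (E →L[ℝ] ℝ)) ^ k) : (E →L[ℝ] ℝ) →L[ℝ] (E →L[ℝ] ℝ)) := rfl
  rw [h1, h]
  rfl

/-- T(u) is minus the transpose of expQuot(ad(log u)). The transpose of a surjective map is
injective, and finite dimension gives the rest. -/
theorem T_bijective (hinj : Injective (lieExp : LieAlg E G → G)) (u : G) :
    Bijective (T u : CoLieAlg E G → CoLieAlg E G) := by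
  have hb := expQuotE_bijective (G := G) hinj (logE E u)
  have h : Injective (T u : CoLieAlg E G → CoLieAlg E G) := by
    rw [injective_iff_map_eq_zero]
    intro q hq
    ext ξ
    obtain ⟨η, rfl⟩ := hb.2 ξ
    have h1 := T_apply u q η
    rw [hq] at h1
    exact (neg_eq_zero.1 h1.symm)
  have : FiniteDimensional ℝ (CoLieAlg E G) := inferInstanceAs (FiniteDimensional ℝ (E →L[ℝ] ℝ))
  refine ⟨h, ?_⟩
  have h2 := (LinearMap.injective_iff_surjective
    (f := ((T u : CoLieAlg E G →L[ℝ] CoLieAlg E G) : CoLieAlg E G →ₗ[ℝ] CoLieAlg E G))).1 h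
  exact h2

/-- The transpose of A·expQuot(A) = e^A - 1 at A = ad(log u), where e^A = Ad(u); the sign in T turns
Ad* - 1 into 1 - Ad*. -/
theorem T_comp_adStar (hexp : Bijective (lieExp : LieAlg E G → G)) (u : G) :
    (T u).comp (adStar (lieLog u)) = ContinuousLinearMap.id ℝ (CoLieAlg E G) - AdStar u := by
  ext q ξ
  have h1 := T_apply u (adStar (lieLog u) q) ξ
  have h2 := congrArg (fun L : E →L[ℝ] E => L ξ) (mul_expQuot (adE E G (logE E u)))
  have h3 := AdE_expE_smul (G := G) (logE E u) 1
  rw [one_smul, one_smul, expE_logE hexp] at h3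
  rw [← h3] at h2
  have h4 : adStar (lieLog u) q (expQuotE E G (logE E u) ξ) = q (Ad u ξ) - q ξ := by
    rw [← map_sub]
    exact congrArg q h2
  refine h1.trans ?_
  rw [h4]
  simp [AdStar]

variable (E) in
/-- An element of `𝔤*` as a functional on the model space. -/
def coE (q : CoLieAlg E G) : E →L[ℝ] ℝ := q

/-- `x(u) = T(u)⁻¹ q`. -/
def invT (q : CoLieAlg E G) (u : G) : CoLieAlg E G :=
  (-(coE E q).comp (expQuotE E G (logE E u)).inverse : E →L[ℝ] ℝ)

theorem expQuotE_inverse_apply (hinj : Injective (lieExp : LieAlg E G → G)) (p ξ : E) :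
    (expQuotE E G p).inverse (expQuotE E G p ξ) = ξ := by
  let f' : E ≃L[ℝ] E := (LinearEquiv.ofBijective (expQuotE E G p : E →ₗ[ℝ] E)
    (expQuotE_bijective hinj p)).toContinuousLinearEquiv
  have h : expQuotE E G p = (f' : E →L[ℝ] E) := rfl
  rw [h, ContinuousLinearMap.inverse_equiv]
  exact f'.symm_apply_apply ξ

theorem T_invT (hinj : Injective (lieExp : LieAlg E G → G)) (q : CoLieAlg E G) (u : G) :
    T u (invT q u) = q := by
  ext ξ
  rw [T_apply]
  have h : invT q u (expQuotE E G (logE E u) ξ) = -q ξ :=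
    congrArg (fun η => -q η) (expQuotE_inverse_apply hinj (logE E u) ξ)
  rw [h, neg_neg]

theorem contMDiff_invT (hexp : Bijective (lieExp : LieAlg E G → G)) (q : CoLieAlg E G)
    (ξ : LieAlg E G) : ContMDiff 𝓘(ℝ, E) 𝓘(ℝ, ℝ) ∞ fun u : G => invT q u ξ := by
  have h : ContDiff ℝ ∞ fun p : E => (expQuotE E G p).inverse (ξ : E) := by
    refine contDiff_iff_contDiffAt.2 fun p => ?_
    let f' : E ≃L[ℝ] E := (LinearEquiv.ofBijective (expQuotE E G p : E →ₗ[ℝ] E)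
      (expQuotE_bijective hexp.1 p)).toContinuousLinearEquiv
    have h1 : ContDiffAt ℝ ∞ ContinuousLinearMap.inverse (expQuotE E G p) :=
      contDiffAt_map_inverse f'
    exact (h1.comp p contDiff_expQuotE.contDiffAt).clm_apply contDiffAt_const
  exact (((coE E q).contDiff.comp h).neg).contMDiff.comp (contMDiff_logE hexp)

/-- Differentiating exp(log v) = v shows that the derivative of log in right-invariant directions is
expQuot(ad(log u))⁻¹. The minus sign in T turns q composed with it into -T(u)⁻¹q. This is where x(u)
enters. -/
theorem dR_logE (hexp : Bijective (lieExp : LieAlg E G → G)) (q : CoLieAlg E G) (u : G)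
    (ζ : LieAlg E G) : dR E (fun v : G => q (lieLog v)) u ζ = -invT q u ζ := by
  have h0 : HasRD 𝓘(ℝ, E) (fun y : G => y * u) 1 (ContinuousLinearMap.id ℝ (LieAlg E G)) :=
    hasRD_id.mul_const u
  have h1 := congrArg (fun L : E →L[ℝ] E => L ζ) (h0.logE hexp)
  have h2 : ∀ v : G, v = u → expQuotE E G (logE E v) (dR E (logE E : G → E) v ζ) = ζ →
      dR E (logE E : G → E) u ζ = (expQuotE E G (logE E u)).inverse ζ := by
    rintro v rfl h
    rw [← expQuotE_inverse_apply hexp.1 (logE E v) (dR E (logE E : G → E) v ζ), h]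
  have h3 := h2 (1 * u) (one_mul u) h1
  have h4 : HasMFDerivAt 𝓘(ℝ, E) 𝓘(ℝ, E) (fun y : G => logE E (y * u)) 1 (dR E (logE E : G → E) u : E →L[ℝ] E) :=
    (((contMDiff_logE hexp).comp (contMDiff_mul_const (E := E) u)).mdifferentiable (by simp) 1).hasMFDerivAt
  have h5 : HasMFDerivAt 𝓘(ℝ, E) 𝓘(ℝ, ℝ) (fun y : G => (coE E q) (logE E (y * u))) 1
      ((coE E q).comp (dR E (logE E : G → E) u)) :=
    HasMFDerivAt.comp (f := fun y : G => logE E (y * u)) (1 : G)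
      (HasFDerivAt.hasMFDerivAt (𝕜 := ℝ) (E := E) (E' := ℝ) (f := coE E q) (f' := coE E q) (coE E q).hasFDerivAt) h4
  have h6 : dR E (fun v : G => q (lieLog v)) u ζ = (coE E q) (dR E (logE E : G → E) u ζ) :=
    congrArg (fun L : E →L[ℝ] ℝ => L ζ) h5.mfderiv
  rw [h6, h3]
  exact (neg_neg _).symm

end Translation

/-! ### Biderivations on polynomial rings are determined by coefficients and variables -/

section Algebra

/-- `br` is a skew-symmetric bilinear biderivation. -/
structure IsSkewBider {P : Type*} [CommRing P] [Algebra ℝ P] (br : P → P → P) : Prop where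
  add_left : ∀ x y z, br (x + y) z = br x z + br y z
  smul_left : ∀ (c : ℝ) x y, br (c • x) y = c • br x y
  skew : ∀ x y, br x y = -br y x
  leibniz : ∀ x y z, br x (y * z) = br x y * z + y * br x z

namespace IsSkewBider

variable {P : Type*} [CommRing P] [Algebra ℝ P] {br : P → P → P}

theorem add_right (h : IsSkewBider br) (x y z : P) : br x (y + z) = br x y + br x z := by
  rw [h.skew, h.add_left, h.skew x y, h.skew x z]; ring

theorem smul_right (h : IsSkewBider br) (c : ℝ) (x y : P) : br x (c • y) = c • br x y := by
  rw [h.skew, h.smul_left, h.skew x y, smul_neg]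

theorem leibniz_left (h : IsSkewBider br) (x y z : P) :
    br (x * y) z = br x z * y + x * br y z := by
  rw [h.skew, h.leibniz, h.skew x z, h.skew y z]; ring

theorem zero_right (h : IsSkewBider br) (x : P) : br x 0 = 0 := by
  have := h.smul_right 0 x 0
  rwa [zero_smul, zero_smul] at this

theorem zero_left (h : IsSkewBider br) (x : P) : br 0 x = 0 := by
  rw [h.skew, h.zero_right, neg_zero]

theorem neg_right (h : IsSkewBider br) (x y : P) : br x (-y) = -br x y := by
  have := h.smul_right (-1) x y
  rwa [neg_one_smul, neg_one_smul] at this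

theorem neg_left (h : IsSkewBider br) (x y : P) : br (-x) y = -br x y := by
  rw [h.skew, h.neg_right, ← h.skew]

theorem sum_right (h : IsSkewBider br) {ι : Type*} (s : Finset ι) (f : ι → P) (x : P) :
    br x (∑ i ∈ s, f i) = ∑ i ∈ s, br x (f i) := by
  classical
  induction s using Finset.induction_on with
  | empty => simp [h.zero_right]
  | insert a s ha ih => rw [Finset.sum_insert ha, Finset.sum_insert ha, h.add_right, ih]

theorem sum_left (h : IsSkewBider br) {ι : Type*} (s : Finset ι) (f : ι → P) (x : P) :
    br (∑ i ∈ s, f i) x = ∑ i ∈ s, br (f i) x := by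
  rw [h.skew, h.sum_right, ← Finset.sum_neg_distrib]
  exact Finset.sum_congr rfl fun i _ => (h.skew _ _).symm

/-- The Jacobiator. -/
def jac (br : P → P → P) (x y z : P) : P := br x (br y z) + br y (br z x) + br z (br x y)

theorem jac_rot (x y z : P) : jac br x y z = jac br y z x := by
  unfold jac; ring

theorem jac_add (h : IsSkewBider br) (x y z w : P) :
    jac br x y (z + w) = jac br x y z + jac br x y w := by
  unfold jac
  simp only [h.add_right, h.add_left]; ring

/-- In the Leibniz expansion the mixed terms, a product of two single brackets, cancel in pairs by
skew-symmetry. The Jacobiator is thus a derivation in its last slot. -/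
theorem jac_mul (h : IsSkewBider br) (x y z w : P) :
    jac br x y (z * w) = jac br x y z * w + z * jac br x y w := by
  unfold jac
  simp only [h.leibniz, h.leibniz_left, h.add_right]
  rw [h.skew z x, h.skew w x]
  simp only [h.neg_right, neg_mul, mul_neg]
  ring

end IsSkewBider

open IsSkewBider

variable {A : Type*} [CommRing A] [Algebra ℝ A] {σ : Type*}

/-- Coefficients and variables of a polynomial ring. -/
inductive IsGen : MvPolynomial σ A → Prop
  | C (a : A) : IsGen (MvPolynomial.C a)
  | X (p : σ) : IsGen (MvPolynomial.X p)

theorem gen_induction {p : MvPolynomial σ A → Prop} (hg : ∀ x, IsGen x → p x)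
    (ha : ∀ x y, p x → p y → p (x + y)) (hm : ∀ x y, p x → p y → p (x * y)) (x) : p x :=
  MvPolynomial.induction_on x (fun a => hg _ (.C a)) ha fun _ i h => hm _ _ h (hg _ (.X i))

/-- A derivation that vanishes on generators vanishes; the cyclic symmetry of the Jacobiator brings
each slot in turn to the last place. -/
theorem jac_eq_zero_of_gen {br : MvPolynomial σ A → MvPolynomial σ A → MvPolynomial σ A}
    (h : IsSkewBider br) (hg : ∀ x y z, IsGen x → IsGen y → IsGen z → jac br x y z = 0)
    (x y z) : jac br x y z = 0 := by
  have step : ∀ x y, (∀ z, IsGen z → jac br x y z = 0) → ∀ z, jac br x y z = 0 := fun x y h1 =>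
    gen_induction h1 (fun z w hz hw => by rw [h.jac_add, hz, hw, add_zero])
      (fun z w hz hw => by rw [h.jac_mul, hz, hw]; ring)
  have h1 : ∀ x y, IsGen x → IsGen y → ∀ z, jac br x y z = 0 := fun x y hx hy =>
    step x y fun z hz => hg x y z hx hy hz
  have h2 : ∀ x, IsGen x → ∀ y z, jac br x y z = 0 := fun x hx y z => by
    rw [jac_rot, jac_rot]
    exact step z x (fun w hw => by rw [jac_rot]; exact h1 _ _ hx hw _) y
  exact step x y (fun w hw => by rw [jac_rot, jac_rot]; exact h2 _ hw _ _) z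

/-- The bracket of a variable and a coefficient is a coefficient and coefficients commute, so
triples with at least two coefficients are automatic. -/
theorem jac_eq_zero_of_X_C {br : MvPolynomial σ A → MvPolynomial σ A → MvPolynomial σ A}
    (h : IsSkewBider br) (V : σ → A → A) (hCC : ∀ a b, br (C a) (C b) = 0)
    (hXC : ∀ p a, br (X p) (C a) = C (V p a))
    (hXXC : ∀ p q a, jac br (X p) (X q) (C a) = 0)
    (hXXX : ∀ p q r, jac br (X p) (X q) (X r) = 0) (x y z) : jac br x y z = 0 := by
  have hCX : ∀ p a, br (C a) (X p) = -C (V p a) := fun p a => by rw [h.skew, hXC]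
  have hXCC : ∀ p a b, jac br (X p) (C a) (C b) = 0 := fun p a b => by
    simp [jac, hCC, hXC, hCX, h.zero_right, h.neg_right]
  refine jac_eq_zero_of_gen h (fun x y z hx hy hz => ?_) x y z
  rcases hx with a | p <;> rcases hy with b | q <;> rcases hz with c | r
  · simp [jac, hCC, h.zero_right]
  · rw [jac_rot, jac_rot]; exact hXCC _ _ _
  · rw [jac_rot]; exact hXCC _ _ _
  · rw [jac_rot]; exact hXXC _ _ _
  · exact hXCC _ _ _
  · rw [jac_rot, jac_rot]; exact hXXC _ _ _
  · exact hXXC _ _ _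
  · exact hXXX _ _ _

/-- Both sides are biderivations along Θ, so agreement extends from generators slot by slot. -/
theorem map_br_of_gen {Q : Type*} [CommRing Q] [Algebra ℝ Q]
    {br : MvPolynomial σ A → MvPolynomial σ A → MvPolynomial σ A}
    {br' : Q → Q → Q} (h : IsSkewBider br) (h' : IsSkewBider br') (Θ : MvPolynomial σ A →+* Q)
    (hg : ∀ x y, IsGen x → IsGen y → Θ (br x y) = br' (Θ x) (Θ y)) (x y) :
    Θ (br x y) = br' (Θ x) (Θ y) := by
  have step : ∀ x, (∀ y, IsGen y → Θ (br x y) = br' (Θ x) (Θ y)) →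
      ∀ y, Θ (br x y) = br' (Θ x) (Θ y) := fun x h1 =>
    gen_induction h1 (fun z w hz hw => by
        rw [h.add_right, map_add, hz, hw, map_add, h'.add_right])
      (fun z w hz hw => by
        rw [h.leibniz, map_add, map_mul, map_mul, hz, hw, map_mul, h'.leibniz])
  have h1 := fun x hx => step x fun y hy => hg x y hx hy
  refine step x (fun w hw => ?_) y
  rw [h.skew, map_neg, h1 w hw, ← h'.skew]

theorem map_br_of_X_C {Q : Type*} [CommRing Q] [Algebra ℝ Q]
    {br : MvPolynomial σ A → MvPolynomial σ A → MvPolynomial σ A}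
    {br' : Q → Q → Q} (h : IsSkewBider br) (h' : IsSkewBider br') (Θ : MvPolynomial σ A →+* Q)
    (hCC : ∀ a b, Θ (br (C a) (C b)) = br' (Θ (C a)) (Θ (C b)))
    (hXC : ∀ p a, Θ (br (X p) (C a)) = br' (Θ (X p)) (Θ (C a)))
    (hXX : ∀ p q, Θ (br (X p) (X q)) = br' (Θ (X p)) (Θ (X q))) (x y) :
    Θ (br x y) = br' (Θ x) (Θ y) := by
  refine map_br_of_gen h h' Θ (fun x y hx hy => ?_) x y
  rcases hx with a | p <;> rcases hy with b | q
  · exact hCC _ _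
  · rw [h.skew, map_neg, hXC, ← h'.skew]
  · exact hXC _ _
  · exact hXX _ _

/-- A derivation of the coefficients, extended to polynomials. -/
def coeffDer (D : Derivation ℝ A A) : Derivation ℝ (MvPolynomial σ A) (MvPolynomial σ A) :=
  have hco : ∀ (φ : MvPolynomial σ A) m, coeff m
      (∑ m ∈ φ.support, monomial m (D (φ.coeff m)) : MvPolynomial σ A) = D (φ.coeff m) := by
    classical
    intro φ m
    rw [coeff_sum]
    simp only [coeff_monomial, Finset.sum_ite_eq', mem_support_iff, ne_eq, ite_not]
    split_ifs with hm
    · rw [hm, map_zero]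
    · rfl
  Derivation.mk'
    -- The same formula as in `onCoeffs`, so that the flower bracket unfolds definitionally to the
    -- shape required by `isSkewBider_of_eq`.
    { toFun := fun φ => ∑ m ∈ φ.support, monomial m (D (φ.coeff m))
      map_add' := fun φ ψ => by ext m; rw [coeff_add, hco, hco, hco, coeff_add, map_add]
      map_smul' := fun c φ => by
        ext m
        simp only [RingHom.id_apply]
        rw [coeff_smul, hco, hco, coeff_smul, D.map_smul] }
    (fun φ ψ => by
      classical
      ext m
      simp only [LinearMap.coe_mk, AddHom.coe_mk, smul_eq_mul]
      rw [mul_comm ψ, hco, coeff_mul, map_sum, coeff_add, coeff_mul, coeff_mul]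
      simp only [hco]
      rw [← Finset.sum_add_distrib]
      exact Finset.sum_congr rfl fun x _ => by
        rw [D.leibniz, smul_eq_mul, smul_eq_mul, mul_comm (coeff x.2 ψ)])

theorem isSkewBider_of_eq [Fintype σ] (c : σ → σ → MvPolynomial σ A) (hc : ∀ p q, c p q = -c q p)
    (V : σ → Derivation ℝ A A) (br : MvPolynomial σ A → MvPolynomial σ A → MvPolynomial σ A)
    (hbr : ∀ φ ψ, br φ ψ = (∑ p, ∑ q, c p q * pderiv p φ * pderiv q ψ) +
      ∑ p, (pderiv p φ * coeffDer (V p) ψ - pderiv p ψ * coeffDer (V p) φ)) :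
    IsSkewBider br where
  add_left x y z := by
    have h1 : ∑ p, ∑ q, c p q * pderiv p (x + y) * pderiv q z =
        (∑ p, ∑ q, c p q * pderiv p x * pderiv q z) +
          ∑ p, ∑ q, c p q * pderiv p y * pderiv q z := by
      simp only [← Finset.sum_add_distrib]
      exact Finset.sum_congr rfl fun p _ => Finset.sum_congr rfl fun q _ => by rw [map_add]; ring
    have h2 : ∑ p, (pderiv p (x + y) * coeffDer (V p) z - pderiv p z * coeffDer (V p) (x + y)) =
        (∑ p, (pderiv p x * coeffDer (V p) z - pderiv p z * coeffDer (V p) x)) +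
          ∑ p, (pderiv p y * coeffDer (V p) z - pderiv p z * coeffDer (V p) y) := by
      simp only [← Finset.sum_add_distrib]
      exact Finset.sum_congr rfl fun p _ => by rw [map_add, map_add]; ring
    rw [hbr, hbr, hbr, h1, h2]; ring
  smul_left a x y := by
    have h1 : ∀ p, pderiv p (a • x) = a • pderiv p x := fun p => by
      rw [← algebraMap_smul A a x, Derivation.map_smul, algebraMap_smul]
    simp only [hbr, h1, Derivation.map_smul, smul_add, Finset.smul_sum]
    congr 1
    · exact Finset.sum_congr rfl fun p _ => Finset.sum_congr rfl fun q _ => by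
        rw [mul_smul_comm, smul_mul_assoc]
    · exact Finset.sum_congr rfl fun p _ => by
        rw [smul_mul_assoc, mul_smul_comm, smul_sub]
  skew x y := by
    simp only [hbr]
    rw [neg_add]
    congr 1
    · rw [Finset.sum_comm, ← Finset.sum_neg_distrib]
      refine Finset.sum_congr rfl fun p _ => ?_
      rw [← Finset.sum_neg_distrib]
      exact Finset.sum_congr rfl fun q _ => by rw [hc q p]; ring
    · rw [← Finset.sum_neg_distrib]
      exact Finset.sum_congr rfl fun p _ => by ring
  leibniz x y z := by
    have h1 : ∑ p, ∑ q, c p q * pderiv p x * pderiv q (y * z) =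
        (∑ p, ∑ q, c p q * pderiv p x * pderiv q y) * z +
          y * ∑ p, ∑ q, c p q * pderiv p x * pderiv q z := by
      simp only [Finset.sum_mul, Finset.mul_sum, ← Finset.sum_add_distrib]
      exact Finset.sum_congr rfl fun p _ => Finset.sum_congr rfl fun q _ => by
        rw [Derivation.leibniz, smul_eq_mul, smul_eq_mul]; ring
    have h2 : ∑ p, (pderiv p x * coeffDer (V p) (y * z) - pderiv p (y * z) * coeffDer (V p) x) =
        (∑ p, (pderiv p x * coeffDer (V p) y - pderiv p y * coeffDer (V p) x)) * z +
          y * ∑ p, (pderiv p x * coeffDer (V p) z - pderiv p z * coeffDer (V p) x) := by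
      simp only [Finset.sum_mul, Finset.mul_sum, ← Finset.sum_add_distrib]
      exact Finset.sum_congr rfl fun p _ => by
        simp only [Derivation.leibniz, smul_eq_mul]; ring
    rw [hbr, hbr, hbr, h1, h2]; ring

end Algebra

/-! ### The commutator of right-invariant vector fields -/

section Lie
variable {E : Type*} [NormedAddCommGroup E] [NormedSpace ℝ E] [FiniteDimensional ℝ E]
  {G : Type*} [TopologicalSpace G] [T2Space G] [ChartedSpace E G] [Group G] [LieGroup 𝓘(ℝ, E) ∞ G]
  {V : Type*} [NormedAddCommGroup V] [NormedSpace ℝ V]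

theorem hasMFDerivAt_dR {f : G → V} (hf : ContMDiff 𝓘(ℝ, E) 𝓘(ℝ, V) ∞ f) (g : G) :
    HasMFDerivAt 𝓘(ℝ, E) 𝓘(ℝ, V) (fun y : G => f (y * g)) 1 (dR E f g : E →L[ℝ] V) :=
  ((hf.comp (contMDiff_mul_const (E := E) g)).mdifferentiable (by simp) 1).hasMFDerivAt

theorem contMDiff_dR_apply {f : G → V} (hf : ContMDiff 𝓘(ℝ, E) 𝓘(ℝ, V) ∞ f) (η : E) :
    ContMDiff 𝓘(ℝ, E) 𝓘(ℝ, V) ∞ (fun g => dR E f g η) :=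
  (contMDiff_dR hf).clm_apply contMDiff_const

/-- Left and right translations commute: this is Schwarz's theorem for f(x g y) at x = y = 1.
Written in right-invariant directions, the left-invariant derivative acquires the varying vector
Ad(xg)w, whose derivative is the bracket term. -/
theorem dR_dR_sub {f : G → V} (hf : ContMDiff 𝓘(ℝ, E) 𝓘(ℝ, V) ∞ f) (g : G) (ξ η : LieAlg E G) :
    dR E (fun g => dR E f g η) g ξ - dR E (fun g => dR E f g ξ) g η = -dR E f g (⁅ξ, η⁆ : LieAlg E G) := by
  -- Chosen so that the left-invariant direction w agrees at g with the right-invariant direction η.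
  set w : LieAlg E G := Ad g⁻¹ η with hw
  have hgw : AdE E g w = η := Ad_Ad_inv g η
  have hmd : MDifferentiable 𝓘(ℝ, E) 𝓘(ℝ, V) f := hf.mdifferentiable (by simp)
  have hsymm := mfderiv_mfderiv_symm (1 : G) (1 : G) (fun x y => f (x * g * y))
    (hf.comp ((contMDiff_fst.mul contMDiff_const).mul contMDiff_snd)) ξ w
  have hy : ∀ x : G, mderiv E (fun y : G => f (x * g * y)) 1 w =
      dR E f (x * g) (AdE E (x * g) w) := by
    intro x
    have h := (hasRD_mul_left (E := E) (x * g)).comp_fun (f := f) (hmd _)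
    have h1 : ∀ v, v = x * g → mderiv E (fun y : G => f (x * g * y)) 1 w =
        dR E f v (AdE E (x * g) w) → mderiv E (fun y : G => f (x * g * y)) 1 w =
        dR E f (x * g) (AdE E (x * g) w) := by rintro v rfl h; exact h
    exact h1 _ (mul_one _) (congrArg (fun L : E →L[ℝ] V => L w) h.mfderiv)
  have hx : ∀ y : G, mderiv E (fun x : G => f (x * g * y)) 1 ξ = dR E f (g * y) ξ := by
    intro y
    have h : (fun x : G => f (x * g * y)) = fun x : G => f (x * (g * y)) := by
      ext x; rw [mul_assoc]
    rw [h]; rfl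
  have hA := hasMFDerivAt_dR (contMDiff_dR hf) g
  have hv := ((hasRD_id (E := E) (G := G)).mul_const g).Ad_apply w
  have h1 := hasMFDerivAt_clm_apply hA hv
  have h2 := congrArg (fun L : E →L[ℝ] V => L ξ) h1.mfderiv
  have h3 : mderiv E (fun x : G => mderiv E (fun y : G => f (x * g * y)) 1 w) 1 ξ =
      dR E f g (⁅ξ, η⁆ : LieAlg E G) + dR E (fun g => dR E f g) g ξ η := by
    have h4 : (fun x : G => mderiv E (fun y : G => f (x * g * y)) 1 w) =
      fun x => dR E f (x * g) (AdE E (x * g) w) := funext hy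
    rw [h4]
    have h5 : ∀ v : G, v = g → dR E f v (lieRight (Ad v w) ξ) +
        dR E (fun g => dR E f g) g ξ (AdE E v w) =
        dR E f g (⁅ξ, η⁆ : LieAlg E G) + dR E (fun g => dR E f g) g ξ η := by
      rintro v rfl
      have h6 : lieRight (Ad v w) ξ = (⁅ξ, η⁆ : LieAlg E G) := congrArg (fun η => ⁅ξ, η⁆) hgw
      rw [hgw]
      exact congrArg (fun ζ => dR E f v ζ + dR E (fun g => dR E f g) v ξ η) h6
    exact Eq.trans h2 (h5 (1 * g) (one_mul g))
  have h4 : mderiv E (fun y : G => mderiv E (fun x : G => f (x * g * y)) 1 ξ) 1 w =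
      dR E (fun g => dR E f g ξ) g η := by
    have h5 : (fun y : G => mderiv E (fun x : G => f (x * g * y)) 1 ξ) =
      fun y => dR E f (g * y) ξ := funext hx
    rw [h5]
    have h6 := (hasRD_mul_left (E := E) g).comp_fun (f := fun g => dR E f g ξ)
      ((contMDiff_dR_apply hf ξ).mdifferentiable (by simp) _)
    have h7 : ∀ v : G, v = g → dR E (fun g => dR E f g ξ) v (AdE E g w) =
        dR E (fun g => dR E f g ξ) g η := by
      rintro v rfl; rw [hgw]
    exact (congrArg (fun L : E →L[ℝ] V => L w) h6.mfderiv).trans (h7 _ (mul_one g))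
  have h5 : dR E (fun g => dR E f g η) g ξ = dR E (fun g => dR E f g) g ξ η := by
    have h6 := hasMFDerivAt_clm_apply (W := E) (w := fun _ : G => (η : E)) (w' := 0) hA
      (hasMFDerivAt_const _ _)
    have h7 := congrArg (fun L : E →L[ℝ] V => L ξ) h6.mfderiv
    refine Eq.trans h7 ?_
    exact (congrArg (fun z => z + _) (map_zero (dR E f (1 * g)))).trans (zero_add _)
  have h6 := h3.symm.trans (Eq.trans hsymm h4)
  rw [h5, ← h6]
  abel

end Lie

/-! ### Variations of one or of all holonomies -/

section Partial
variable {E : Type*} [NormedAddCommGroup E] [NormedSpace ℝ E]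
  {G : Type*} [TopologicalSpace G] [ChartedSpace E G] [Group G] [LieGroup 𝓘(ℝ, E) ∞ G]
  {V : Type*} [NormedAddCommGroup V] [NormedSpace ℝ V] {n g : ℕ}

theorem contMDiff_move (X : Hol n g) :
    ContMDiff ((piModel (Hol n g) E).prod 𝓘(ℝ, E)) (piModel (Hol n g) E) ∞
      (uncurry fun (u : Hol n g → G) (y : G) => update u X (y * u X)) := by
  refine contMDiff_to_pi fun Y => ?_
  by_cases h : Y = X
  · subst h
    have h1 : ContMDiff ((piModel (Hol n g) E).prod 𝓘(ℝ, E)) 𝓘(ℝ, E) ∞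
        (fun p : (Hol n g → G) × G => p.2 * p.1 Y) :=
      contMDiff_snd.mul ((contMDiff_proj (M := G) Y).comp contMDiff_fst)
    simpa [uncurry] using h1
  · have h1 : ContMDiff ((piModel (Hol n g) E).prod 𝓘(ℝ, E)) 𝓘(ℝ, E) ∞
        (fun p : (Hol n g → G) × G => p.1 Y) := (contMDiff_proj Y).comp contMDiff_fst
    simpa [uncurry, h] using h1

theorem contMDiff_move_left (u : Hol n g → G) (X : Hol n g) :
    ContMDiff 𝓘(ℝ, E) (piModel (Hol n g) E) ∞ (fun y : G => update u X (y * u X)) :=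
  (contMDiff_move X).comp (contMDiff_const.prodMk contMDiff_id : ContMDiff 𝓘(ℝ, E)
    ((piModel (Hol n g) E).prod 𝓘(ℝ, E)) ∞ (fun y : G => (u, y)))

variable (E) in
/-- The derivative of `s` when `u_X` moves to `e^{tξ} u_X`. -/
def pd (X : Hol n g) (s : (Hol n g → G) → V) (u : Hol n g → G) : E →L[ℝ] V :=
  mderiv E (fun y : G => s (update u X (y * u X))) 1

theorem contMDiff_pd (X : Hol n g) {s : (Hol n g → G) → V}
    (hs : ContMDiff (piModel (Hol n g) E) 𝓘(ℝ, V) ∞ s) :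
    ContMDiff (piModel (Hol n g) E) 𝓘(ℝ, E →L[ℝ] V) ∞ (pd E X s) :=
  contMDiff_mfderiv_clm (1 : G) (fun u y => s (update u X (y * u X))) (hs.comp (contMDiff_move X))

theorem hasMFDerivAt_pd (X : Hol n g) {s : (Hol n g → G) → V}
    (hs : ContMDiff (piModel (Hol n g) E) 𝓘(ℝ, V) ∞ s) (u : Hol n g → G) :
    HasMFDerivAt 𝓘(ℝ, E) 𝓘(ℝ, V) (fun y : G => s (update u X (y * u X))) 1
      (pd E X s u : E →L[ℝ] V) :=
  ((hs.comp (contMDiff_move_left u X)).mdifferentiable (by simp) 1).hasMFDerivAt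

theorem pd_eq_of_hasMFDerivAt {X : Hol n g} {s : (Hol n g → G) → V} {u : Hol n g → G}
    {L : E →L[ℝ] V} (h : HasMFDerivAt 𝓘(ℝ, E) 𝓘(ℝ, V) (fun y : G => s (update u X (y * u X))) 1 L) :
    pd E X s u = L := h.mfderiv

theorem JL_apply (X : Hol n g) (ξ : LieAlg E G) (F : Fn E G n g) (u : Hol n g → G) :
    JL X ξ F u = -pd E X F u ξ := by
  have h0 : ∀ p : G, p = 1 → HasMFDerivAt 𝓘(ℝ, E) 𝓘(ℝ, ℝ)
      (fun y : G => F (update u X (y * u X))) p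
      (pd E X F u : E →L[ℝ] ℝ) := by
    rintro p rfl; exact hasMFDerivAt_pd X F.contMDiff u
  have h := (h0 (1 : G)⁻¹ inv_one).comp (1 : G) (hasMFDerivAt_inv_one (E := E))
  refine (congrArg (fun L : E →L[ℝ] ℝ => L ξ) h.mfderiv).trans ?_
  exact map_neg (pd E X F u) (ξ : E)

/-- Right multiplication is left multiplication by a conjugate: u_X e^{tξ} = e^{tAd(u_X)ξ}u_X. -/
theorem JR_apply (X : Hol n g) (ξ : LieAlg E G) (F : Fn E G n g) (u : Hol n g → G) :
    JR X ξ F u = pd E X F u (AdE E (u X) ξ) := by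
  have h0 : ∀ p : G, p = 1 → HasMFDerivAt 𝓘(ℝ, E) 𝓘(ℝ, ℝ)
      (fun y : G => F (update u X (y * u X))) p
      (pd E X F u : E →L[ℝ] ℝ) := by
    rintro p rfl; exact hasMFDerivAt_pd X F.contMDiff u
  have h := (h0 (u X * 1 * (u X)⁻¹) (by simp)).comp (1 : G) (hasMFDerivAt_Ad (E := E) (u X) rfl)
  have h1 : (fun y : G => F (update u X (y * u X))) ∘ (fun y : G => u X * y * (u X)⁻¹) =
      fun y : G => F (update u X (u X * y)) := by
    ext y; simp
  rw [h1] at h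
  exact congrArg (fun L : E →L[ℝ] ℝ => L ξ) h.mfderiv

theorem pd_update (X : Hol n g) (s : (Hol n g → G) → V) (u : Hol n g → G) (v : G) :
    pd E X s (update u X v) = dR E (fun g => s (update u X g)) v := by
  simp [pd, dR]

theorem pd_comm_of_ne {X Y : Hol n g} (hXY : X ≠ Y) {s : (Hol n g → G) → V}
    (hs : ContMDiff (piModel (Hol n g) E) 𝓘(ℝ, V) ∞ s) (u : Hol n g → G) (ξ η : E) :
    pd E X (fun u => pd E Y s u η) u ξ = pd E Y (fun u => pd E X s u ξ) u η := by
  have h1 : ContMDiff (𝓘(ℝ, E).prod 𝓘(ℝ, E)) 𝓘(ℝ, V) ∞ (uncurry fun x y : G =>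
      s (update (update u X (x * u X)) Y (y * u Y))) := by
    have h2 : (uncurry fun x y : G => s (update (update u X (x * u X)) Y (y * u Y))) =
        s ∘ (uncurry fun (u : Hol n g → G) (y : G) => update u Y (y * u Y)) ∘
          (fun p : G × G => (update u X (p.1 * u X), p.2)) := by
      ext ⟨x, y⟩; simp [hXY.symm]
    rw [h2]
    exact hs.comp ((contMDiff_move Y).comp
      (((contMDiff_move_left u X).comp contMDiff_fst).prodMk contMDiff_snd))
  have h3 := mfderiv_mfderiv_symm (1 : G) (1 : G) (fun x y : G =>
      s (update (update u X (x * u X)) Y (y * u Y))) h1 ξ η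
  refine Eq.trans ?_ (h3.trans ?_)
  · refine congrArg (fun f : G → V => mderiv E f 1 ξ) (funext fun x => ?_)
    refine congrArg (fun f : G → V => mderiv E f 1 η) (funext fun y => ?_)
    simp [hXY.symm]
  · refine congrArg (fun f : G → V => mderiv E f 1 η) (funext fun x => ?_)
    refine congrArg (fun f : G → V => mderiv E f 1 ξ) (funext fun y => ?_)
    rw [update_comm hXY]
    simp [hXY]

theorem contMDiff_update (u : Hol n g → G) (X : Hol n g) :
    ContMDiff 𝓘(ℝ, E) (piModel (Hol n g) E) ∞ (fun v : G => update u X v) := by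
  have h := (contMDiff_move_left (E := E) (update u X 1) X)
  simpa using h

/-- The other holonomies are frozen, which leaves a function on one copy of G and the commutator
`dR_dR_sub`. -/
theorem pd_comm_self [FiniteDimensional ℝ E] [T2Space G] (X : Hol n g) {s : (Hol n g → G) → V}
    (hs : ContMDiff (piModel (Hol n g) E) 𝓘(ℝ, V) ∞ s) (u : Hol n g → G) (ξ η : LieAlg E G) :
    pd E X (fun u => pd E X s u η) u ξ - pd E X (fun u => pd E X s u ξ) u η =
      -pd E X s u (⁅ξ, η⁆ : LieAlg E G) := by
  have h := dR_dR_sub (f := fun v => s (update u X v)) (hs.comp (contMDiff_update (E := E) u X))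
    (u X) ξ η
  have h1 : ∀ (s : (Hol n g → G) → V), pd E X s u = dR E (fun v => s (update u X v)) (u X) :=
    fun s => by rw [← pd_update, update_eq_self]
  simp only [h1]
  simp only [pd_update]
  exact h

variable (E) in
/-- The derivative of `s` when every `u_Y` moves to `e^{tβ_Y} u_Y`. -/
def vD (β : Hol n g → LieAlg E G) (s : (Hol n g → G) → V) (u : Hol n g → G) : V := ∑ Y, pd E Y s u (β Y)

/-- `c` moves to `e^{tv} c` when every `u_Y` moves to `e^{tβ_Y} u_Y`. -/
def HasVar (c : (Hol n g → G) → G) (u : Hol n g → G) (β : Hol n g → LieAlg E G) (v : LieAlg E G) : Prop :=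
  ∃ Λ : Hol n g → LieAlg E G →L[ℝ] LieAlg E G,
    (∀ Y, HasRD 𝓘(ℝ, E) (fun y : G => c (update u Y (y * u Y))) 1 (Λ Y : E →L[ℝ] LieAlg E G)) ∧
      ∑ Y, Λ Y (β Y) = v

theorem hasVar_const (c : G) (u : Hol n g → G) (β : Hol n g → LieAlg E G) :
    HasVar (fun _ => c) u β 0 :=
  ⟨fun _ => 0, fun _ => hasRD_const c _, Finset.sum_eq_zero fun _ _ => rfl⟩

theorem hasVar_proj (X : Hol n g) (u : Hol n g → G) (β : Hol n g → LieAlg E G) :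
    HasVar (fun u => u X) u β (β X) := by
  refine ⟨fun Y => if Y = X then ContinuousLinearMap.id ℝ _ else 0, fun Y => ?_, ?_⟩
  · by_cases h : Y = X
    · subst h
      have h1 := (hasRD_id (E := E) (G := G)).mul (hasRD_const (E := E) (I := 𝓘(ℝ, E)) (u Y) 1)
      have h2 : ContinuousLinearMap.id ℝ (LieAlg E G) +
        (Ad (1 : G)).comp (0 : LieAlg E G →L[ℝ] LieAlg E G) = ContinuousLinearMap.id ℝ _ := by
        ext; simp
      simp only [if_true, update_self]
      rw [← h2]; exact h1
    · have h1 : (fun y : G => update u Y (y * u Y) X) = fun _ => u X := by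
        ext y; rw [update_of_ne (Ne.symm h)]
      simp only [if_neg h, h1]
      exact hasRD_const (u X) _
  · rw [Finset.sum_eq_single X]
    · simp only [if_true]; rfl
    · intro Y _ h; simp only [if_neg h]; rfl
    · simp

theorem HasVar.mul {c d : (Hol n g → G) → G} {u : Hol n g → G} {β : Hol n g → LieAlg E G}
    {v w : LieAlg E G} (hc : HasVar c u β v) (hd : HasVar d u β w) :
    HasVar (fun u => c u * d u) u β (v + Ad (c u) w) := by
  obtain ⟨Λ, h1, rfl⟩ := hc
  obtain ⟨Λ', h2, rfl⟩ := hd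
  refine ⟨fun Y => Λ Y + (Ad (c u)).comp (Λ' Y), fun Y => ?_, ?_⟩
  · have h := (h1 Y).mul (h2 Y)
    rw [one_mul, update_eq_self] at h
    exact h
  · rw [map_sum, ← Finset.sum_add_distrib]
    rfl

theorem HasVar.inv {c : (Hol n g → G) → G} {u : Hol n g → G} {β : Hol n g → LieAlg E G}
    {v : LieAlg E G} (hc : HasVar c u β v) :
    HasVar (fun u => (c u)⁻¹) u β (-Ad (c u)⁻¹ v) := by
  obtain ⟨Λ, h1, rfl⟩ := hc
  refine ⟨fun Y => -(Ad (c u)⁻¹).comp (Λ Y), fun Y => ?_, ?_⟩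
  · have h := (h1 Y).inv
    rw [one_mul, update_eq_self] at h
    exact h
  · rw [map_sum, ← Finset.sum_neg_distrib]
    rfl

theorem HasVar.vD_comp {c : (Hol n g → G) → G} {u : Hol n g → G} {β : Hol n g → LieAlg E G}
    {v : LieAlg E G} (hc : HasVar c u β v) {f : G → V} (hf : ContMDiff 𝓘(ℝ, E) 𝓘(ℝ, V) ∞ f) :
    vD E β (fun u => f (c u)) u = dR E f (c u) v := by
  obtain ⟨Λ, h1, rfl⟩ := hc
  have h2 : ∀ Y, pd E Y (fun u => f (c u)) u (β Y) = dR E f (c u) (Λ Y (β Y)) := by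
    intro Y
    have h := (h1 Y).comp_fun (hf.mdifferentiable (by simp) _)
    simp only [one_mul, update_eq_self] at h
    exact congrArg (fun L : E →L[ℝ] V => L (β Y)) h.mfderiv
  rw [vD, Finset.sum_congr rfl fun Y _ => h2 Y]
  exact (map_sum (dR E f (c u)) (fun Y => (Λ Y (β Y) : E)) Finset.univ).symm

theorem HasVar.vD_Ad [FiniteDimensional ℝ E] [T2Space G] {c : (Hol n g → G) → G}
    {u : Hol n g → G} {β : Hol n g → LieAlg E G}
    {v : LieAlg E G} (hc : HasVar c u β v) (η : LieAlg E G) :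
    vD E β (fun u => AdE E (c u) η) u = (⁅v, Ad (c u) η⁆ : LieAlg E G) := by
  obtain ⟨Λ, h1, rfl⟩ := hc
  have h2 : ∀ Y, pd E Y (fun u => AdE E (c u) η) u (β Y) =
      lieRight (Ad (c u) η) (Λ Y (β Y)) := by
    intro Y
    have h := (h1 Y).Ad_apply η
    simp only [one_mul, update_eq_self] at h
    exact congrArg (fun L : E →L[ℝ] E => L (β Y)) h.mfderiv
  rw [vD, Finset.sum_congr rfl fun Y _ => h2 Y]
  exact (map_sum (lieRight (Ad (c u) η)) (fun Y => (Λ Y (β Y))) Finset.univ).symm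

end Partial

/-! ### The decoupling matrix and the motion of the total holonomy -/

section GenVar
variable {E : Type*} [NormedAddCommGroup E] [NormedSpace ℝ E] [FiniteDimensional ℝ E]
  {G : Type*} [TopologicalSpace G] [T2Space G] [ChartedSpace E G] [Group G] [LieGroup 𝓘(ℝ, E) ∞ G]
  {n g : ℕ}

variable (E) in
/-- `1 - Ad(u)`. -/
def subAd (u : G) : LieAlg E G →L[ℝ] LieAlg E G := ContinuousLinearMap.id ℝ _ - Ad u

@[simp] theorem subAd_apply (u : G) (ξ : LieAlg E G) : subAd E u ξ = ξ - Ad u ξ := rfl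

variable (E) in
/-- `1 - Ad(u_Y)` for `Y = M_i` and the identity for `Y = A_i, B_i`. -/
def anchor (u : Hol n g → G) : Hol n g → LieAlg E G →L[ℝ] LieAlg E G
  | Sum.inl i => subAd E (u (Sum.inl i))
  | Sum.inr _ => ContinuousLinearMap.id ℝ _

variable (E) in
/-- The identity for `Y = M_i` and `1 - Ad(u_Y)` for `Y = A_i, B_i`. -/
def coanchor (u : Hol n g → G) : Hol n g → LieAlg E G →L[ℝ] LieAlg E G
  | Sum.inl _ => ContinuousLinearMap.id ℝ _
  | Sum.inr y => subAd E (u (Sum.inr y))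

theorem anchor_coanchor (u : Hol n g → G) (Y : Hol n g) (ξ : LieAlg E G) :
    anchor E u Y (coanchor E u Y ξ) = subAd E (u Y) ξ := by
  rcases Y with i | i <;> rfl

open Classical in
variable (E) in
/-- The linear change of generators that decouples the holonomies: `j^X(ξ) ↦ ∑_Y k^Y(S_{XY} ξ)`. -/
def decouple (u : Hol n g → G) (X Y : Hol n g) : LieAlg E G →L[ℝ] LieAlg E G :=
  if Prec X Y then (coanchor E u Y).comp (subAd E (u X))
  else if X = Y then Sum.elim (fun _ => ContinuousLinearMap.id ℝ _) (fun _ => subAd E (u X)) X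
  else if ∃ i, X = Hol.A i ∧ Y = Hol.B i then subAd E (u X) - Ad (u Y)
  else if ∃ i, X = Hol.B i ∧ Y = Hol.A i then ContinuousLinearMap.id ℝ _
  else 0

theorem Prec.irrefl (X : Hol n g) : ¬Prec X X := by
  rcases X with i | i | i <;> simp [Prec]

theorem Prec.trans {X Y Z : Hol n g} (h : Prec X Y) (h' : Prec Y Z) : Prec X Z := by
  rcases X with i | i | i <;> rcases Y with j | j | j <;> rcases Z with k | k | k <;>
    simp_all [Prec] <;> exact lt_trans h h'

theorem Prec.ne {X Y : Hol n g} (h : Prec X Y) : X ≠ Y := by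
  rintro rfl; exact Prec.irrefl X h

theorem Prec.asymm {X Y : Hol n g} (h : Prec X Y) : ¬Prec Y X := fun h' =>
  Prec.irrefl X (h.trans h')

theorem not_prec_A_B (i : Fin g) : ¬Prec (Hol.A i : Hol n g) (Hol.B i) := by simp [Prec]

theorem not_prec_B_A (i : Fin g) : ¬Prec (Hol.B i : Hol n g) (Hol.A i) := by simp [Prec]

theorem prec_trichotomy (X Y : Hol n g) : Prec X Y ∨ Prec Y X ∨ X = Y ∨
    (∃ i, X = Hol.A i ∧ Y = Hol.B i) ∨ ∃ i, X = Hol.B i ∧ Y = Hol.A i := by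
  rcases X with i | i | i <;> rcases Y with j | j | j <;> simp [Prec] <;>
    rcases lt_trichotomy i j with h | h | h <;> simp_all

theorem decouple_of_prec (u : Hol n g → G) {X Y : Hol n g} (h : Prec X Y) :
    decouple E u X Y = (coanchor E u Y).comp (subAd E (u X)) := if_pos h

theorem decouple_of_prec_symm (u : Hol n g → G) {X Y : Hol n g} (h : Prec Y X) :
    decouple E u X Y = 0 := by
  rw [decouple, if_neg h.asymm, if_neg h.ne.symm, if_neg, if_neg]
  · rintro ⟨i, rfl, rfl⟩; exact not_prec_A_B i h
  · rintro ⟨i, rfl, rfl⟩; exact not_prec_B_A i h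

theorem decouple_M_M (u : Hol n g → G) (i : Fin n) :
    decouple E u (Hol.M i) (Hol.M i) = ContinuousLinearMap.id ℝ _ := by
  rw [decouple, if_neg (Prec.irrefl _), if_pos rfl]; rfl

theorem decouple_A_A (u : Hol n g → G) (i : Fin g) :
    decouple E u (Hol.A i) (Hol.A i) = subAd E (u (Hol.A i)) := by
  rw [decouple, if_neg (Prec.irrefl _), if_pos rfl]; rfl

theorem decouple_B_B (u : Hol n g → G) (i : Fin g) :
    decouple E u (Hol.B i) (Hol.B i) = subAd E (u (Hol.B i)) := by
  rw [decouple, if_neg (Prec.irrefl _), if_pos rfl]; rfl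

theorem decouple_A_B (u : Hol n g → G) (i : Fin g) :
    decouple E u (Hol.A i) (Hol.B i) = subAd E (u (Hol.A i)) - Ad (u (Hol.B i)) := by
  rw [decouple, if_neg (not_prec_A_B i), if_neg (by simp), if_pos ⟨i, rfl, rfl⟩]

theorem decouple_B_A (u : Hol n g → G) (i : Fin g) :
    decouple E u (Hol.B i) (Hol.A i) = ContinuousLinearMap.id ℝ _ := by
  rw [decouple, if_neg (not_prec_B_A i), if_neg (by simp), if_neg (by simp), if_pos ⟨i, rfl, rfl⟩]

/-- The vector field `{j^X(ξ), ·}`: `u_Y` moves in the direction `genVar u X ξ Y`. -/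
def genVar (u : Hol n g → G) (X : Hol n g) (ξ : LieAlg E G) (Y : Hol n g) : LieAlg E G :=
  anchor E u Y (decouple E u X Y ξ)

theorem genVar_of_prec (u : Hol n g → G) {X Y : Hol n g} (h : Prec X Y) (ξ : LieAlg E G) :
    genVar u X ξ Y = subAd E (u Y) (subAd E (u X) ξ) := by
  rw [genVar, decouple_of_prec u h, ContinuousLinearMap.comp_apply, anchor_coanchor]

theorem genVar_of_prec_symm (u : Hol n g → G) {X Y : Hol n g} (h : Prec Y X) (ξ : LieAlg E G) :
    genVar u X ξ Y = 0 := by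
  rw [genVar, decouple_of_prec_symm u h]; simp

theorem genVar_self (u : Hol n g → G) (X : Hol n g) (ξ : LieAlg E G) :
    genVar u X ξ X = subAd E (u X) ξ := by
  rcases X with i | i | i
  · rw [genVar, decouple_M_M]; rfl
  · rw [genVar, decouple_A_A]; rfl
  · rw [genVar, decouple_B_B]; rfl

theorem genVar_A_B (u : Hol n g → G) (i : Fin g) (ξ : LieAlg E G) :
    genVar u (Hol.A i) ξ (Hol.B i) = subAd E (u (Hol.A i)) ξ - Ad (u (Hol.B i)) ξ := by
  rw [genVar, decouple_A_B]; rfl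

theorem genVar_B_A (u : Hol n g → G) (i : Fin g) (ξ : LieAlg E G) :
    genVar u (Hol.B i) ξ (Hol.A i) = ξ := by
  rw [genVar, decouple_B_A]; rfl

/-! The total holonomy. -/

/-- Moving by (1-Ad(c))ζ means conjugation by e^{tζ}, which is compatible with products. This
describes every holonomy above X, and everything built from them, under the vector field of j^X. -/
theorem hasVar_mul_of_late {c d : (Hol n g → G) → G} {u : Hol n g → G}
    {β : Hol n g → LieAlg E G} {ζ : LieAlg E G} (hc : HasVar c u β (subAd E (c u) ζ))
    (hd : HasVar d u β (subAd E (d u) ζ)) :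
    HasVar (fun u => c u * d u) u β (subAd E (c u * d u) ζ) := by
  have h := hc.mul hd
  have h1 : subAd E (c u) ζ + Ad (c u) (subAd E (d u) ζ) = subAd E (c u * d u) ζ := by
    simp [Ad_mul]
  rwa [h1] at h

theorem hasVar_inv_of_late {c : (Hol n g → G) → G} {u : Hol n g → G}
    {β : Hol n g → LieAlg E G} {ζ : LieAlg E G} (hc : HasVar c u β (subAd E (c u) ζ)) :
    HasVar (fun u => (c u)⁻¹) u β (subAd E (c u)⁻¹ ζ) := by
  have h := hc.inv
  have h1 : -Ad (c u)⁻¹ (subAd E (c u) ζ) = subAd E (c u)⁻¹ ζ := by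
    have h2 := congrArg (fun L : LieAlg E G →L[ℝ] LieAlg E G => L ζ) (Ad_mul (E := E) (c u)⁻¹ (c u))
    simp only [inv_mul_cancel, Ad_one, ContinuousLinearMap.comp_apply,
      ContinuousLinearMap.id_apply] at h2
    simp [← h2]
  rwa [h1] at h

theorem hasVar_list_late {α : Type*} (l : List α) (w : α → (Hol n g → G) → G) {u : Hol n g → G}
    {β : Hol n g → LieAlg E G} {ζ : LieAlg E G}
    (h : ∀ a ∈ l, HasVar (w a) u β (subAd E (w a u) ζ)) :
    HasVar (fun u => (l.map fun a => w a u).prod) u β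
      (subAd E (l.map fun a => w a u).prod ζ) := by
  induction l with
  | nil =>
    have h1 : subAd E (([] : List α).map fun a => w a u).prod ζ = 0 := by simp [Ad_one]
    rw [h1]
    exact hasVar_const 1 u β
  | cons a l ih =>
    simp only [List.map_cons, List.prod_cons]
    exact hasVar_mul_of_late (h a (by simp)) (ih fun b hb => h b (by simp [hb]))

theorem hasVar_list_zero {α : Type*} (l : List α) (w : α → (Hol n g → G) → G) {u : Hol n g → G}
    {β : Hol n g → LieAlg E G} (h : ∀ a ∈ l, HasVar (w a) u β 0) :
    HasVar (fun u => (l.map fun a => w a u).prod) u β 0 := by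
  have h1 := hasVar_list_late l w (ζ := 0) (β := β) (u := u) (fun a ha => by
    rw [map_zero]; exact h a ha)
  rwa [map_zero] at h1

/-- In a product s·w_i·t the block s is conjugated by e^{tζ}, w_i moves by ζ, and t rests. The total
velocity is (1-Ad(s))ζ + Ad(s)ζ = ζ. -/
theorem hasVar_list {α : Type*} {r : α → α → Prop} (l : List α) (hl : l.Pairwise r) (i : α)
    (hi : i ∈ l) (w : α → (Hol n g → G) → G) {u : Hol n g → G}
    {β : Hol n g → LieAlg E G} {ζ : LieAlg E G}
    (h1 : ∀ a, r a i → HasVar (w a) u β (subAd E (w a u) ζ)) (h2 : HasVar (w i) u β ζ)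
    (h3 : ∀ a, r i a → HasVar (w a) u β 0) :
    HasVar (fun u => (l.map fun a => w a u).prod) u β ζ := by
  obtain ⟨s, t, rfl⟩ := List.append_of_mem hi
  rw [List.pairwise_append, List.pairwise_cons] at hl
  have h := (hasVar_list_late s w (β := β) (u := u) (ζ := ζ)
    (fun a ha => h1 a (hl.2.2 a ha i (by simp)))).mul (h2.mul
      (hasVar_list_zero t w (β := β) (u := u) (fun a ha => h3 a (hl.2.1.1 a ha))))
  have h4 : subAd E (s.map fun a => w a u).prod ζ + Ad (s.map fun a => w a u).prod
      (ζ + Ad (w i u) 0) = ζ := by simp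
  rw [h4] at h
  simpa using h

theorem hasVar_uK_of_late {u : Hol n g → G} {β : Hol n g → LieAlg E G} {ζ : LieAlg E G}
    (i : Fin g) (hA : β (Hol.A i) = subAd E (u (Hol.A i)) ζ)
    (hB : β (Hol.B i) = subAd E (u (Hol.B i)) ζ) :
    HasVar (fun u => uK u i) u β (subAd E (uK u i) ζ) := by
  have h1 := hA ▸ hasVar_proj (Hol.A i) u β
  have h2 := hB ▸ hasVar_proj (Hol.B i) u β
  exact hasVar_mul_of_late (hasVar_mul_of_late (hasVar_mul_of_late h2 (hasVar_inv_of_late h1))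
    (hasVar_inv_of_late h2)) h1

theorem hasVar_uK (u : Hol n g → G) (β : Hol n g → LieAlg E G) (i : Fin g) :
    HasVar (fun u => uK u i) u β (β (Hol.B i) - Ad (u (Hol.B i) * (u (Hol.A i))⁻¹) (β (Hol.A i))
      - Ad (u (Hol.B i) * (u (Hol.A i))⁻¹ * (u (Hol.B i))⁻¹) (β (Hol.B i) - β (Hol.A i))) := by
  have h1 := hasVar_proj (Hol.A i) u β
  have h2 := hasVar_proj (Hol.B i) u β
  have h := ((h2.mul h1.inv).mul h2.inv).mul h1
  convert! h using 1
  simp [Ad_mul]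
  abel

theorem pairwise_gt_reverse_finRange (k : ℕ) :
    (List.finRange k).reverse.Pairwise (fun a b => b < a) := by
  rw [List.pairwise_reverse]
  exact List.pairwise_lt_finRange k

/-- In u_tot the larger labels stand on the left. The holonomies above X are conjugated by ζ =
(1-Ad(u_X))ξ, those below X are fixed, and the factor containing X moves by ζ itself, so the whole
product moves by ζ. -/
theorem hasVar_uTot (u : Hol n g → G) (X : Hol n g) (ξ : LieAlg E G) :
    HasVar uTot u (genVar u X ξ) (subAd E (u X) ξ) := by
  set ζ := subAd E (u X) ξ with hζ
  have hlate : ∀ Y, Prec X Y → genVar u X ξ Y = subAd E (u Y) ζ := fun Y h => genVar_of_prec u h ξ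
  have hzero : ∀ Y, Prec Y X → genVar u X ξ Y = 0 := fun Y h => genVar_of_prec_symm u h ξ
  -- The labels A_i and B_i have the same predecessors and successors, so for a handle only the
  -- motion of u_{K_i} remains to be computed.
  have key : ∀ i : Fin g, (X = Hol.A i ∨ X = Hol.B i) → HasVar (fun u => uK u i) u (genVar u X ξ) ζ →
      HasVar uTot u (genVar u X ξ) ζ := by
    intro i hX hK
    have h1 := hasVar_list (β := genVar u X ξ) (u := u) (ζ := ζ) _ (pairwise_gt_reverse_finRange g) i
      (by simp) (fun i u => uK u i)
      (fun j hj => hasVar_uK_of_late j (hlate _ (by rcases hX with rfl | rfl <;> simpa [Prec]))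
        (hlate _ (by rcases hX with rfl | rfl <;> simpa [Prec]))) hK (fun j hj => by
          have h := hasVar_uK u (genVar u X ξ) j
          rw [hzero _ (by rcases hX with rfl | rfl <;> simpa [Prec]),
            hzero _ (by rcases hX with rfl | rfl <;> simpa [Prec])] at h
          simpa using h)
    have h2 := hasVar_list_zero (β := genVar u X ξ) (u := u) (List.finRange n).reverse
      (fun i u => u (Hol.M i)) (fun j _ => by
        rw [← hzero (Hol.M j) (by rcases hX with rfl | rfl <;> simp [Prec])]
        exact hasVar_proj _ _ _)
    have h3 := h1.mul h2
    rw [map_zero, add_zero] at h3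
    exact h3
  rcases X with i | i | i
  · have h1 := hasVar_list_late (β := genVar u (Sum.inl i) ξ) (u := u) (ζ := ζ)
      (List.finRange g).reverse (fun i u => uK u i) (fun j _ =>
        hasVar_uK_of_late j (hlate _ (by simp [Prec])) (hlate _ (by simp [Prec])))
    have h2 := hasVar_list (β := genVar u (Sum.inl i) ξ) (u := u) (ζ := ζ) _
      (pairwise_gt_reverse_finRange n) i (by simp) (fun i u => u (Hol.M i))
      (fun j hj => by
        show HasVar _ _ _ (subAd E (u (Hol.M j)) ζ)
        rw [← hlate (Hol.M j) (by simpa [Prec] using hj)]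
        exact hasVar_proj _ _ _)
      (by
        have h3 := hasVar_proj (Hol.M i) u (genVar u (Sum.inl i) ξ)
        rwa [genVar_self] at h3)
      (fun j hj => by
        rw [← hzero (Hol.M j) (by simpa [Prec] using hj)]
        exact hasVar_proj _ _ _)
    have h3 := h1.mul h2
    rw [subAd_apply, sub_add_cancel] at h3
    exact h3
  · refine key i (Or.inl rfl) ?_
    -- For X = A_i and for X = B_i alike the velocities satisfy β_B - β_A = -Ad(u_B)ξ. After this
    -- substitution the terms with Ad(u_B u_A⁻¹)ξ cancel and (1-Ad(u_X))ξ is left.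
    have h := hasVar_uK u (genVar u (Sum.inr (Sum.inl i)) ξ) i
    rw [genVar_self, genVar_A_B] at h
    convert! h using 1
    rw [hζ]
    simp [Ad_mul, Ad_inv_Ad]
  · refine key i (Or.inr rfl) ?_
    have h := hasVar_uK u (genVar u (Sum.inr (Sum.inr i)) ξ) i
    rw [genVar_self, genVar_B_A] at h
    convert! h using 1
    rw [hζ]
    simp [Ad_mul, Ad_inv_Ad]
end GenVar

/-! ### Smooth dependence of the decoupling matrix -/

section Smooth
variable {E : Type*} [NormedAddCommGroup E] [NormedSpace ℝ E] [FiniteDimensional ℝ E]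
  {G : Type*} [TopologicalSpace G] [T2Space G] [ChartedSpace E G] [Group G] [LieGroup 𝓘(ℝ, E) ∞ G]
  {n g : ℕ}

variable (E) in
/-- An element of the Lie algebra as an element of the model space. -/
def toE (ξ : LieAlg E G) : E := ξ

/-- Smoothness of Ad is available for fixed vectors only, so s(u) is expanded in a basis with smooth
coefficients. -/
theorem contMDiff_Ad_apply {w : (Hol n g → G) → G} {s : (Hol n g → G) → E}
    (hw : ContMDiff (piModel (Hol n g) E) 𝓘(ℝ, E) ∞ w)
    (hs : ContMDiff (piModel (Hol n g) E) 𝓘(ℝ, E) ∞ s) :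
    ContMDiff (piModel (Hol n g) E) 𝓘(ℝ, E) ∞ (fun u => AdE E (w u) (s u)) := by
  set b := Module.finBasis ℝ E
  have h1 : (fun u => AdE E (w u) (s u)) =
      fun u => ∑ i, (LinearMap.toContinuousLinearMap (b.coord i)) (s u) • AdE E (w u) (b i) := by
    ext1 u
    conv_lhs => rw [← b.sum_repr (s u), map_sum]
    exact Finset.sum_congr rfl fun i _ => map_smul _ _ _
  rw [h1]
  refine contMDiff_finsetSum fun i _ => ?_
  have h2 := contMDiff_deriv_fixed (E := E) (1 : G) (fun u g : G => u * g * u⁻¹) contMDiff_conj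
    (by simp) (b i)
  exact ContMDiff.smul
    ((LinearMap.toContinuousLinearMap (b.coord i)).contMDiff.comp hs) (h2.comp hw)

theorem contMDiff_subAd_apply {w : (Hol n g → G) → G} {s : (Hol n g → G) → E}
    (hw : ContMDiff (piModel (Hol n g) E) 𝓘(ℝ, E) ∞ w)
    (hs : ContMDiff (piModel (Hol n g) E) 𝓘(ℝ, E) ∞ s) :
    ContMDiff (piModel (Hol n g) E) 𝓘(ℝ, E) ∞ (fun u => toE E (subAd E (w u) (s u))) :=
  hs.sub (contMDiff_Ad_apply hw hs)

theorem contMDiff_decouple (X Y : Hol n g) {s : (Hol n g → G) → E}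
    (hs : ContMDiff (piModel (Hol n g) E) 𝓘(ℝ, E) ∞ s) :
    ContMDiff (piModel (Hol n g) E) 𝓘(ℝ, E) ∞ (fun u => toE E (decouple E u X Y (s u))) := by
  rcases prec_trichotomy X Y with h | h | rfl | ⟨i, rfl, rfl⟩ | ⟨i, rfl, rfl⟩
  · simp only [decouple_of_prec _ h]
    rcases Y with i | i
    · exact contMDiff_subAd_apply (contMDiff_proj X) hs
    · exact contMDiff_subAd_apply (contMDiff_proj _) (contMDiff_subAd_apply (contMDiff_proj X) hs)
  · simp only [decouple_of_prec_symm _ h]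
    exact contMDiff_const (M' := E) (c := (0 : E))
  · rcases X with i | i | i
    · simp only [decouple_M_M]; exact hs
    · simp only [decouple_A_A]; exact contMDiff_subAd_apply (contMDiff_proj _) hs
    · simp only [decouple_B_B]; exact contMDiff_subAd_apply (contMDiff_proj _) hs
  · simp only [decouple_A_B]
    exact ContMDiff.sub (G := E) (contMDiff_subAd_apply (contMDiff_proj _) hs)
      (contMDiff_Ad_apply (contMDiff_proj _) hs)
  · simp only [decouple_B_A]; exact hs

end Smooth

/-! ### Elements linear in the generators -/

section Linear
variable {E : Type*} [NormedAddCommGroup E] [NormedSpace ℝ E] [FiniteDimensional ℝ E]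
  {G : Type*} [TopologicalSpace G] [T2Space G] [ChartedSpace E G] [Group G] [LieGroup 𝓘(ℝ, E) ∞ G]
  {n g : ℕ} {κ : Type*} [Fintype κ] [DecidableEq κ] (J : Module.Basis κ ℝ (LieAlg E G))

variable (E G n g) in
/-- Smooth functions on `G^{n+2g}` with values in the Lie algebra. -/
abbrev FnE : Type _ := C^∞⟮piModel (Hol n g) E, Hol n g → G; 𝓘(ℝ, E), E⟯

variable (E) in
/-- The `b`-th coordinate with respect to the basis `J`. -/
def coordCLM (b : κ) : E →L[ℝ] ℝ :=
  LinearMap.toContinuousLinearMap (J.coord b : LieAlg E G →ₗ[ℝ] ℝ)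

theorem coordCLM_apply (b : κ) (ξ : LieAlg E G) : coordCLM E J b ξ = J.repr ξ b := rfl

/-- The `b`-th component of a Lie algebra valued function. -/
def compFn (b : κ) (s : FnE E G n g) : Fn E G n g :=
  ⟨fun u => coordCLM E J b (s u), (coordCLM E J b).contMDiff.comp s.contMDiff⟩

theorem compFn_apply (b : κ) (s : FnE E G n g) (u : Hol n g → G) :
    compFn J b s u = coordCLM E J b (s u) := rfl

variable (n g) in
/-- The constant function with value `ξ`. -/
def constE (ξ : LieAlg E G) : FnE E G n g :=
  ⟨fun _ => ξ, contMDiff_const (M' := E) (c := (ξ : E))⟩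

/-- `u ↦ S_{XY}(u) s(u)` for the change of generators `S`. -/
def decoupleFn (X Y : Hol n g) (s : FnE E G n g) : FnE E G n g :=
  ⟨fun u => decouple E u X Y (s u), contMDiff_decouple X Y s.contMDiff⟩

/-- `∑_Y j^Y(s_Y)`. -/
def lin (s : Hol n g → FnE E G n g) : FlowerAlg E G n g κ :=
  ∑ p : Hol n g × κ, C (compFn J p.2 (s p.1)) * X p

/-- `j^Y(s)`. -/
def jv (Y : Hol n g) (s : FnE E G n g) : FlowerAlg E G n g κ :=
  ∑ b, C (compFn J b s) * gen Y b

theorem smul_eq_C_mul' (r : ℝ) (φ : FlowerAlg E G n g κ) :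
    r • φ = C (algebraMap ℝ (Fn E G n g) r) * φ := by
  rw [← MvPolynomial.smul_eq_C_mul, algebraMap_smul]

theorem jv_const (Y : Hol n g) (ξ : LieAlg E G) :
    jv J Y (constE n g ξ) = ∑ c, J.repr ξ c • gen Y c := by
  refine Finset.sum_congr rfl fun c _ => ?_
  rw [smul_eq_C_mul']
  rfl

theorem sum_repr_smul (ξ : LieAlg E G) : ∑ a, J.repr ξ a • J a = ξ := J.sum_repr ξ

/-- `(1 - Ad(u_X)) J_a = ∑ d, (δ_a^d - Ad*(u_X)_a^d) J_d`. -/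
theorem oneSubAd_apply (X : Hol n g) (a d : κ) (u : Hol n g → G) :
    oneSubAd J X a d u = J.repr (subAd E (u X) (J a)) d := by
  have h : oneSubAd J X a d u = (if a = d then (1 : ℝ) else 0) - J.repr (Ad (u X) (J a)) d := by
    have h1 : (if a = d then (1 : Fn E G n g) else 0) u = if a = d then (1 : ℝ) else 0 := by
      split_ifs <;> rfl
    rw [← h1]; rfl
  rw [h, subAd_apply, map_sub, Finsupp.sub_apply, J.repr_self, Finsupp.single_apply]

theorem upperBracket_of_prec {X Y : Hol n g} (h : Prec X Y) (a b : κ) (s : FnE E G n g)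
    (hs : ∀ u, s u = (⁅subAd E (u X) (J a), J b⁆ : LieAlg E G)) :
    upperBracket J (X, a) (Y, b) = -jv J Y s := by
  rw [upperBracket, if_pos h, Finset.sum_comm, jv]
  congr 1
  refine Finset.sum_congr rfl fun c _ => ?_
  rw [← Finset.sum_mul, ← map_sum]
  congr 2
  ext u
  rw [compFn_apply, hs, coordCLM_apply]
  conv_rhs => rw [← sum_repr_smul J (subAd E (u X) (J a)), sum_lie]
  rw [map_sum, Finset.sum_apply']
  have h1 : ∀ (F : κ → Fn E G n g), (∑ d, F d) u = ∑ d, F d u := fun F =>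
    map_sum (ContMDiffMap.evalRingHom (I := piModel (Hol n g) E) (n := ∞) u) F Finset.univ
  rw [h1]
  refine Finset.sum_congr rfl fun d _ => ?_
  rw [smul_lie, map_smul]
  show strc J d b c * oneSubAd J X a d u = _
  rw [oneSubAd_apply, strc, Finsupp.smul_apply, smul_eq_mul, mul_comm]

end Linear

/-! ### Vector fields and brackets of the generators in basis-free form -/

section Field
variable {E : Type*} [NormedAddCommGroup E] [NormedSpace ℝ E] [FiniteDimensional ℝ E]
  {G : Type*} [TopologicalSpace G] [T2Space G] [ChartedSpace E G] [Group G] [LieGroup 𝓘(ℝ, E) ∞ G]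
  {n g : ℕ} {κ : Type*} [Fintype κ] [DecidableEq κ] (J : Module.Basis κ ℝ (LieAlg E G))

theorem Fn_sum_apply {ι : Type*} (t : Finset ι) (F : ι → Fn E G n g) (u : Hol n g → G) :
    (∑ i ∈ t, F i) u = ∑ i ∈ t, F i u :=
  map_sum (ContMDiffMap.evalRingHom (I := piModel (Hol n g) E) (n := ∞) u) F t

theorem derivation_sum_apply {A ι : Type*} [CommRing A] [Algebra ℝ A] (t : Finset ι)
    (D : ι → Derivation ℝ A A) (F : A) : (∑ i ∈ t, D i) F = ∑ i ∈ t, D i F := by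
  classical
  induction t using Finset.induction_on with
  | empty => simp
  | insert a s ha ih => rw [Finset.sum_insert ha, Finset.sum_insert ha, Derivation.add_apply, ih]

theorem conjField_apply (Y : Hol n g) (b : κ) (F : Fn E G n g) (u : Hol n g → G) :
    conjField J Y b F u = -pd E Y F u (subAd E (u Y) (J b)) := by
  have h : conjField J Y b F u = JR Y (J b) F u + JL Y (J b) F u := rfl
  rw [h, JR_apply, JL_apply]
  have h1 : pd E Y F u (subAd E (u Y) (J b)) = pd E Y F u (J b) - pd E Y F u (AdE E (u Y) (J b)) :=
    map_sub (pd E Y F u) _ _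
  rw [h1]; ring

theorem sum_oneSubAd_smul (X : Hol n g) (a : κ) (u : Hol n g → G) :
    ∑ b, oneSubAd J X a b u • J b = subAd E (u X) (J a) := by
  simp only [oneSubAd_apply]
  exact sum_repr_smul J _

theorem sum_mul_clm {Y : κ → ℝ} (L : E →L[ℝ] ℝ) (M : LieAlg E G →L[ℝ] LieAlg E G) :
    ∑ b, Y b * L (M (J b)) = L (M (∑ b, Y b • J b)) := by
  have h := map_sum ((L : E →L[ℝ] ℝ).comp (M : E →L[ℝ] E)) (fun b => (Y b • J b : E)) Finset.univ
  refine Eq.trans ?_ h.symm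
  exact Finset.sum_congr rfl fun b _ =>
    (map_smul ((L : E →L[ℝ] ℝ).comp (M : E →L[ℝ] E)) (Y b) (J b : E)).symm

open Classical in
theorem tailField_apply (X : Hol n g) (a : κ) (F : Fn E G n g) (u : Hol n g → G) :
    tailField J X a F u =
      -∑ Y with Prec X Y, pd E Y F u (subAd E (u Y) (subAd E (u X) (J a))) := by
  have h : tailField J X a F = ∑ b, oneSubAd J X a b * ∑ Y with Prec X Y, conjField J Y b F := by
    rw [tailField]
    simp only [derivation_sum_apply, Derivation.smul_apply, smul_eq_mul]
  rw [h, Fn_sum_apply]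
  have h1 : ∀ b, (oneSubAd J X a b * ∑ Y with Prec X Y, conjField J Y b F) u =
      -∑ Y with Prec X Y, oneSubAd J X a b u * pd E Y F u (subAd E (u Y) (J b)) := by
    intro b
    have h2 : (oneSubAd J X a b * ∑ Y with Prec X Y, conjField J Y b F) u =
      oneSubAd J X a b u * (∑ Y with Prec X Y, conjField J Y b F) u := rfl
    rw [h2, Fn_sum_apply, Finset.mul_sum, ← Finset.sum_neg_distrib]
    exact Finset.sum_congr rfl fun Y _ => by rw [conjField_apply]; ring
  simp only [h1]
  rw [Finset.sum_neg_distrib, Finset.sum_comm]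
  congr 1
  refine Finset.sum_congr rfl fun Y _ => ?_
  rw [sum_mul_clm, sum_oneSubAd_smul]

theorem sum_adFn_JR (w : (Hol n g → G) → G) (hw : ContMDiff (piModel (Hol n g) E) 𝓘(ℝ, E) ∞ w)
    (a : κ) (Y : Hol n g) (F : Fn E G n g) (u : Hol n g → G) :
    (∑ b, adFn J w hw a b • JR Y (J b)) F u = pd E Y F u (AdE E (u Y * w u) (J a)) := by
  have h : (∑ b, adFn J w hw a b • JR Y (J b)) F = ∑ b, adFn J w hw a b * JR Y (J b) F := by
    simp only [derivation_sum_apply, Derivation.smul_apply, smul_eq_mul]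
  rw [h, Fn_sum_apply]
  have h1 : ∀ b, (adFn J w hw a b * JR Y (J b) F) u =
      J.repr (Ad (w u) (J a)) b * pd E Y F u (Ad (u Y) (J b)) := fun b => by
    have h2 : (adFn J w hw a b * JR Y (J b) F) u = adFn J w hw a b u * JR Y (J b) F u := rfl
    rw [h2, JR_apply]; rfl
  simp only [h1]
  rw [sum_mul_clm, sum_repr_smul]
  exact congrArg (fun L : LieAlg E G →L[ℝ] LieAlg E G => pd E Y F u (L (J a))) (Ad_mul (E := E) _ _).symm

/-- Links the prescribed fields with the decoupling: written through left translations, `genField`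
moves u_Y exactly in the direction obtained by applying S_{XY} and then the action of k^Y. -/
theorem genField_apply (X : Hol n g) (a : κ) (F : Fn E G n g) (u : Hol n g → G) :
    genField J X a F u = vD E (genVar u X (J a)) F u := by
  classical
  have hpd0 : ∀ Y, pd E Y F u (0 : LieAlg E G) = 0 := fun Y => map_zero (pd E Y F u)
  set tl : Hol n g → ℝ := fun Y => if Prec X Y then
    pd E Y F u (subAd E (u Y) (subAd E (u X) (J a))) else 0 with htl
  have htail : -tailField J X a F u = ∑ Y, tl Y := by
    rw [tailField_apply, neg_neg, Finset.sum_filter]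
  -- The labels Y > X are accounted for by `tailField`; `own` collects X and, for a handle, its
  -- partner.
  have hsplit : ∀ (own : Hol n g → ℝ), (∀ Y, pd E Y F u (genVar u X (J a) Y) = own Y + tl Y) →
      vD E (genVar u X (J a)) F u = (∑ Y, own Y) - tailField J X a F u := by
    intro own h
    rw [vD, Finset.sum_congr rfl fun Y _ => h Y, Finset.sum_add_distrib, ← htail]; ring
  rcases X with i | i | i
  · have h : genField J (Sum.inl i) a F u = -conjField J (Hol.M i) a F u -
      tailField J (Hol.M i) a F u := rfl
    rw [h, conjField_apply, hsplit (fun Y => if Y = Hol.M i then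
      pd E (Hol.M i) F u (subAd E (u (Hol.M i)) (J a)) else 0)]
    · rw [Finset.sum_ite_eq' Finset.univ]; simp
    · intro Y
      simp only [htl]
      rcases prec_trichotomy (Sum.inl i) Y with h | h | rfl | ⟨j, hj, rfl⟩ | ⟨j, hj, rfl⟩
      · rw [genVar_of_prec u h, if_pos h, if_neg h.ne.symm, zero_add]
      · rw [genVar_of_prec_symm u h, if_neg h.asymm, if_neg h.ne, hpd0, zero_add]
      · rw [genVar_self, if_neg (Prec.irrefl _), if_pos rfl, add_zero]
      · simp at hj
      · simp at hj
  · have h : genField J (Sum.inr (Sum.inl i)) a F u = -conjField J (Hol.A i) a F u -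
      conjField J (Hol.B i) a F u - (∑ b, adFn J (fun u : Hol n g → G => (u (Hol.B i))⁻¹ *
        u (Hol.A i)) (contMDiff_invBA i) a b • JR (Hol.B i) (J b)) F u -
      tailField J (Hol.A i) a F u := rfl
    rw [h, conjField_apply, conjField_apply, sum_adFn_JR, hsplit (fun Y => (if Y = Hol.A i then
      pd E (Hol.A i) F u (subAd E (u (Hol.A i)) (J a)) else 0) + if Y = Hol.B i then
      pd E (Hol.B i) F u (subAd E (u (Hol.A i)) (J a) - Ad (u (Hol.B i)) (J a)) else 0)]
    · rw [Finset.sum_add_distrib, Finset.sum_ite_eq' Finset.univ, Finset.sum_ite_eq' Finset.univ]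
      simp only [Finset.mem_univ, if_true, mul_inv_cancel_left]
      -- At B_i the conjugation field gives 1 - Ad(u_B), and the extra J^R term gives
      -- Ad(u_B·u_B⁻¹u_A) = Ad(u_A).
      have h1 : (pd E (Hol.B i) F u) ((subAd E (u (Hol.A i))) (J a) - (Ad (u (Hol.B i))) (J a)) =
          (pd E (Hol.B i) F u) ((subAd E (u (Hol.B i))) (J a)) -
          (pd E (Hol.B i) F u) (AdE E (u (Hol.A i)) (J a)) := by
        refine Eq.trans ?_ (map_sub (pd E (Hol.B i) F u) _ _)
        refine congrArg (pd E (Hol.B i) F u) ?_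
        show J a - Ad (u (Hol.A i)) (J a) - Ad (u (Hol.B i)) (J a) =
          J a - Ad (u (Hol.B i)) (J a) - Ad (u (Hol.A i)) (J a)
        abel
      rw [h1]; ring
    · intro Y
      simp only [htl]
      rcases prec_trichotomy (Hol.A i) Y with h | h | rfl | ⟨j, hj, rfl⟩ | ⟨j, hj, rfl⟩
      · have hB : Y ≠ Hol.B i := by rintro rfl; exact not_prec_A_B i h
        rw [genVar_of_prec u h, if_pos h, if_neg h.ne.symm, if_neg hB, zero_add, zero_add]
      · have hB : Y ≠ Hol.B i := by rintro rfl; exact not_prec_B_A i h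
        rw [genVar_of_prec_symm u h, if_neg h.asymm, if_neg h.ne, if_neg hB, hpd0, zero_add, zero_add]
      · rw [genVar_self, if_neg (Prec.irrefl _), if_pos rfl, if_neg (by simp), add_zero, add_zero]
      · obtain rfl : i = j := by simpa using hj
        rw [genVar_A_B, if_neg (not_prec_A_B i), if_neg (by simp), if_pos rfl, zero_add, add_zero]
      · simp at hj
  · have h : genField J (Sum.inr (Sum.inr i)) a F u = -JL (Hol.A i) (J a) F u -
      conjField J (Hol.B i) a F u - tailField J (Hol.B i) a F u := rfl
    rw [h, conjField_apply, JL_apply, hsplit (fun Y => (if Y = Hol.A i then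
      pd E (Hol.A i) F u (J a) else 0) + if Y = Hol.B i then
      pd E (Hol.B i) F u (subAd E (u (Hol.B i)) (J a)) else 0)]
    · rw [Finset.sum_add_distrib, Finset.sum_ite_eq' Finset.univ, Finset.sum_ite_eq' Finset.univ]
      simp
    · intro Y
      simp only [htl]
      rcases prec_trichotomy (Hol.B i) Y with h | h | rfl | ⟨j, hj, rfl⟩ | ⟨j, hj, rfl⟩
      · have hB : Y ≠ Hol.A i := by rintro rfl; exact not_prec_B_A i h
        rw [genVar_of_prec u h, if_pos h, if_neg h.ne.symm, if_neg hB, zero_add, zero_add]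
      · have hB : Y ≠ Hol.A i := by rintro rfl; exact not_prec_A_B i h
        rw [genVar_of_prec_symm u h, if_neg h.asymm, if_neg h.ne, if_neg hB, hpd0, zero_add, zero_add]
      · rw [genVar_self, if_neg (Prec.irrefl _), if_neg (by simp), if_pos rfl, add_zero, zero_add]
      · simp at hj
      · obtain rfl : i = j := by simpa using hj
        rw [genVar_B_A, if_neg (not_prec_B_A i), if_pos rfl, if_neg (by simp), add_zero, add_zero]

theorem genBracket_self (X : Hol n g) (a b : κ) :
    genBracket J (X, a) (X, b) = -jv J X (constE n g ⁅J a, J b⁆) := by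
  rw [genBracket, if_pos rfl, jv_const]; rfl

theorem upperBracket_eq_zero {X Y : Hol n g} (h : ¬Prec X Y)
    (h' : ¬∃ i, X = Hol.A i ∧ Y = Hol.B i) (a b : κ) : upperBracket J (X, a) (Y, b) = 0 := by
  rw [upperBracket, if_neg h, if_neg h']

theorem genBracket_of_prec {X Y : Hol n g} (h : Prec X Y) (a b : κ) (s : FnE E G n g)
    (hs : ∀ u, s u = (⁅subAd E (u X) (J a), J b⁆ : LieAlg E G)) :
    genBracket J (X, a) (Y, b) = -jv J Y s := by
  rw [genBracket, if_neg h.ne, upperBracket_of_prec J h a b s hs, upperBracket_eq_zero J h.asymm,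
    sub_zero]
  rintro ⟨i, rfl, rfl⟩; exact not_prec_B_A i h

theorem genBracket_A_B (i : Fin g) (a b : κ) :
    genBracket J (Hol.A i, a) (Hol.B i, b) =
      -jv J (Hol.B i : Hol n g) (constE n g ⁅J a, J b⁆) := by
  rw [genBracket, if_neg (by simp), upperBracket_eq_zero J (not_prec_B_A i) (by simp), sub_zero,
    upperBracket, if_neg (not_prec_A_B i), if_pos ⟨i, rfl, rfl⟩, jv_const]; rfl

theorem genBracket_symm (p q : Hol n g × κ) : genBracket J p q = -genBracket J q p := by
  obtain ⟨X, a⟩ := p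
  obtain ⟨Y, b⟩ := q
  by_cases h : X = Y
  · subst h
    rw [genBracket_self, genBracket_self, jv_const, jv_const, ← lie_skew (J b)]
    simp only [map_neg, Finsupp.neg_apply, neg_smul, Finset.sum_neg_distrib, neg_neg]
  · rw [genBracket, genBracket, if_neg h, if_neg (Ne.symm h)]; ring

theorem isSkewBider_bracket :
    IsSkewBider (bracket J : FlowerAlg E G n g κ → FlowerAlg E G n g κ → _) :=
  isSkewBider_of_eq (genBracket J) (genBracket_symm J) (fun p => genField J p.1 p.2) _
    fun _ _ => rfl

end Field

/-! ### The decoupled bracket and its Jacobi identity -/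

section Decoupled
variable {E : Type*} [NormedAddCommGroup E] [NormedSpace ℝ E] [FiniteDimensional ℝ E]
  {G : Type*} [TopologicalSpace G] [T2Space G] [ChartedSpace E G] [Group G] [LieGroup 𝓘(ℝ, E) ∞ G]
  {V : Type*} [NormedAddCommGroup V] [NormedSpace ℝ V]
  {n g : ℕ}

theorem pd_pd_apply (X Y : Hol n g) {F : (Hol n g → G) → V} {s : (Hol n g → G) → E}
    (hF : ContMDiff (piModel (Hol n g) E) 𝓘(ℝ, V) ∞ F)
    (hs : ContMDiff (piModel (Hol n g) E) 𝓘(ℝ, E) ∞ s) (u : Hol n g → G) (ξ : E) :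
    pd E X (fun v => pd E Y F v (s v)) u ξ =
      pd E X (fun v => pd E Y F v (s u)) u ξ + pd E Y F u (pd E X s u ξ) := by
  have hA := hasMFDerivAt_pd X (contMDiff_pd Y hF) u
  have h1 := hasMFDerivAt_clm_apply hA (hasMFDerivAt_pd X hs u)
  have h2 := hasMFDerivAt_clm_apply (W := E) (w := fun _ : G => s u) (w' := 0) hA
    (hasMFDerivAt_const _ _)
  have h3 := congrArg (fun L : E →L[ℝ] V => L ξ) h1.mfderiv
  have h4 := congrArg (fun L : E →L[ℝ] V => L ξ) h2.mfderiv
  have h5 : ∀ v, v = u → pd E X (fun v => pd E Y F v (s v)) u ξ =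
      pd E Y F v (pd E X s u ξ) + pd E X (pd E Y F) u ξ (s v) →
      pd E X (fun v => pd E Y F v (s u)) u ξ =
      pd E Y F v ((0 : E →L[ℝ] E) ξ) + pd E X (pd E Y F) u ξ (s u) →
      pd E X (fun v => pd E Y F v (s v)) u ξ =
      pd E X (fun v => pd E Y F v (s u)) u ξ + pd E Y F u (pd E X s u ξ) := by
    rintro v rfl h h'
    rw [h, h', zero_apply, map_zero]; abel
  exact h5 (update u X (1 * u X)) (by simp) h3 h4

theorem pd_sub {X : Hol n g} {s t : (Hol n g → G) → V}
    (hs : ContMDiff (piModel (Hol n g) E) 𝓘(ℝ, V) ∞ s)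
    (ht : ContMDiff (piModel (Hol n g) E) 𝓘(ℝ, V) ∞ t) (u : Hol n g → G) :
    pd E X (fun u => s u - t u) u = pd E X s u - pd E X t u :=
  pd_eq_of_hasMFDerivAt ((hasMFDerivAt_pd X hs u).sub (hasMFDerivAt_pd X ht u))

theorem pd_const (X : Hol n g) (c : V) (u : Hol n g → G) : pd E X (fun _ => c) u = 0 :=
  pd_eq_of_hasMFDerivAt (hasMFDerivAt_const _ _)

theorem pd_Ad_self (X : Hol n g) (u : Hol n g → G) (ξ η : LieAlg E G) :
    pd E X (fun v => AdE E (v X) η) u ξ = (⁅ξ, Ad (u X) η⁆ : LieAlg E G) := by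
  have h := ((hasRD_id (E := E) (G := G)).mul_const (u X)).Ad_apply η
  have h1 : (fun y : G => AdE E (y * u X) η) = fun y => AdE E (update u X (y * u X) X) η := by
    ext y; simp
  rw [h1] at h
  have h2 := congrArg (fun L : E →L[ℝ] E => L ξ) h.mfderiv
  refine Eq.trans h2 ?_
  show ⁅ξ, Ad (1 * u X) η⁆ = ⁅ξ, Ad (u X) η⁆
  rw [one_mul]

theorem pd_subAd_self (X : Hol n g) (u : Hol n g → G) (ξ η : LieAlg E G) :
    pd E X (fun v => toE E (subAd E (v X) η)) u ξ = toE E (-⁅ξ, Ad (u X) η⁆) := by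
  have h1 := pd_sub (E := E) (X := X) (V := E) (s := fun _ : Hol n g → G => toE E η)
    (t := fun v => AdE E (v X) η) (contMDiff_const (M' := E) (c := toE E η))
    (contMDiff_Ad_apply (contMDiff_proj X) (contMDiff_const (M' := E) (c := toE E η))) u
  have h2 : pd E X (fun v : Hol n g → G => toE E (subAd E (v X) η)) u =
      pd E X (fun _ : Hol n g → G => toE E η) u - pd E X (fun v => AdE E (v X) η) u := h1
  rw [h2, pd_const, zero_sub]
  exact congrArg (fun w : E => -w) (pd_Ad_self X u ξ η)

theorem anchor_update_of_ne {X Y : Hol n g} (h : X ≠ Y) (u : Hol n g → G) (v : G) :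
    anchor E (update u X v) Y = anchor E u Y := by
  rcases Y with i | i
  · simp [anchor, update_of_ne h.symm]
  · rfl

theorem pd_anchor_of_ne {X Y : Hol n g} (h : X ≠ Y) (F : (Hol n g → G) → V) (u : Hol n g → G)
    (ξ η : LieAlg E G) : pd E X (fun v => pd E Y F v (anchor E v Y η)) u ξ =
      pd E X (fun v => pd E Y F v (anchor E u Y η)) u ξ := by
  refine congrArg (fun f : G → V => mderiv E f 1 ξ) (funext fun y => ?_)
  exact congrArg (fun A : LieAlg E G →L[ℝ] LieAlg E G =>
    pd E Y F (update u X (y * u X)) (A η)) (anchor_update_of_ne h u _)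

/-- For a handle label this is the commutator of right-invariant fields. For M_i the vector
(1-Ad(u))ξ itself varies with u; the extra terms combine with the commutator because Ad(u) preserves
the bracket. -/
theorem anchor_bracket (X : Hol n g) {F : (Hol n g → G) → V}
    (hF : ContMDiff (piModel (Hol n g) E) 𝓘(ℝ, V) ∞ F) (u : Hol n g → G) (ξ η : LieAlg E G) :
    pd E X (fun v => pd E X F v (anchor E v X η)) u (anchor E u X ξ) -
      pd E X (fun v => pd E X F v (anchor E v X ξ)) u (anchor E u X η) =
      -pd E X F u (anchor E u X ⁅ξ, η⁆) := by
  rcases X with i | i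
  · set X : Hol n g := Sum.inl i
    have h1 : ∀ ξ η : LieAlg E G, pd E X (fun v => pd E X F v (toE E (subAd E (v X) η))) u
        (subAd E (u X) ξ) = pd E X (fun v => pd E X F v (subAd E (u X) η)) u (subAd E (u X) ξ) +
          pd E X F u (-⁅subAd E (u X) ξ, Ad (u X) η⁆ : LieAlg E G) := by
      intro ξ η
      refine (pd_pd_apply X X hF (contMDiff_subAd_apply (contMDiff_proj X) contMDiff_const) u _).trans ?_
      rw [pd_subAd_self]; rfl
    have h2 := pd_comm_self X hF u (subAd E (u X) ξ) (subAd E (u X) η)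
    have h3 : pd E X F u (-⁅subAd E (u X) ξ, subAd E (u X) η⁆ - ⁅subAd E (u X) ξ, Ad (u X) η⁆ +
      ⁅subAd E (u X) η, Ad (u X) ξ⁆ : LieAlg E G) = pd E X F u (-subAd E (u X) ⁅ξ, η⁆ : LieAlg E G) := by
      have hLie : (-⁅subAd E (u X) ξ, subAd E (u X) η⁆ - ⁅subAd E (u X) ξ, Ad (u X) η⁆ +
          ⁅subAd E (u X) η, Ad (u X) ξ⁆ : LieAlg E G) = (-subAd E (u X) ⁅ξ, η⁆ : LieAlg E G) := by
        rw [← lie_skew (subAd E (u X) η) (Ad (u X) ξ)]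
        simp only [subAd_apply, sub_lie, lie_sub, Ad_lie]
        abel
      exact congrArg (fun v : E => pd E X F u v) hLie
    have h4 : pd E X F u (-⁅subAd E (u X) ξ, subAd E (u X) η⁆ - ⁅subAd E (u X) ξ, Ad (u X) η⁆ +
      ⁅subAd E (u X) η, Ad (u X) ξ⁆ : LieAlg E G) =
      -pd E X F u (⁅subAd E (u X) ξ, subAd E (u X) η⁆ : LieAlg E G) +
        pd E X F u (-⁅subAd E (u X) ξ, Ad (u X) η⁆ : LieAlg E G) -
          pd E X F u (-⁅subAd E (u X) η, Ad (u X) ξ⁆ : LieAlg E G) := by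
      have h5 : ∀ a b c : E, pd E X F u (-a - b + c) = -pd E X F u a + pd E X F u (-b) -
        pd E X F u (-c) := fun a b c => by simp only [map_add, map_sub, map_neg]; abel
      exact h5 _ _ _
    have h5 : pd E X F u (-subAd E (u X) ⁅ξ, η⁆ : LieAlg E G) = -pd E X F u (subAd E (u X) ⁅ξ, η⁆ : LieAlg E G) :=
      map_neg (pd E X F u) _
    refine Eq.trans ?_ h5
    rw [← h3, h4, ← h2]
    refine (congrArg₂ (fun a b : V => a - b) (h1 ξ η) (h1 η ξ)).trans ?_
    abel
  · exact pd_comm_self (Sum.inr i) hF u ξ η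

theorem anchor_comm {X Y : Hol n g} (hXY : X ≠ Y) {F : (Hol n g → G) → V}
    (hF : ContMDiff (piModel (Hol n g) E) 𝓘(ℝ, V) ∞ F) (u : Hol n g → G) (ξ η : LieAlg E G) :
    pd E X (fun v => pd E Y F v (anchor E v Y η)) u (anchor E u X ξ) =
      pd E Y (fun v => pd E X F v (anchor E v X ξ)) u (anchor E u Y η) := by
  rw [pd_anchor_of_ne hXY, pd_anchor_of_ne hXY.symm]
  exact pd_comm_of_ne hXY hF u _ _

variable {κ : Type*} [Fintype κ] [DecidableEq κ] (J : Module.Basis κ ℝ (LieAlg E G))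

/-- The vector field of the decoupled generator `k^Y_a`. -/
def anchorField : Hol n g × κ → Derivation ℝ (Fn E G n g) (Fn E G n g)
  | (Sum.inl i, a) => -conjField J (Hol.M i) a
  | (Sum.inr y, a) => -JL (Sum.inr y) (J a)

theorem anchorField_apply (p : Hol n g × κ) (F : Fn E G n g) (u : Hol n g → G) :
    anchorField J p F u = pd E p.1 F u (anchor E u p.1 (J p.2)) := by
  obtain ⟨Y | Y, a⟩ := p
  · have h : anchorField J (Sum.inl Y, a) F u = -conjField J (Hol.M Y) a F u := rfl
    rw [h, conjField_apply, neg_neg]; rfl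
  · have h : anchorField J (Sum.inr Y, a) F u = -JL (Sum.inr Y) (J a) F u := rfl
    rw [h, JL_apply, neg_neg]; rfl

/-- The brackets of the decoupled generators. -/
def diagBracket (p q : Hol n g × κ) : FlowerAlg E G n g κ :=
  if p.1 = q.1 then -jv J p.1 (constE n g ⁅J p.2, J q.2⁆) else 0

/-- The bracket of the decoupled generators, as a biderivation. -/
def decBracket (φ ψ : FlowerAlg E G n g κ) : FlowerAlg E G n g κ :=
  (∑ p, ∑ q, diagBracket J p q * pderiv p φ * pderiv q ψ) +
    ∑ p, (pderiv p φ * coeffDer (anchorField J p) ψ - pderiv p ψ * coeffDer (anchorField J p) φ)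

theorem diagBracket_symm (p q : Hol n g × κ) : diagBracket J p q = -diagBracket J q p := by
  unfold diagBracket
  by_cases h : p.1 = q.1
  · rw [if_pos h, if_pos h.symm, ← h, jv_const, jv_const, ← lie_skew (J q.2)]
    simp only [map_neg, Finsupp.neg_apply, neg_smul, Finset.sum_neg_distrib, neg_neg]
  · rw [if_neg h, if_neg (Ne.symm h), neg_zero]

theorem isSkewBider_decBracket :
    IsSkewBider (decBracket J : FlowerAlg E G n g κ → FlowerAlg E G n g κ → _) :=
  isSkewBider_of_eq (diagBracket J) (diagBracket_symm J) (anchorField J) _ fun _ _ => rfl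

theorem coeffDer_C (D : Derivation ℝ (Fn E G n g) (Fn E G n g)) (F : Fn E G n g) :
    coeffDer D (C F : FlowerAlg E G n g κ) = C (D F) := onCoeffs_C D F

theorem coeffDer_X (D : Derivation ℝ (Fn E G n g) (Fn E G n g)) (p : Hol n g × κ) :
    coeffDer D (X p : FlowerAlg E G n g κ) = 0 := onCoeffs_X D p

theorem decBracket_X_X (p q : Hol n g × κ) :
    decBracket J (X p) (X q) = diagBracket J p q := by
  simp [decBracket, coeffDer_X, Pi.single_apply]

theorem decBracket_X_C (p : Hol n g × κ) (F : Fn E G n g) :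
    decBracket J (X p) (C F) = C (anchorField J p F) := by
  simp [decBracket, coeffDer_X, coeffDer_C, Pi.single_apply]

theorem decBracket_C_C (F F' : Fn E G n g) :
    decBracket J (C F : FlowerAlg E G n g κ) (C F') = 0 := by
  simp [decBracket]

theorem decBracket_jv_const_C (Y : Hol n g) (ξ : LieAlg E G) (F : Fn E G n g) :
    decBracket J (jv J Y (constE n g ξ)) (C F) =
      C (∑ c, J.repr ξ c • anchorField J (Y, c) F) := by
  rw [jv_const, (isSkewBider_decBracket J).sum_left, map_sum]
  refine Finset.sum_congr rfl fun c _ => ?_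
  rw [(isSkewBider_decBracket J).smul_left, decBracket_X_C, smul_eq_C_mul', Algebra.smul_def, map_mul]

theorem sum_anchorField_apply (Y : Hol n g) (ξ : LieAlg E G) (F : Fn E G n g) (u : Hol n g → G) :
    (∑ c, J.repr ξ c • anchorField J (Y, c) F) u = pd E Y F u (anchor E u Y ξ) := by
  rw [Fn_sum_apply]
  have h1 : ∀ c, (J.repr ξ c • anchorField J (Y, c) F) u =
      J.repr ξ c * pd E Y F u (anchor E u Y (J c)) := fun c =>
    congrArg (fun r : ℝ => J.repr ξ c * r) (anchorField_apply J (Y, c) F u)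
  simp only [h1]
  rw [sum_mul_clm, sum_repr_smul]

theorem decBracket_X_jv_const (X' Y : Hol n g) (a : κ) (ξ : LieAlg E G) :
    decBracket J (X (X', a)) (jv J Y (constE n g ξ)) =
      if X' = Y then -jv J Y (constE n g ⁅J a, ξ⁆) else 0 := by
  rw [jv_const, (isSkewBider_decBracket J).sum_right]
  simp only [(isSkewBider_decBracket J).smul_right, decBracket_X_X, diagBracket]
  split_ifs with h
  · subst h
    simp only [jv_const]
    have h1 : J.repr ⁅J a, ξ⁆ = ∑ b, J.repr ξ b • J.repr ⁅J a, J b⁆ := by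
      conv_lhs => rw [← sum_repr_smul J ξ, lie_sum, map_sum]
      exact Finset.sum_congr rfl fun b _ => by rw [lie_smul, map_smul]
    rw [h1]
    simp only [Finsupp.coe_finsetSum, Finset.sum_apply, Finsupp.smul_apply, Finset.sum_smul,
      smul_neg, Finset.sum_neg_distrib, Finset.smul_sum, smul_eq_mul, mul_smul]
    rw [Finset.sum_comm]
  · simp

/-- For two generators and a function, the identity says that the fields of one label represent 𝔤 up
to sign and that those of different labels commute. For three generators it is the Jacobi identity
of 𝔤, or trivial when the labels differ. -/
theorem jac_decBracket (x y z : FlowerAlg E G n g κ) : IsSkewBider.jac (decBracket J) x y z = 0 := by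
  have hS := isSkewBider_decBracket (n := n) (g := g) J
  refine jac_eq_zero_of_X_C hS (fun p => anchorField J p) (decBracket_C_C J) (decBracket_X_C J)
    (fun p q F => ?_) (fun p q r => ?_) x y z
  · obtain ⟨X', a⟩ := p
    obtain ⟨Y, b⟩ := q
    have hF := F.contMDiff
    rw [IsSkewBider.jac, hS.skew (C F) (X (X', a)), hS.neg_right, hS.skew (C F) (decBracket J _ _),
      decBracket_X_C, decBracket_X_C, decBracket_X_C, decBracket_X_C, decBracket_X_X, diagBracket]
    have hpt : ∀ p q (u : Hol n g → G), anchorField J p (anchorField J q F) u =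
        pd E p.1 (fun v => pd E q.1 F v (anchor E v q.1 (J q.2))) u (anchor E u p.1 (J p.2)) := by
      intro p q u
      rw [anchorField_apply]
      have : ⇑(anchorField J q F) = fun v => pd E q.1 F v (anchor E v q.1 (J q.2)) :=
        funext fun v => anchorField_apply J q F v
      rw [this]
    by_cases h : X' = Y
    · subst h
      rw [if_pos rfl, hS.neg_left, neg_neg, decBracket_jv_const_C, ← map_neg, ← map_add, ← map_add]
      rw [← map_zero (C (σ := Hol n g × κ) (R := Fn E G n g))]
      congr 1
      ext u
      have h1 := anchor_bracket X' hF u (J a) (J b)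
      have h2 := sum_anchorField_apply J X' ⁅J a, J b⁆ F u
      have h3 : (anchorField J (X', a) (anchorField J (X', b) F) +
        -anchorField J (X', b) (anchorField J (X', a) F) +
        ∑ c, J.repr ⁅J a, J b⁆ c • anchorField J (X', c) F) u =
        anchorField J (X', a) (anchorField J (X', b) F) u -
        anchorField J (X', b) (anchorField J (X', a) F) u +
        (∑ c, J.repr ⁅J a, J b⁆ c • anchorField J (X', c) F) u := by
        rw [sub_eq_add_neg]; rfl
      rw [h3, h2, hpt, hpt, h1]
      exact neg_add_cancel _
    · rw [if_neg h, hS.zero_left, neg_zero, add_zero, ← sub_eq_add_neg, sub_eq_zero]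
      congr 1
      ext u
      rw [hpt, hpt]
      exact anchor_comm h hF u _ _
  · obtain ⟨P, a⟩ := p
    obtain ⟨Q, b⟩ := q
    obtain ⟨R, c⟩ := r
    rw [IsSkewBider.jac, decBracket_X_X, decBracket_X_X, decBracket_X_X]
    have key : ∀ (P Q R : Hol n g) (a b c : κ), decBracket J (X (P, a)) (diagBracket J (Q, b) (R, c)) =
        if P = Q ∧ Q = R then jv J P (constE n g ⁅J a, ⁅J b, J c⁆⁆) else 0 := by
      intro P Q R a b c
      unfold diagBracket
      dsimp only
      by_cases h : Q = R
      · rw [if_pos h, hS.neg_right, decBracket_X_jv_const]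
        by_cases h' : P = Q
        · rw [if_pos h', if_pos ⟨h', h⟩, neg_neg, h']
        · rw [if_neg h', if_neg (fun h => h' h.1), neg_zero]
      · rw [if_neg h, hS.zero_right, if_neg (fun h' => h h'.2)]
    rw [key, key, key]
    by_cases h : P = Q ∧ Q = R
    · obtain ⟨rfl, rfl⟩ := h
      simp only [and_self, if_true, jv_const, ← Finset.sum_add_distrib, ← add_smul,
        ← Finsupp.add_apply, ← map_add, lie_jacobi]
      simp
    · rw [if_neg h, if_neg, if_neg]
      · simp
      · rintro ⟨rfl, rfl⟩; exact h ⟨rfl, rfl⟩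
      · rintro ⟨rfl, rfl⟩; exact h ⟨rfl, rfl⟩

end Decoupled

/-! ### Variation of the decoupling matrix -/

section Variation
variable {E : Type*} [NormedAddCommGroup E] [NormedSpace ℝ E] [FiniteDimensional ℝ E]
  {G : Type*} [TopologicalSpace G] [T2Space G] [ChartedSpace E G] [Group G] [LieGroup 𝓘(ℝ, E) ∞ G]
  {V : Type*} [NormedAddCommGroup V] [NormedSpace ℝ V]
  {n g : ℕ}

theorem pd_add {X : Hol n g} {s t : (Hol n g → G) → V}
    (hs : ContMDiff (piModel (Hol n g) E) 𝓘(ℝ, V) ∞ s)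
    (ht : ContMDiff (piModel (Hol n g) E) 𝓘(ℝ, V) ∞ t) (u : Hol n g → G) :
    pd E X (fun u => s u + t u) u = pd E X s u + pd E X t u :=
  pd_eq_of_hasMFDerivAt ((hasMFDerivAt_pd X hs u).add (hasMFDerivAt_pd X ht u))

theorem vD_add {β : Hol n g → LieAlg E G} {s t : (Hol n g → G) → V}
    (hs : ContMDiff (piModel (Hol n g) E) 𝓘(ℝ, V) ∞ s)
    (ht : ContMDiff (piModel (Hol n g) E) 𝓘(ℝ, V) ∞ t) (u : Hol n g → G) :
    vD E β (fun u => s u + t u) u = vD E β s u + vD E β t u := by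
  simp only [vD, ← Finset.sum_add_distrib]
  refine Finset.sum_congr rfl fun Y _ => ?_
  rw [pd_add hs ht]; rfl

theorem vD_sub {β : Hol n g → LieAlg E G} {s t : (Hol n g → G) → V}
    (hs : ContMDiff (piModel (Hol n g) E) 𝓘(ℝ, V) ∞ s)
    (ht : ContMDiff (piModel (Hol n g) E) 𝓘(ℝ, V) ∞ t) (u : Hol n g → G) :
    vD E β (fun u => s u - t u) u = vD E β s u - vD E β t u := by
  simp only [vD, ← Finset.sum_sub_distrib]
  refine Finset.sum_congr rfl fun Y _ => ?_
  rw [pd_sub hs ht]; rfl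

theorem vD_const (β : Hol n g → LieAlg E G) (c : V) (u : Hol n g → G) :
    vD E β (fun _ => c) u = 0 := by
  simp only [vD, pd_const]
  exact Finset.sum_eq_zero fun Y _ => rfl

theorem pd_clm_comp {W : Type*} [NormedAddCommGroup W] [NormedSpace ℝ W] (L : V →L[ℝ] W)
    {X : Hol n g} {s : (Hol n g → G) → V}
    (hs : ContMDiff (piModel (Hol n g) E) 𝓘(ℝ, V) ∞ s) (u : Hol n g → G) :
    pd E X (fun u => L (s u)) u = L.comp (pd E X s u) :=
  pd_eq_of_hasMFDerivAt (L.hasMFDerivAt.comp (1 : G) (hasMFDerivAt_pd X hs u))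

theorem vD_clm_comp {W : Type*} [NormedAddCommGroup W] [NormedSpace ℝ W] (L : V →L[ℝ] W)
    {β : Hol n g → LieAlg E G} {s : (Hol n g → G) → V}
    (hs : ContMDiff (piModel (Hol n g) E) 𝓘(ℝ, V) ∞ s) (u : Hol n g → G) :
    vD E β (fun u => L (s u)) u = L (vD E β s u) := by
  simp only [vD, map_sum]
  refine Finset.sum_congr rfl fun Y _ => ?_
  rw [pd_clm_comp L hs]; rfl

theorem toE_add (ξ η : LieAlg E G) : toE E (ξ + η) = toE E ξ + toE E η := rfl

theorem toE_sub (ξ η : LieAlg E G) : toE E (ξ - η) = toE E ξ - toE E η := rfl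

theorem toE_zero : toE E (0 : LieAlg E G) = 0 := rfl

theorem vD_subAd {c : (Hol n g → G) → G} (hcs : ContMDiff (piModel (Hol n g) E) 𝓘(ℝ, E) ∞ c)
    {u : Hol n g → G} {β : Hol n g → LieAlg E G} {v : LieAlg E G} (hc : HasVar c u β v)
    (ξ : LieAlg E G) :
    vD E β (fun u => toE E (subAd E (c u) ξ)) u = toE E (-⁅v, Ad (c u) ξ⁆) := by
  have hconst := contMDiff_const (I := piModel (Hol n g) E) (I' := 𝓘(ℝ, E)) (n := ∞)
    (M := Hol n g → G) (M' := E) (c := toE E ξ)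
  have h1 := vD_sub (β := β) hconst (contMDiff_Ad_apply hcs hconst) u
  refine Eq.trans h1 ?_
  rw [vD_const, zero_sub]
  exact congrArg (fun w : E => -w) (hc.vD_Ad ξ)

theorem contMDiff_subAd_const {c : (Hol n g → G) → G}
    (hcs : ContMDiff (piModel (Hol n g) E) 𝓘(ℝ, E) ∞ c) (ξ : LieAlg E G) :
    ContMDiff (piModel (Hol n g) E) 𝓘(ℝ, E) ∞ (fun u => toE E (subAd E (c u) ξ)) :=
  contMDiff_subAd_apply hcs (contMDiff_const (M' := E) (c := toE E ξ))

variable (u : Hol n g → G) (β : Hol n g → LieAlg E G) (ξ : LieAlg E G)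

theorem vD_decouple_of_prec_M {X : Hol n g} {i : Fin n} (h : Prec X (Hol.M i)) :
    vD E β (fun v => toE E (decouple E v X (Hol.M i) ξ)) u = toE E (-⁅β X, Ad (u X) ξ⁆) := by
  simp only [decouple_of_prec _ h]
  exact vD_subAd (contMDiff_proj X) (hasVar_proj X u β) ξ

theorem vD_decouple_of_prec_handle {X : Hol n g} {y : Fin g ⊕ Fin g} (h : Prec X (Sum.inr y)) :
    vD E β (fun v => toE E (decouple E v X (Sum.inr y) ξ)) u =
      toE E (-⁅β X, Ad (u X) ξ⁆ - ⁅β (Sum.inr y), Ad (u (Sum.inr y)) ξ⁆ +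
        ⁅β (Sum.inr y) + Ad (u (Sum.inr y)) (β X), Ad (u (Sum.inr y)) (Ad (u X) ξ)⁆) := by
  set Y : Hol n g := Sum.inr y
  -- (1-Ad(u_Y))(1-Ad(u_X)) = (1-Ad(u_X)) + (1-Ad(u_Y)) - (1-Ad(u_Y u_X)), so only operators of the
  -- form 1 - Ad(c) have to be varied.
  have h0 : (fun v : Hol n g → G => toE E (decouple E v X Y ξ)) = fun v =>
      toE E (subAd E (v X) ξ) + toE E (subAd E (v Y) ξ) - toE E (subAd E (v Y * v X) ξ) := by
    ext1 v
    rw [decouple_of_prec _ h, ← toE_add, ← toE_sub]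
    refine congrArg (toE E) ?_
    show subAd E (v Y) (subAd E (v X) ξ) = _
    simp only [subAd_apply, Ad_mul, map_sub, ContinuousLinearMap.comp_apply]
    abel
  have hX := contMDiff_proj (E := E) (M := G) X
  have hY := contMDiff_proj (E := E) (M := G) Y
  have sX := contMDiff_subAd_const hX ξ
  have sY := contMDiff_subAd_const hY ξ
  have sXY : ContMDiff (piModel (Hol n g) E) 𝓘(ℝ, E) ∞ (fun v : Hol n g → G =>
      toE E (subAd E (v X) ξ) + toE E (subAd E (v Y) ξ)) := sX.add sY
  have hYX : ContMDiff (piModel (Hol n g) E) 𝓘(ℝ, E) ∞ (fun v : Hol n g → G => v Y * v X) :=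
    hY.mul hX
  rw [h0, vD_sub sXY (contMDiff_subAd_const hYX ξ), vD_add sX sY, vD_subAd hX (hasVar_proj X u β), vD_subAd hY (hasVar_proj Y u β),
    vD_subAd hYX ((hasVar_proj Y u β).mul (hasVar_proj X u β)), ← toE_add, ← toE_sub]
  refine congrArg (toE E) ?_
  simp only [Ad_mul, ContinuousLinearMap.comp_apply]
  abel

theorem vD_decouple_of_prec_symm {X Y : Hol n g} (h : Prec Y X) :
    vD E β (fun v => toE E (decouple E v X Y ξ)) u = 0 := by
  simp only [decouple_of_prec_symm _ h]
  exact vD_const β (0 : E) u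

theorem vD_decouple_M_M (i : Fin n) :
    vD E β (fun v => toE E (decouple E v (Hol.M i) (Hol.M i) ξ)) u = 0 := by
  simp only [decouple_M_M]
  exact vD_const β (toE E ξ) u

theorem vD_decouple_B_A (i : Fin g) :
    vD E β (fun v => toE E (decouple E v (Hol.B i) (Hol.A i) ξ)) u = 0 := by
  simp only [decouple_B_A]
  exact vD_const β (toE E ξ) u

theorem vD_decouple_A_A (i : Fin g) :
    vD E β (fun v => toE E (decouple E v (Hol.A i) (Hol.A i) ξ)) u =
      toE E (-⁅β (Hol.A i), Ad (u (Hol.A i)) ξ⁆) := by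
  simp only [decouple_A_A]
  exact vD_subAd (contMDiff_proj _) (hasVar_proj _ u β) ξ

theorem vD_decouple_B_B (i : Fin g) :
    vD E β (fun v => toE E (decouple E v (Hol.B i) (Hol.B i) ξ)) u =
      toE E (-⁅β (Hol.B i), Ad (u (Hol.B i)) ξ⁆) := by
  simp only [decouple_B_B]
  exact vD_subAd (contMDiff_proj _) (hasVar_proj _ u β) ξ

theorem vD_decouple_A_B (i : Fin g) :
    vD E β (fun v => toE E (decouple E v (Hol.A i) (Hol.B i) ξ)) u =
      toE E (-⁅β (Hol.A i), Ad (u (Hol.A i)) ξ⁆ - ⁅β (Hol.B i), Ad (u (Hol.B i)) ξ⁆) := by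
  have hA := contMDiff_proj (E := E) (M := G) (Hol.A i : Hol n g)
  have hB := contMDiff_proj (E := E) (M := G) (Hol.B i : Hol n g)
  have h0 : (fun v : Hol n g → G => toE E (decouple E v (Hol.A i) (Hol.B i) ξ)) = fun v =>
      toE E (subAd E (v (Hol.A i)) ξ) + toE E (subAd E (v (Hol.B i)) ξ) - toE E ξ := by
    ext1 v
    rw [decouple_A_B, ← toE_add, ← toE_sub]
    refine congrArg (toE E) ?_
    simp only [sub_apply, subAd_apply]
    abel
  have hAB : ContMDiff (piModel (Hol n g) E) 𝓘(ℝ, E) ∞ (fun v : Hol n g → G =>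
      toE E (subAd E (v (Hol.A i)) ξ) + toE E (subAd E (v (Hol.B i)) ξ)) :=
    (contMDiff_subAd_const hA ξ).add (contMDiff_subAd_const hB ξ)
  rw [h0, vD_sub hAB (contMDiff_const (M' := E) (c := toE E ξ)), vD_const, sub_zero,
    vD_add (contMDiff_subAd_const hA ξ) (contMDiff_subAd_const hB ξ),
    vD_subAd hA (hasVar_proj _ u β), vD_subAd hB (hasVar_proj _ u β), ← toE_add, ← sub_eq_add_neg]

/-- The entry S_{XY} depends on u_X and u_Y only. -/
theorem vD_decouple_eq_zero {X Y : Hol n g} (hX : β X = 0) (hY : β Y = 0) :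
    vD E β (fun v => toE E (decouple E v X Y ξ)) u = 0 := by
  rcases prec_trichotomy X Y with h | h | rfl | ⟨i, rfl, rfl⟩ | ⟨i, rfl, rfl⟩
  · rcases Y with i | i
    · rw [vD_decouple_of_prec_M _ _ _ h, hX, zero_lie, neg_zero, toE_zero]
    · rw [vD_decouple_of_prec_handle _ _ _ h, hX, hY]
      simp only [zero_lie, map_zero, neg_zero, add_zero, sub_zero, toE_zero]
  · exact vD_decouple_of_prec_symm _ _ _ h
  · rcases X with i | i | i
    · exact vD_decouple_M_M _ _ _ i
    · exact (vD_decouple_A_A _ _ _ i).trans (by rw [hX, zero_lie, neg_zero, toE_zero])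
    · exact (vD_decouple_B_B _ _ _ i).trans (by rw [hX, zero_lie, neg_zero, toE_zero])
  · rw [vD_decouple_A_B, hX, hY, zero_lie, zero_lie, neg_zero, sub_zero, toE_zero]
  · exact vD_decouple_B_A _ _ _ i

variable {ξ} (η : LieAlg E G)

/-- The bracket of the two elements `∑_Y k^Y(S_{XY} ξ)` and `∑_Y k^Y(S_{X'Y} η)`, at `Y`. -/
def decoupleBr (u : Hol n g → G) (X X' : Hol n g) (ξ η : LieAlg E G) (Y : Hol n g) : E :=
  toE E (-⁅decouple E u X Y ξ, decouple E u X' Y η⁆) +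
    vD E (genVar u X ξ) (fun v => toE E (decouple E v X' Y η)) u -
    vD E (genVar u X' η) (fun v => toE E (decouple E v X Y ξ)) u

end Variation

/-! ### The generator relations after decoupling -/

section Variation
variable {E : Type*} [NormedAddCommGroup E] [NormedSpace ℝ E] [FiniteDimensional ℝ E]
  {G : Type*} [TopologicalSpace G] [T2Space G] [ChartedSpace E G] [Group G] [LieGroup 𝓘(ℝ, E) ∞ G]
  {n g : ℕ} (u : Hol n g → G) (ξ η : LieAlg E G)

/-- Isolates the derivatives: once b and c are known, what remains is an identity in 𝔤 between
brackets and Ad. -/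
theorem decoupleBr_eq {X X' Y : Hol n g} {a b c d : LieAlg E G}
    (hc : vD E (genVar u X' η) (fun v => toE E (decouple E v X Y ξ)) u = toE E c)
    (hb : vD E (genVar u X ξ) (fun v => toE E (decouple E v X' Y η)) u = toE E b)
    (ha : -⁅decouple E u X Y ξ, decouple E u X' Y η⁆ = a)
    (h : a + b - c = d) : decoupleBr u X X' ξ η Y = toE E d := by
  rw [decoupleBr, hb, hc, ha]
  exact congrArg (toE E) h

theorem decoupleBr_of_prec_left {X X' Y : Hol n g} (h : Prec Y X) (h' : Prec Y X') :
    decoupleBr u X X' ξ η Y = 0 := by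
  refine (decoupleBr_eq u ξ η (a := 0) (b := 0) (c := 0) (d := 0)
    (vD_decouple_of_prec_symm _ _ _ h) (vD_decouple_of_prec_symm _ _ _ h') ?_ (by simp)).trans rfl
  rw [decouple_of_prec_symm u h, zero_apply, zero_lie, neg_zero]

theorem lie_flip (a b : LieAlg E G) : -⁅a, b⁆ = ⁅b, a⁆ := lie_skew b a

/-- Label by label this is the relation {j^X(ξ), j^X(η)} = -j^X([ξ,η]) rewritten in the k^Y. With
the variations of S inserted, it follows from bilinearity and from Ad preserving brackets. -/
theorem decoupleBr_self (X Y : Hol n g) :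
    decoupleBr u X X ξ η Y = toE E (-decouple E u X Y ⁅ξ, η⁆) := by
  rcases prec_trichotomy X Y with h | h | rfl | ⟨i, rfl, rfl⟩ | ⟨i, rfl, rfl⟩
  · rcases Y with i | y
    · refine decoupleBr_eq u ξ η (vD_decouple_of_prec_M _ _ _ h) (vD_decouple_of_prec_M _ _ _ h)
        rfl ?_
      simp only [decouple_of_prec _ h, genVar_self, coanchor, ContinuousLinearMap.comp_apply,
        ContinuousLinearMap.id_apply]
      -- `abel` treats [a,b] and [b,a] as unrelated atoms, so all brackets are first oriented with ξ
      -- on the left; the same is done in the other cases.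
      rw [lie_flip (subAd E (u X) η)]
      simp only [subAd_apply, lie_sub, sub_lie, map_sub, Ad_lie]
      abel
    · refine decoupleBr_eq u ξ η (vD_decouple_of_prec_handle _ _ _ h)
        (vD_decouple_of_prec_handle _ _ _ h) rfl ?_
      simp only [decouple_of_prec _ h, genVar_self, genVar_of_prec _ h, coanchor,
        ContinuousLinearMap.comp_apply]
      rw [lie_flip (subAd E (u X) η), ← lie_skew _ (Ad (u (Sum.inr y)) ξ),
        ← lie_skew _ (Ad (u (Sum.inr y)) (Ad (u X) ξ))]
      simp only [subAd_apply, lie_sub, sub_lie, map_sub, Ad_lie, lie_add, add_lie]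
      abel
  · refine (decoupleBr_of_prec_left u ξ η h h).trans ?_
    rw [decouple_of_prec_symm u h, zero_apply, neg_zero, toE_zero]
  · rcases X with i | i | i
    · refine decoupleBr_eq u ξ η (c := 0) (b := 0) (vD_decouple_M_M _ _ _ i) (vD_decouple_M_M _ _ _ i)
        rfl ?_
      simp only [decouple_M_M, ContinuousLinearMap.id_apply, sub_zero, add_zero]
    · refine decoupleBr_eq u ξ η (vD_decouple_A_A _ _ _ i) (vD_decouple_A_A _ _ _ i) rfl ?_
      simp only [decouple_A_A, genVar_self]
      rw [lie_flip (subAd E _ η)]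
      simp only [subAd_apply, lie_sub, sub_lie, map_sub, Ad_lie]
      abel
    · refine decoupleBr_eq u ξ η (vD_decouple_B_B _ _ _ i) (vD_decouple_B_B _ _ _ i) rfl ?_
      simp only [decouple_B_B, genVar_self]
      rw [lie_flip (subAd E _ η)]
      simp only [subAd_apply, lie_sub, sub_lie, map_sub, Ad_lie]
      abel
  · refine decoupleBr_eq u ξ η (vD_decouple_A_B _ _ _ i) (vD_decouple_A_B _ _ _ i) rfl ?_
    simp only [decouple_A_B, genVar_self, genVar_A_B, sub_apply]
    rw [lie_flip (subAd E _ η), ← lie_skew _ (Ad (u (Hol.B i)) ξ)]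
    simp only [subAd_apply, lie_sub, sub_lie, map_sub, Ad_lie]
    abel
  · refine decoupleBr_eq u ξ η (c := 0) (b := 0) (vD_decouple_B_A _ _ _ i) (vD_decouple_B_A _ _ _ i)
      rfl ?_
    simp only [decouple_B_A, ContinuousLinearMap.id_apply, sub_zero, add_zero]

theorem decoupleBr_A_B (i : Fin g) (Y : Hol n g) :
    decoupleBr u (Hol.A i) (Hol.B i) ξ η Y = toE E (-decouple E u (Hol.B i) Y ⁅ξ, η⁆) := by
  rcases prec_trichotomy (Hol.A i) Y with h | h | rfl | ⟨j, hj, rfl⟩ | ⟨j, hj, rfl⟩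
  · rcases Y with j | y
    · exact absurd h (by simp [Prec])
    · have h' : Prec (Hol.B i : Hol n g) (Sum.inr y) := by simpa [Prec] using h
      refine decoupleBr_eq u ξ η (vD_decouple_of_prec_handle _ _ _ h)
        (vD_decouple_of_prec_handle _ _ _ h') rfl ?_
      simp only [decouple_of_prec _ h, decouple_of_prec _ h', genVar_of_prec _ h,
        genVar_of_prec _ h', genVar_A_B, genVar_B_A, coanchor, ContinuousLinearMap.comp_apply]
      rw [lie_flip η, ← lie_skew _ (Ad (u (Sum.inr y)) ξ),
        ← lie_skew _ (Ad (u (Sum.inr y)) (Ad (u (Hol.A i)) ξ))]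
      simp only [subAd_apply, lie_sub, sub_lie, map_sub, Ad_lie, lie_add, add_lie]
      abel
  · have h' : Prec Y (Hol.B i : Hol n g) := by
      rcases Y with j | j | j <;> simpa [Prec] using h
    refine (decoupleBr_of_prec_left u ξ η h h').trans ?_
    rw [decouple_of_prec_symm u h', zero_apply, neg_zero, toE_zero]
  · refine decoupleBr_eq u ξ η (b := 0) (vD_decouple_A_A _ _ _ i) (vD_decouple_B_A _ _ _ i)
      rfl ?_
    simp only [decouple_A_A, decouple_B_A, genVar_B_A, ContinuousLinearMap.id_apply, add_zero]
    rw [lie_flip η]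
    simp only [subAd_apply, lie_sub, sub_lie]
    abel
  · obtain rfl : i = j := by simpa using hj
    refine decoupleBr_eq u ξ η (vD_decouple_A_B _ _ _ i) (vD_decouple_B_B _ _ _ i) rfl ?_
    simp only [decouple_A_B, decouple_B_B, genVar_self, genVar_A_B, genVar_B_A, sub_apply]
    rw [lie_flip η, ← lie_skew _ (Ad (u (Hol.B i)) ξ)]
    simp only [subAd_apply, lie_sub, sub_lie, map_sub, Ad_lie]
    abel
  · simp at hj

theorem decoupleBr_of_prec {X X' : Hol n g} (h : Prec X X') (Y : Hol n g) :
    decoupleBr u X X' ξ η Y = toE E (-decouple E u X' Y ⁅subAd E (u X) ξ, η⁆) := by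
  -- The larger generator does not move the smaller holonomy, so S_{XY} varies under j^{X'} only
  -- through u_Y.
  have hX0 : genVar u X' η X = 0 := genVar_of_prec_symm u h η
  rcases prec_trichotomy X' Y with h' | h' | rfl | ⟨i, rfl, rfl⟩ | ⟨i, rfl, rfl⟩
  · have hXY := h.trans h'
    rcases Y with i | y
    · refine decoupleBr_eq u ξ η (vD_decouple_of_prec_M _ _ _ hXY)
        (vD_decouple_of_prec_M _ _ _ h') rfl ?_
      simp only [decouple_of_prec _ hXY, decouple_of_prec _ h', genVar_of_prec _ h, hX0, coanchor,
        ContinuousLinearMap.comp_apply, ContinuousLinearMap.id_apply]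
      simp only [subAd_apply, lie_sub, sub_lie, map_sub, Ad_lie, zero_lie]
      abel
    · refine decoupleBr_eq u ξ η (vD_decouple_of_prec_handle _ _ _ hXY)
        (vD_decouple_of_prec_handle _ _ _ h') rfl ?_
      simp only [decouple_of_prec _ hXY, decouple_of_prec _ h', genVar_of_prec _ h,
        genVar_of_prec _ h', genVar_of_prec _ hXY, hX0, coanchor,
        ContinuousLinearMap.comp_apply]
      rw [← lie_skew _ (Ad (u (Sum.inr y)) ξ),
        ← lie_skew _ (Ad (u (Sum.inr y)) (Ad (u X) ξ))]
      simp only [subAd_apply, lie_sub, sub_lie, map_sub, Ad_lie, lie_add, add_lie, zero_lie, map_zero,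
        lie_zero]
      abel
  · have hY0 : genVar u X' η Y = 0 := genVar_of_prec_symm u h' η
    refine decoupleBr_eq u ξ η (b := 0) (c := 0) (vD_decouple_eq_zero _ _ _ hX0 hY0)
      (vD_decouple_of_prec_symm _ _ _ h') rfl ?_
    rw [decouple_of_prec_symm u h']; simp
  · rcases X' with i | i | i
    · refine decoupleBr_eq u ξ η (b := 0) (vD_decouple_of_prec_M _ _ _ h) (vD_decouple_M_M _ _ _ i)
        rfl ?_
      rw [hX0]
      simp only [decouple_M_M, decouple_of_prec _ h, coanchor, ContinuousLinearMap.comp_apply,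
        ContinuousLinearMap.id_apply, zero_lie, neg_zero, sub_zero, add_zero]
    · refine decoupleBr_eq u ξ η (vD_decouple_of_prec_handle _ _ _ h) (vD_decouple_A_A _ _ _ i)
        rfl ?_
      rw [hX0]
      simp only [decouple_A_A, decouple_of_prec _ h, genVar_of_prec _ h, genVar_self, coanchor,
        ContinuousLinearMap.comp_apply]
      rw [← lie_skew _ (Ad (u (Hol.A i)) ξ), ← lie_skew _ (Ad (u (Hol.A i)) (Ad (u X) ξ))]
      simp only [subAd_apply, lie_sub, sub_lie, map_sub, Ad_lie, lie_add, add_lie, zero_lie, map_zero,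
        lie_zero]
      abel
    · refine decoupleBr_eq u ξ η (vD_decouple_of_prec_handle _ _ _ h) (vD_decouple_B_B _ _ _ i)
        rfl ?_
      rw [hX0]
      simp only [decouple_B_B, decouple_of_prec _ h, genVar_of_prec _ h, genVar_self, coanchor,
        ContinuousLinearMap.comp_apply]
      rw [← lie_skew _ (Ad (u (Hol.B i)) ξ), ← lie_skew _ (Ad (u (Hol.B i)) (Ad (u X) ξ))]
      simp only [subAd_apply, lie_sub, sub_lie, map_sub, Ad_lie, lie_add, add_lie, zero_lie, map_zero,
        lie_zero]
      abel
  · have hB : Prec X (Hol.B i) := by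
      rcases X with j | j | j <;> simpa [Prec] using h
    refine decoupleBr_eq u ξ η (vD_decouple_of_prec_handle _ _ _ hB) (vD_decouple_A_B _ _ _ i)
      rfl ?_
    rw [hX0]
    simp only [decouple_A_B, decouple_of_prec _ hB, genVar_of_prec _ h, genVar_of_prec _ hB,
      genVar_A_B, coanchor, ContinuousLinearMap.comp_apply, sub_apply]
    rw [← lie_skew _ (Ad (u (Hol.B i)) ξ), ← lie_skew _ (Ad (u (Hol.B i)) (Ad (u X) ξ))]
    simp only [subAd_apply, lie_sub, sub_lie, map_sub, Ad_lie, lie_add, add_lie, zero_lie, map_zero,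
      lie_zero]
    abel
  · have hA : Prec X (Hol.A i) := by
      rcases X with j | j | j <;> simpa [Prec] using h
    refine decoupleBr_eq u ξ η (b := 0) (vD_decouple_of_prec_handle _ _ _ hA) (vD_decouple_B_A _ _ _ i)
      rfl ?_
    rw [hX0]
    simp only [decouple_B_A, decouple_of_prec _ hA, genVar_B_A, coanchor,
      ContinuousLinearMap.comp_apply, ContinuousLinearMap.id_apply]
    rw [← lie_skew _ (Ad (u (Hol.A i)) ξ), ← lie_skew _ (Ad (u (Hol.A i)) (Ad (u X) ξ))]
    simp only [subAd_apply, lie_sub, sub_lie, map_sub, Ad_lie, lie_add, add_lie, zero_lie, map_zero,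
      lie_zero]
    abel

end Variation

theorem IsSkewBider.sum_mul_sum {P : Type*} [CommRing P] [Algebra ℝ P] {br : P → P → P}
    (hS : IsSkewBider br) {ι : Type*} [Fintype ι] (f k x : ι → P) (h : ∀ p q, br (f p) (k q) = 0) :
    br (∑ p, f p * x p) (∑ q, k q * x q) =
      ∑ q, (∑ p, f p * br (x p) (k q)) * x q + (∑ p, ∑ q, f p * k q * br (x p) (x q)) -
        ∑ p, (∑ q, k q * br (x q) (f p)) * x p := by
  have h1 : ∀ p q, br (f p * x p) (k q * x q) = f p * br (x p) (k q) * x q +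
      f p * k q * br (x p) (x q) - k q * br (x q) (f p) * x p := fun p q => by
    rw [hS.leibniz, hS.leibniz_left, hS.leibniz_left, h, hS.skew (f p) (x q)]
    ring
  rw [hS.sum_left]
  simp only [hS.sum_right, h1, Finset.sum_add_distrib, Finset.sum_sub_distrib, Finset.sum_mul]
  congr 2
  exact Finset.sum_comm

/-! ### The decoupling homomorphism -/

section Decoupling
variable {E : Type*} [NormedAddCommGroup E] [NormedSpace ℝ E] [FiniteDimensional ℝ E]
  {G : Type*} [TopologicalSpace G] [T2Space G] [ChartedSpace E G] [Group G] [LieGroup 𝓘(ℝ, E) ∞ G]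
  {n g : ℕ} {κ : Type*} [Fintype κ] [DecidableEq κ] (J : Module.Basis κ ℝ (LieAlg E G))

theorem lin_neg (s : Hol n g → FnE E G n g) : lin J (fun Y => -s Y) = -lin J s := by
  rw [lin, lin, ← Finset.sum_neg_distrib]
  refine Finset.sum_congr rfl fun p _ => ?_
  have h : compFn J p.2 (-s p.1) = -compFn J p.2 (s p.1) :=
    ContMDiffMap.ext fun u => map_neg (coordCLM E J p.2) (s p.1 u)
  rw [h, map_neg, neg_mul]

theorem sum_coord_smul (v : E) : ∑ a, coordCLM E J a v • toE E (J a) = v := sum_repr_smul J v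

theorem sum_C_mul_lin {ι : Type*} (t : Finset ι) (f : ι → Fn E G n g)
    (s : ι → Hol n g → FnE E G n g) (r : Hol n g → FnE E G n g)
    (h : ∀ Y u, r Y u = ∑ i ∈ t, f i u • s i Y u) :
    ∑ i ∈ t, C (f i) * lin J (s i) = lin J r := by
  simp only [lin, Finset.mul_sum]
  rw [Finset.sum_comm]
  refine Finset.sum_congr rfl fun p _ => ?_
  simp only [← mul_assoc, ← map_mul]
  rw [← Finset.sum_mul, ← map_sum]
  congr 2
  ext u
  rw [Fn_sum_apply, compFn_apply, h, map_sum]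
  exact Finset.sum_congr rfl fun i _ => (map_smul (coordCLM E J p.2) (f i u) (s i p.1 u)).symm

/-- The change of generators `j^X(ξ) ↦ ∑_Y k^Y(S_{XY} ξ)`. -/
def decoupleHom : FlowerAlg E G n g κ →ₐ[Fn E G n g] FlowerAlg E G n g κ :=
  aeval fun p => lin J fun Y => decoupleFn p.1 Y (constE n g (J p.2))

theorem decoupleHom_X (X' : Hol n g) (a : κ) : decoupleHom J (X (X', a)) =
    lin J fun Y => decoupleFn X' Y (constE n g (J a)) := aeval_X _ _

theorem decoupleHom_C (F : Fn E G n g) :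
    decoupleHom J (C F : FlowerAlg E G n g κ) = C F := aeval_C _ _

theorem decoupleHom_jv (Z : Hol n g) (s : FnE E G n g) :
    decoupleHom J (jv J Z s) = lin J fun Y => decoupleFn Z Y s := by
  rw [jv, map_sum]
  simp only [map_mul, decoupleHom_C]
  simp only [gen, decoupleHom_X]
  refine sum_C_mul_lin J _ _ _ _ fun Y u => ?_
  show toE E (decouple E u Z Y (s u)) = ∑ b, coordCLM E J b (s u) • toE E (decouple E u Z Y (J b))
  have h := congrArg (decouple E u Z Y) (sum_repr_smul J (s u)).symm
  rw [map_sum] at h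
  refine (congrArg (toE E) h).trans ?_
  refine Finset.sum_congr rfl fun b _ => ?_
  exact congrArg (toE E) (map_smul (decouple E u Z Y) _ _)

theorem decBracket_lin_C (s : Hol n g → FnE E G n g) (F : Fn E G n g) :
    decBracket J (lin J s) (C F) = C (∑ p, compFn J p.2 (s p.1) * anchorField J p F) := by
  have hS := isSkewBider_decBracket (n := n) (g := g) J
  rw [lin, hS.sum_left, map_sum]
  refine Finset.sum_congr rfl fun p _ => ?_
  rw [hS.leibniz_left, decBracket_C_C, decBracket_X_C, zero_mul, zero_add, map_mul]

theorem sum_compFn_anchorField_apply (s : Hol n g → FnE E G n g) (F : Fn E G n g)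
    (u : Hol n g → G) : (∑ p, compFn J p.2 (s p.1) * anchorField J p F) u =
      vD E (fun Y => anchor E u Y (s Y u)) F u := by
  rw [Fn_sum_apply, Fintype.sum_prod_type, vD]
  refine Finset.sum_congr rfl fun Y _ => ?_
  have h1 : ∀ c, (compFn J c (s Y) * anchorField J (Y, c) F) u =
      J.repr (s Y u) c * pd E Y F u (anchor E u Y (J c)) := fun c =>
    congrArg (fun r : ℝ => coordCLM E J c (s Y u) * r) (anchorField_apply J (Y, c) F u)
  simp only [h1]
  rw [sum_mul_clm]
  exact congrArg (fun v : LieAlg E G => pd E Y F u (anchor E u Y v)) (sum_repr_smul J (s Y u))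

theorem sum_diagBracket (s t : Hol n g → FnE E G n g) :
    ∑ p : Hol n g × κ, ∑ q : Hol n g × κ, C (compFn J p.2 (s p.1)) * C (compFn J q.2 (t q.1)) *
      diagBracket J p q = -∑ r : Hol n g × κ, C (∑ a, ∑ b, compFn J a (s r.1) * compFn J b (t r.1) *
        algebraMap ℝ (Fn E G n g) (J.repr ⁅J a, J b⁆ r.2)) * X r := by
  have h1 : ∀ (Y : Hol n g) (a : κ), ∑ q : Hol n g × κ, C (compFn J a (s Y)) *
      C (compFn J q.2 (t q.1)) * diagBracket J (Y, a) q =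
      -∑ b, C (compFn J a (s Y)) * C (compFn J b (t Y)) * jv J Y (constE n g ⁅J a, J b⁆) := by
    intro Y a
    rw [Fintype.sum_prod_type, Finset.sum_eq_single Y, ← Finset.sum_neg_distrib]
    · refine Finset.sum_congr rfl fun b _ => ?_
      rw [diagBracket, if_pos rfl, mul_neg]
    · intro Z _ hZ
      refine Finset.sum_eq_zero fun b _ => ?_
      rw [diagBracket, if_neg (Ne.symm hZ), mul_zero]
    · simp
  rw [Fintype.sum_prod_type, Fintype.sum_prod_type, ← Finset.sum_neg_distrib]
  refine Finset.sum_congr rfl fun Y _ => ?_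
  simp only [h1, Finset.sum_neg_distrib, jv_const, smul_eq_C_mul', Finset.mul_sum]
  congr 1
  simp only [map_sum, Finset.sum_mul, map_mul]
  rw [Finset.sum_comm' (t' := Finset.univ) (s' := fun _ => Finset.univ) (by simp)]
  rw [Finset.sum_congr rfl fun b _ => Finset.sum_comm]
  rw [Finset.sum_comm]
  refine Finset.sum_congr rfl fun c _ => ?_
  rw [Finset.sum_comm]
  refine Finset.sum_congr rfl fun a _ => Finset.sum_congr rfl fun b _ => ?_
  simp only [mul_assoc]

variable (G) in
/-- The Lie bracket on the model space. -/
def brE (ξ η : E) : E := toE E (⁅(show LieAlg E G from ξ), (show LieAlg E G from η)⁆ : LieAlg E G)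

theorem coord_brE (ξ η : E) (c : κ) : ∑ a, ∑ b, coordCLM E J a ξ * coordCLM E J b η *
    J.repr ⁅J a, J b⁆ c = coordCLM E J c (brE G ξ η) := by
  set ξ' : LieAlg E G := ξ
  set η' : LieAlg E G := η
  show ∑ a, ∑ b, J.repr ξ' a * J.repr η' b * J.repr ⁅J a, J b⁆ c = J.repr ⁅ξ', η'⁆ c
  conv_rhs => rw [← sum_repr_smul J ξ', ← sum_repr_smul J η', sum_lie]
  rw [map_sum, Finset.sum_apply']
  refine Finset.sum_congr rfl fun a _ => ?_
  rw [lie_sum, map_sum, Finset.sum_apply']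
  refine Finset.sum_congr rfl fun b _ => ?_
  rw [smul_lie, lie_smul, map_smul, map_smul, Finsupp.smul_apply, Finsupp.smul_apply, smul_eq_mul,
    smul_eq_mul, mul_assoc]

theorem vD_compFn (β : Hol n g → LieAlg E G) (c : κ) (s : FnE E G n g) (u : Hol n g → G) :
    vD E β (compFn J c s) u = coordCLM E J c (vD E β s u) :=
  vD_clm_comp (coordCLM E J c) s.contMDiff u

/-- Linear elements bracket like sections of an action Lie algebroid: minus the pointwise bracket,
plus the derivative of t along s, minus that of s along t. The Leibniz rule yields these three sums.
-/
theorem decBracket_lin_lin (s t r : Hol n g → FnE E G n g)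
    (h : ∀ Y u, r Y u = -brE G (s Y u) (t Y u) + vD E (fun Z => anchor E u Z (s Z u)) (t Y) u -
      vD E (fun Z => anchor E u Z (t Z u)) (s Y) u) :
    decBracket J (lin J s) (lin J t) = lin J r := by
  have hS := isSkewBider_decBracket (n := n) (g := g) J
  have h3 : decBracket J (lin J s) (lin J t) =
      ∑ q, C (∑ p, compFn J p.2 (s p.1) * anchorField J p (compFn J q.2 (t q.1))) * X q +
      (∑ p : Hol n g × κ, ∑ q : Hol n g × κ, C (compFn J p.2 (s p.1)) * C (compFn J q.2 (t q.1)) *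
        diagBracket J p q) -
      ∑ p, C (∑ q, compFn J q.2 (t q.1) * anchorField J q (compFn J p.2 (s p.1))) * X p := by
    refine (hS.sum_mul_sum (fun p : Hol n g × κ => C (compFn J p.2 (s p.1)))
      (fun q : Hol n g × κ => C (compFn J q.2 (t q.1))) (fun p => X p)
      fun p q => decBracket_C_C J (compFn J p.2 (s p.1)) (compFn J q.2 (t q.1))).trans ?_
    simp only [decBracket_X_C, decBracket_X_X, map_sum, map_mul]
  rw [h3, sum_diagBracket, lin, ← Finset.sum_neg_distrib, ← Finset.sum_add_distrib,
    ← Finset.sum_sub_distrib]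
  refine Finset.sum_congr rfl fun p _ => ?_
  rw [← neg_mul, ← add_mul, ← sub_mul, ← map_neg, ← map_add, ← map_sub]
  congr 2
  ext u
  rw [compFn_apply, h]
  have h4 : (∑ a, ∑ b, compFn J a (s p.1) * compFn J b (t p.1) *
      algebraMap ℝ (Fn E G n g) (J.repr ⁅J a, J b⁆ p.2)) u =
      coordCLM E J p.2 (brE G (s p.1 u) (t p.1 u)) := by
    rw [← coord_brE]
    simp only [Fn_sum_apply]
    rfl
  rw [map_sub, map_add, map_neg, ← h4, ← vD_compFn J, ← vD_compFn J, ← sum_compFn_anchorField_apply J,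
    ← sum_compFn_anchorField_apply J, add_comm (-_)]
  rfl

/-- Reduces a relation between two generators to the pointwise identities for `decoupleBr`. -/
theorem decBracket_decoupleHom (X₁ X₂ Z : Hol n g) (a b : κ) (r : FnE E G n g)
    (h : ∀ Y u, decoupleBr u X₁ X₂ (J a) (J b) Y = toE E (-decouple E u Z Y (r u))) :
    decoupleHom J (-jv J Z r) = decBracket J (decoupleHom J (X (X₁, a))) (decoupleHom J (X (X₂, b))) := by
  rw [map_neg, decoupleHom_jv, ← lin_neg, decoupleHom_X, decoupleHom_X]
  exact (decBracket_lin_lin J _ _ _ fun Y u => (h Y u).symm).symm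

end Decoupling

/-! ### Injectivity of the decoupling and the Jacobi identity of the flower algebra -/

section Jacobi
variable {E : Type*} [NormedAddCommGroup E] [NormedSpace ℝ E] [FiniteDimensional ℝ E]
  {G : Type*} [TopologicalSpace G] [T2Space G] [ChartedSpace E G] [Group G] [LieGroup 𝓘(ℝ, E) ∞ G]
  {n g : ℕ} {κ : Type*} [Fintype κ] [DecidableEq κ] (J : Module.Basis κ ℝ (LieAlg E G))

theorem decoupleHom_genBracket (p q : Hol n g × κ) :
    decoupleHom J (genBracket J p q) =
      decBracket J (decoupleHom J (X p)) (decoupleHom J (X q)) := by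
  obtain ⟨X₁, a⟩ := p
  obtain ⟨X₂, b⟩ := q
  have hS := isSkewBider_decBracket (n := n) (g := g) J
  have hprec : ∀ (X₁ X₂ : Hol n g) (a b : κ), Prec X₁ X₂ → decoupleHom J
      (genBracket J (X₁, a) (X₂, b)) =
        decBracket J (decoupleHom J (X (X₁, a))) (decoupleHom J (X (X₂, b))) := by
    intro X₁ X₂ a b h
    have hs : ContMDiff (piModel (Hol n g) E) 𝓘(ℝ, E) ∞
        (fun u : Hol n g → G => toE E (⁅subAd E (u X₁) (J a), J b⁆ : LieAlg E G)) := by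
      have h1 := contMDiff_subAd_const (E := E) (contMDiff_proj (M := G) X₁) (J a)
      have h2 := (LinearMap.toContinuousLinearMap
        (-(LieAlgebra.ad ℝ (LieAlg E G) (J b)) : LieAlg E G →ₗ[ℝ] LieAlg E G) : E →L[ℝ] E).contMDiff.comp h1
      refine h2.congr fun u => ?_
      exact congrArg (toE E) (lie_skew (subAd E (u X₁) (J a)) (J b)).symm
    rw [genBracket_of_prec J h a b ⟨_, hs⟩ fun u => rfl]
    exact decBracket_decoupleHom J X₁ X₂ X₂ a b _ fun Y u => decoupleBr_of_prec u _ _ h Y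
  have hAB : ∀ (i : Fin g) (a b : κ), decoupleHom J
      (genBracket J ((Hol.A i : Hol n g), a) (Hol.B i, b)) =
        decBracket J (decoupleHom J (X (Hol.A i, a))) (decoupleHom J (X (Hol.B i, b))) := by
    intro i a b
    rw [genBracket_A_B]
    exact decBracket_decoupleHom J _ _ _ a b _ fun Y u => decoupleBr_A_B u _ _ i Y
  rcases prec_trichotomy X₁ X₂ with h | h | rfl | ⟨i, rfl, rfl⟩ | ⟨i, rfl, rfl⟩
  · exact hprec _ _ _ _ h
  · rw [genBracket_symm, map_neg, hprec _ _ _ _ h, ← hS.skew]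
  · rw [genBracket_self]
    exact decBracket_decoupleHom J _ _ _ a b _ fun Y u => decoupleBr_self u _ _ X₁ Y
  · exact hAB i a b
  · rw [genBracket_symm, map_neg, hAB, ← hS.skew]

theorem decoupleHom_bracket (φ ψ : FlowerAlg E G n g κ) :
    decoupleHom J (bracket J φ ψ) = decBracket J (decoupleHom J φ) (decoupleHom J ψ) := by
  refine map_br_of_X_C (isSkewBider_bracket J) (isSkewBider_decBracket J)
    (decoupleHom J : FlowerAlg E G n g κ →ₐ[Fn E G n g] FlowerAlg E G n g κ).toRingHom
    (fun F F' => ?_) (fun p F => ?_) (fun p q => ?_) φ ψ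
  · show decoupleHom J (bracket J _ _) = decBracket J (decoupleHom J _) (decoupleHom J _)
    rw [bracket_C_C, decoupleHom_C, decoupleHom_C, decBracket_C_C, map_zero]
  · obtain ⟨X₁, a⟩ := p
    show decoupleHom J (bracket J (gen X₁ a) _) = decBracket J (decoupleHom J _) (decoupleHom J _)
    rw [bracket_gen_C, decoupleHom_C, decoupleHom_C, decoupleHom_X, decBracket_lin_C]
    congr 1
    ext u
    rw [genField_apply]
    exact (sum_compFn_anchorField_apply J (fun Y => decoupleFn X₁ Y (constE n g (J a))) F u).symm
  · show decoupleHom J (bracket J _ _) = decBracket J (decoupleHom J _) (decoupleHom J _)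
    rw [bracket_gen_gen, decoupleHom_genBracket]

/-- S is block triangular for the order of the holonomies: the blocks of the M_i are identities and
each handle contributes an invertible 2 × 2 block. Induction along the order kills the components
one block at a time. -/
theorem decouple_injective (u : Hol n g → G) (ξ : Hol n g → LieAlg E G)
    (h : ∀ Y, ∑ X, decouple E u X Y (ξ X) = 0) : ξ = 0 := by
  classical
  have hwf : WellFounded (Prec : Hol n g → Hol n g → Prop) := by
    have : IsTrans (Hol n g) Prec := ⟨fun _ _ _ => Prec.trans⟩
    have : Std.Irrefl (Prec : Hol n g → Hol n g → Prop) := ⟨Prec.irrefl⟩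
    exact Finite.wellFounded_of_trans_of_irrefl _
  have hAB : ∀ i, (∀ Z, Prec Z (Hol.A i) → ξ Z = 0) → ξ (Hol.A i) = 0 ∧ ξ (Hol.B i) = 0 := by
    intro i hZ
    have hsum : ∀ Y, (Y = Hol.A i ∨ Y = Hol.B i) →
        decouple E u (Hol.A i) Y (ξ (Hol.A i)) + decouple E u (Hol.B i) Y (ξ (Hol.B i)) = 0 := by
      intro Y hY
      rw [← h Y, Fintype.sum_eq_add (Hol.A i) (Hol.B i) (by simp)]
      rintro X ⟨hXA, hXB⟩
      rcases prec_trichotomy X (Hol.A i) with h' | h' | h' | ⟨j, h', h''⟩ | ⟨j, h', h''⟩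
      · rw [hZ X h', map_zero]
      · rw [decouple_of_prec_symm, zero_apply]
        rcases hY with rfl | rfl
        · exact h'
        · rcases X with j | j | j <;> simpa [Prec] using h'
      · exact absurd h' hXA
      · simp at h''
      · obtain rfl : i = j := by simpa using h''
        exact absurd h' hXB
    have h1 := hsum _ (Or.inl rfl)
    have h2 := hsum _ (Or.inr rfl)
    simp only [decouple_A_A, decouple_B_A, decouple_A_B, decouple_B_B, sub_apply, subAd_apply,
      ContinuousLinearMap.id_apply] at h1 h2
    -- With a and b the components at A_i and B_i, the first equation gives b = (Ad(u_A)-1)a;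
    -- inserted into the second it leaves Ad(u_B)Ad(u_A)a = 0.
    have h3 : ξ (Hol.B i) = Ad (u (Hol.A i)) (ξ (Hol.A i)) - ξ (Hol.A i) := by
      rw [← sub_eq_zero, ← h1]; abel
    have h4 : Ad (u (Hol.B i)) (Ad (u (Hol.A i)) (ξ (Hol.A i))) = 0 := by
      rw [h3, map_sub] at h2
      rw [← neg_eq_zero, ← h2]; abel
    have h5 : ξ (Hol.A i) = 0 := by
      have h6 := congrArg (fun v => Ad (u (Hol.A i))⁻¹ (Ad (u (Hol.B i))⁻¹ v)) h4
      simpa only [Ad_inv_Ad, map_zero] using h6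
    exact ⟨h5, by rw [h3, h5, map_zero, sub_zero]⟩
  ext1 X
  induction X using hwf.induction with
  | _ X ih =>
  rcases X with i | i | i
  · have h1 := h (Hol.M i)
    rw [Fintype.sum_eq_single (Hol.M i), decouple_M_M] at h1
    · exact h1
    · intro X hX
      rcases prec_trichotomy X (Hol.M i) with h' | h' | h' | ⟨j, h', h''⟩ | ⟨j, h', h''⟩
      · rw [ih X h']; exact map_zero _
      · rw [decouple_of_prec_symm _ h', zero_apply]
      · exact absurd h' hX
      · simp at h''
      · simp at h''
  · exact (hAB i ih).1
  · exact (hAB i fun Z hZ => ih Z (by rcases Z with j | j | j <;> simpa [Prec] using hZ)).2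

/-- Evaluation of the coefficients at `u` and of the variables at `p`. -/
def evalPt (u : Hol n g → G) (p : Hol n g × κ → ℝ) : FlowerAlg E G n g κ →+* ℝ :=
  eval₂Hom (ContMDiffMap.evalRingHom (I := piModel (Hol n g) E) (n := ∞) u) p

theorem evalPt_C (u : Hol n g → G) (p : Hol n g × κ → ℝ) (F : Fn E G n g) :
    evalPt u p (C F) = F u := eval₂Hom_C _ _ _

theorem evalPt_X (u : Hol n g → G) (p : Hol n g × κ → ℝ) (q : Hol n g × κ) :
    evalPt (E := E) u p (X q) = p q := eval₂Hom_X' _ _ _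

/-- At each u a real polynomial that vanishes at all points is zero, since ℝ is infinite. -/
theorem eq_zero_of_evalPt {φ : FlowerAlg E G n g κ} (h : ∀ u p, evalPt u p φ = 0) : φ = 0 := by
  ext m u
  have h1 : MvPolynomial.map (ContMDiffMap.evalRingHom (I := piModel (Hol n g) E) (n := ∞) u) φ = 0 := by
    refine MvPolynomial.funext fun p => ?_
    rw [map_zero, eval_map]
    exact h u p
  have h2 := congrArg (coeff m) h1
  rw [coeff_map] at h2
  exact h2

/-- The matrix of the change of generators at `u`. -/
def decoupleMatrix (u : Hol n g → G) : Matrix (Hol n g × κ) (Hol n g × κ) ℝ :=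
  fun p q => coordCLM E J q.2 (decouple E u p.1 q.1 (J p.2))

theorem evalPt_decoupleHom (u : Hol n g → G) (p : Hol n g × κ → ℝ) (φ : FlowerAlg E G n g κ) :
    evalPt u p (decoupleHom J φ) = evalPt u ((decoupleMatrix J u).mulVec p) φ := by
  have h : (evalPt u p).comp (decoupleHom J :
      FlowerAlg E G n g κ →ₐ[Fn E G n g] FlowerAlg E G n g κ).toRingHom =
      evalPt u ((decoupleMatrix J u).mulVec p) := by
    refine MvPolynomial.ringHom_ext (fun F => ?_) fun q => ?_
    · show evalPt u p (decoupleHom J (C F)) = _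
      rw [decoupleHom_C, evalPt_C, evalPt_C]
    · obtain ⟨X₁, a⟩ := q
      show evalPt u p (decoupleHom J (X (X₁, a))) = _
      rw [decoupleHom_X, evalPt_X, lin, map_sum]
      refine Finset.sum_congr rfl fun q _ => ?_
      rw [map_mul, evalPt_C, evalPt_X]
      rfl
  exact congrArg (fun f : FlowerAlg E G n g κ →+* ℝ => f φ) h

theorem isUnit_decoupleMatrix (u : Hol n g → G) : IsUnit (decoupleMatrix J u) := by
  rw [← Matrix.vecMul_injective_iff_isUnit]
  refine (injective_iff_map_eq_zero (Matrix.vecMulLinear (decoupleMatrix J u))).2 fun c hc => ?_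
  have h1 := decouple_injective u (fun X => ∑ a, c (X, a) • J a) fun Y => by
    apply J.repr.injective
    ext b
    have h2 := congrFun hc (Y, b)
    rw [map_zero, Finsupp.zero_apply]
    refine Eq.trans ?_ h2
    show J.repr _ b = ∑ p, c p * coordCLM E J b (decouple E u p.1 Y (J p.2))
    rw [map_sum, Finset.sum_apply', Fintype.sum_prod_type]
    refine Finset.sum_congr rfl fun X _ => ?_
    rw [map_sum, map_sum, Finset.sum_apply']
    refine Finset.sum_congr rfl fun a _ => ?_
    rw [map_smul, map_smul]; rfl
  ext ⟨X, a⟩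
  have h2 : ∑ a, c (X, a) • J a = 0 := congrFun h1 X
  exact Fintype.linearIndependent_iff.1 J.linearIndependent _ h2 a

/-- At each fixed u the substitution is an invertible linear change of real variables, so every
evaluation point is reached. Smoothness of the inverse matrix in u is not needed. -/
theorem decoupleHom_injective :
    Function.Injective (decoupleHom J : FlowerAlg E G n g κ → FlowerAlg E G n g κ) := by
  refine (injective_iff_map_eq_zero (decoupleHom J)).2 fun φ hφ => eq_zero_of_evalPt fun u p => ?_
  obtain ⟨p', rfl⟩ := Matrix.mulVec_surjective_iff_isUnit.2 (isUnit_decoupleMatrix J u) p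
  rw [← evalPt_decoupleHom, hφ, map_zero]

theorem jac_bracket (x y z : FlowerAlg E G n g κ) : IsSkewBider.jac (bracket J) x y z = 0 := by
  apply decoupleHom_injective J
  have h := jac_decBracket J (decoupleHom J x) (decoupleHom J y) (decoupleHom J z)
  simp only [IsSkewBider.jac, ← decoupleHom_bracket, ← map_add] at h
  rw [map_zero]; exact h

theorem isPoissonBracket_bracket :
    IsPoissonBracket (bracket J : FlowerAlg E G n g κ → FlowerAlg E G n g κ → _) where
  add_left := (isSkewBider_bracket J).add_left
  smul_left := (isSkewBider_bracket J).smul_left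
  skew := (isSkewBider_bracket J).skew
  leibniz := (isSkewBider_bracket J).leibniz
  jacobi := jac_bracket J

end Jacobi

/-! ### Equivariance under simultaneous conjugation -/

section Equivariance
variable {E : Type*} [NormedAddCommGroup E] [NormedSpace ℝ E] [FiniteDimensional ℝ E]
  {G : Type*} [TopologicalSpace G] [T2Space G] [ChartedSpace E G] [Group G] [LieGroup 𝓘(ℝ, E) ∞ G]
  {V : Type*} [NormedAddCommGroup V] [NormedSpace ℝ V] {n g : ℕ}

theorem conjAll_apply (h : G) (u : Hol n g → G) (X : Hol n g) :
    conjAll (E := E) h u X = h * u X * h⁻¹ := rfl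

theorem subAd_conj (h v : G) (ξ : LieAlg E G) :
    subAd E (h * v * h⁻¹) (Ad h ξ) = Ad h (subAd E v ξ) := by
  simp only [subAd_apply, Ad_mul, ContinuousLinearMap.comp_apply, Ad_inv_Ad, map_sub]

theorem anchor_conjAll (h : G) (u : Hol n g → G) (Y : Hol n g) (ξ : LieAlg E G) :
    anchor E (conjAll (E := E) h u) Y (Ad h ξ) = Ad h (anchor E u Y ξ) := by
  rcases Y with i | y
  · exact subAd_conj h _ ξ
  · rfl

theorem coanchor_conjAll (h : G) (u : Hol n g → G) (Y : Hol n g) (ξ : LieAlg E G) :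
    coanchor E (conjAll (E := E) h u) Y (Ad h ξ) = Ad h (coanchor E u Y ξ) := by
  rcases Y with i | y
  · rfl
  · exact subAd_conj h _ ξ

theorem decouple_conjAll (h : G) (u : Hol n g → G) (X Y : Hol n g) (ξ : LieAlg E G) :
    decouple E (conjAll (E := E) h u) X Y (Ad h ξ) = Ad h (decouple E u X Y ξ) := by
  rcases prec_trichotomy X Y with h' | h' | rfl | ⟨i, rfl, rfl⟩ | ⟨i, rfl, rfl⟩
  · simp only [decouple_of_prec _ h', ContinuousLinearMap.comp_apply, conjAll_apply, subAd_conj,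
      coanchor_conjAll]
  · simp only [decouple_of_prec_symm _ h', zero_apply, map_zero]
  · rcases X with i | i | i
    · simp only [decouple_M_M, ContinuousLinearMap.id_apply]
    · simp only [decouple_A_A, conjAll_apply, subAd_conj]
    · simp only [decouple_B_B, conjAll_apply, subAd_conj]
  · simp only [decouple_A_B, sub_apply, conjAll_apply, subAd_conj, map_sub, Ad_mul,
      ContinuousLinearMap.comp_apply, Ad_inv_Ad]
  · simp only [decouple_B_A, ContinuousLinearMap.id_apply]

theorem genVar_conjAll (h : G) (u : Hol n g → G) (X Y : Hol n g) (ξ : LieAlg E G) :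
    genVar (conjAll (E := E) h u) X (Ad h ξ) Y = Ad h (genVar u X ξ Y) := by
  rw [genVar, decouple_conjAll, anchor_conjAll]; rfl

theorem conjAll_move (h : G) (u : Hol n g → G) (Y : Hol n g) (y : G) :
    conjAll (E := E) h (update u Y (y * u Y)) =
      update (conjAll (E := E) h u) Y ((h * y * h⁻¹) * conjAll (E := E) h u Y) := by
  ext1 Z
  by_cases hZ : Z = Y
  · subst hZ
    simp only [conjAll_apply, update_self]
    group
  · simp only [conjAll_apply, update_of_ne hZ]

theorem pd_comp_conjAll (h : G) (Y : Hol n g) {F : (Hol n g → G) → V}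
    (hF : ContMDiff (piModel (Hol n g) E) 𝓘(ℝ, V) ∞ F) (u : Hol n g → G) (ζ : LieAlg E G) :
    pd E Y (fun u => F (conjAll (E := E) h u)) u ζ =
      pd E Y F (conjAll (E := E) h u) (AdE E h ζ) := by
  set w := conjAll (E := E) h u
  have h1 : ∀ p : G, p = 1 → HasMFDerivAt 𝓘(ℝ, E) 𝓘(ℝ, V)
      (fun y : G => F (update w Y (y * w Y))) p (pd E Y F w : E →L[ℝ] V) := by
    rintro p rfl
    exact hasMFDerivAt_pd Y hF w
  have h2 : HasMFDerivAt 𝓘(ℝ, E) 𝓘(ℝ, E) (fun y : G => h * y * h⁻¹) 1 (AdE E h : E →L[ℝ] E) :=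
    ((contMDiff_conj_left (E := E) h).mdifferentiable (by simp) 1).hasMFDerivAt
  have h3 := (h1 (h * 1 * h⁻¹) (by simp)).comp (1 : G) h2
  have h4 : pd E Y (fun u => F (conjAll (E := E) h u)) u = (pd E Y F w).comp (AdE E h) := by
    have h5 : (fun y : G => F (conjAll (E := E) h (update u Y (y * u Y)))) =
        fun y => F (update w Y ((h * y * h⁻¹) * w Y)) :=
      funext fun y => congrArg F (conjAll_move h u Y y)
    exact (congrArg (fun f : G → V => mderiv E f 1) h5).trans h3.mfderiv
  rw [h4]; rfl

theorem vD_comp_conjAll (h : G) {F : (Hol n g → G) → V}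
    (hF : ContMDiff (piModel (Hol n g) E) 𝓘(ℝ, V) ∞ F) (u : Hol n g → G) (X : Hol n g)
    (ξ : LieAlg E G) :
    vD E (genVar u X ξ) (fun u => F (conjAll (E := E) h u)) u =
      vD E (genVar (conjAll (E := E) h u) X (Ad h ξ)) F (conjAll (E := E) h u) := by
  refine Finset.sum_congr rfl fun Y _ => ?_
  rw [pd_comp_conjAll h Y hF]
  exact congrArg (fun v : E => pd E Y F (conjAll (E := E) h u) v) (genVar_conjAll h u X Y ξ).symm

theorem uK_conjAll (h : G) (u : Hol n g → G) (i : Fin g) :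
    uK (conjAll (E := E) h u) i = h * uK u i * h⁻¹ := by
  simp only [uK, conjAll_apply]; group

theorem list_prod_conj {α : Type*} (l : List α) (w : α → G) (h : G) :
    (l.map fun a => h * w a * h⁻¹).prod = h * (l.map w).prod * h⁻¹ := by
  induction l with
  | nil => simp
  | cons a l ih => rw [List.map_cons, List.prod_cons, ih, List.map_cons, List.prod_cons]; group

theorem uTot_conjAll (h : G) (u : Hol n g → G) :
    uTot (conjAll (E := E) h u) = h * uTot u * h⁻¹ := by
  simp only [uTot, uK_conjAll, conjAll_apply, list_prod_conj]; group

end Equivariance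

/-! ### Brackets of j^X(ξ) for arbitrary ξ -/

section Vectors
variable {E : Type*} [NormedAddCommGroup E] [NormedSpace ℝ E] [FiniteDimensional ℝ E]
  {G : Type*} [TopologicalSpace G] [T2Space G] [ChartedSpace E G] [Group G] [LieGroup 𝓘(ℝ, E) ∞ G]
  {n g : ℕ} {κ : Type*} [Fintype κ] [DecidableEq κ] (J : Module.Basis κ ℝ (LieAlg E G))

/-- The derivation `F ↦ {j^X(ξ), F}`. -/
def vecField (X : Hol n g) (ξ : LieAlg E G) (F : Fn E G n g) : Fn E G n g :=
  ∑ c, J.repr ξ c • genField J X c F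

theorem vecField_apply (X : Hol n g) (ξ : LieAlg E G) (F : Fn E G n g) (u : Hol n g → G) :
    vecField J X ξ F u = vD E (genVar u X ξ) F u := by
  have h1 : ∀ c, (J.repr ξ c • genField J X c F) u =
      J.repr ξ c * vD E (genVar u X (J c)) F u := fun c =>
    congrArg (fun r : ℝ => J.repr ξ c * r) (genField_apply J X c F u)
  rw [vecField, Fn_sum_apply]
  simp only [h1, vD, Finset.mul_sum]
  rw [Finset.sum_comm]
  refine Finset.sum_congr rfl fun Y _ => ?_
  have h2 := sum_mul_clm J (Y := fun c => J.repr ξ c) (pd E Y F u)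
    ((anchor E u Y).comp (decouple E u X Y))
  rw [sum_repr_smul] at h2
  exact h2

theorem vecField_conjAll (h : G) (X : Hol n g) (ξ : LieAlg E G) (F : Fn E G n g) :
    vecField J X ξ (F.comp (conjAll h)) = (vecField J X (Ad h ξ) F).comp (conjAll h) := by
  ext u
  rw [vecField_apply]
  refine (vD_comp_conjAll h F.contMDiff u X ξ).trans ?_
  exact (vecField_apply J X (Ad h ξ) F _).symm

theorem vecField_add (X : Hol n g) (ξ : LieAlg E G) (F F' : Fn E G n g) :
    vecField J X ξ (F + F') = vecField J X ξ F + vecField J X ξ F' := by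
  simp only [vecField, map_add, smul_add, Finset.sum_add_distrib]

/-- The bracket with a function of u_tot sees only the velocity of u_tot, which `hasVar_uTot`
supplies. -/
theorem vecField_comp_Phi (X : Hol n g) (ξ : LieAlg E G) (f : C^∞⟮𝓘(ℝ, E), G; 𝓘(ℝ, ℝ), ℝ⟯)
    (u : Hol n g → G) : vecField J X ξ (f.comp Phi) u = dR E f (uTot u) (subAd E (u X) ξ) :=
  (vecField_apply J X ξ _ u).trans ((hasVar_uTot u X ξ).vD_comp f.contMDiff)

theorem bracket_jv_const_C (X : Hol n g) (ξ : LieAlg E G) (F : Fn E G n g) :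
    bracket J (jv J X (constE n g ξ)) (C F) = C (vecField J X ξ F) := by
  rw [jv_const, (isSkewBider_bracket J).sum_left, vecField, map_sum]
  refine Finset.sum_congr rfl fun c _ => ?_
  rw [(isSkewBider_bracket J).smul_left, bracket_gen_C, smul_eq_C_mul', Algebra.smul_def, map_mul]

theorem sum_C_mul_jv {ι : Type*} (t : Finset ι) (f : ι → Fn E G n g) (Z : Hol n g)
    (s : ι → FnE E G n g) (r : FnE E G n g) (h : ∀ u, r u = ∑ i ∈ t, f i u • s i u) :
    ∑ i ∈ t, C (f i) * jv J Z (s i) = jv J Z r := by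
  simp only [jv, Finset.mul_sum]
  rw [Finset.sum_comm]
  refine Finset.sum_congr rfl fun b _ => ?_
  simp only [← mul_assoc, ← map_mul]
  rw [← Finset.sum_mul, ← map_sum]
  congr 2
  ext u
  rw [Fn_sum_apply, compFn_apply, h, map_sum]
  exact Finset.sum_congr rfl fun i _ => (map_smul (coordCLM E J b) (f i u) (s i u)).symm

/-- `1 - Ad(u_X)` if `X < Y` and the identity otherwise. -/
def preOp (u : Hol n g → G) (X Y : Hol n g) : LieAlg E G →L[ℝ] LieAlg E G :=
  open Classical in if Prec X Y then subAd E (u X) else ContinuousLinearMap.id ℝ _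

theorem preOp_conjAll (h : G) (u : Hol n g → G) (X Y : Hol n g) (ξ : LieAlg E G) :
    preOp (conjAll (E := E) h u) X Y (Ad h ξ) = Ad h (preOp u X Y ξ) := by
  unfold preOp
  split_ifs
  · exact subAd_conj h _ ξ
  · rfl

theorem contMDiff_preOp (X Y : Hol n g) (ξ : LieAlg E G) :
    ContMDiff (piModel (Hol n g) E) 𝓘(ℝ, E) ∞
      (fun u : Hol n g → G => toE E (preOp u X Y ξ)) := by
  unfold preOp
  split_ifs
  · exact contMDiff_subAd_const (contMDiff_proj X) ξ
  · exact contMDiff_const (M' := E) (c := toE E ξ)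

theorem contMDiff_brE {s t : (Hol n g → G) → E} (hs : ContMDiff (piModel (Hol n g) E) 𝓘(ℝ, E) ∞ s)
    (ht : ContMDiff (piModel (Hol n g) E) 𝓘(ℝ, E) ∞ t) :
    ContMDiff (piModel (Hol n g) E) 𝓘(ℝ, E) ∞ (fun u => brE G (s u) (t u)) := by
  let J := Module.finBasis ℝ (LieAlg E G)
  have h1 : (fun u => brE G (s u) (t u)) = fun u => ∑ c, (∑ a, ∑ b, coordCLM E J a (s u) *
      coordCLM E J b (t u) * J.repr ⁅J a, J b⁆ c) • toE E (J c) := by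
    ext1 u
    simp only [coord_brE]
    exact (sum_coord_smul J _).symm
  rw [h1]
  refine contMDiff_finsetSum fun c _ => ContMDiff.smul (contMDiff_finsetSum fun a _ =>
    contMDiff_finsetSum fun b _ => ContMDiff.mul (ContMDiff.mul
      ((coordCLM E J a).contMDiff.comp hs) ((coordCLM E J b).contMDiff.comp ht)) contMDiff_const)
    (contMDiff_const (M' := E) (c := toE E (J c)))

/-- The function `u ↦ -[ξ, η]`, with `1 - Ad(u_X)` applied to `ξ` if `X < Y` and `1 - Ad(u_Y)`
applied to `η` if `Y < X`. -/
def preBr (X Y : Hol n g) (ξ η : LieAlg E G) : FnE E G n g :=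
  ⟨fun u => -brE G (toE E (preOp u X Y ξ)) (toE E (preOp u Y X η)),
    ContMDiff.neg (G := E) (contMDiff_brE (contMDiff_preOp X Y ξ) (contMDiff_preOp Y X η))⟩

theorem preBr_apply (X Y : Hol n g) (ξ η : LieAlg E G) (u : Hol n g → G) :
    preBr X Y ξ η u = toE E (-⁅preOp u X Y ξ, preOp u Y X η⁆) := rfl

theorem jv_neg (Z : Hol n g) (s : FnE E G n g) : jv J Z (-s) = -jv J Z s := by
  have h := sum_C_mul_jv J Finset.univ (fun _ : Unit => (-1 : Fn E G n g)) Z (fun _ => s) (-s)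
    (fun u => by
      rw [Finset.univ_unique, Finset.sum_singleton]
      exact (neg_one_smul ℝ (s u)).symm)
  rw [← h, Finset.univ_unique, Finset.sum_singleton, map_neg, map_one, neg_one_mul]

/-- One formula for all positions of X and Y, with Z independent of the components: Z is the larger
label, B_i for a pair A_i, B_i, and X when the labels agree. Invariance of the bracket can then be
proved without distinguishing cases. -/
theorem exists_genBracket_eq (X Y : Hol n g) : ∃ Z, ∀ a b,
    genBracket J (X, a) (Y, b) = jv J Z (preBr X Y (J a) (J b)) := by
  rcases prec_trichotomy X Y with h | h | rfl | ⟨i, rfl, rfl⟩ | ⟨i, rfl, rfl⟩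
  · refine ⟨Y, fun a b => ?_⟩
    rw [genBracket_of_prec J h a b (-preBr X Y (J a) (J b)) fun u => ?_, ← jv_neg, neg_neg]
    refine (neg_neg _).trans ?_
    rw [preOp, preOp, if_pos h, if_neg h.asymm]; rfl
  · refine ⟨X, fun a b => ?_⟩
    rw [genBracket_symm, genBracket_of_prec J h b a (preBr X Y (J a) (J b)) fun u => ?_, neg_neg]
    rw [preBr_apply, lie_skew, preOp, preOp, if_pos h, if_neg h.asymm]; rfl
  · refine ⟨X, fun a b => ?_⟩
    rw [genBracket_self, ← jv_neg]
    refine congrArg (jv J _) (ContMDiffMap.ext fun u => ?_)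
    rw [preBr_apply, preOp, if_neg (Prec.irrefl X)]; rfl
  · refine ⟨Hol.B i, fun a b => ?_⟩
    rw [genBracket_A_B, ← jv_neg]
    refine congrArg (jv J _) (ContMDiffMap.ext fun u => ?_)
    rw [preBr_apply, preOp, preOp, if_neg (not_prec_A_B i), if_neg (not_prec_B_A i)]; rfl
  · refine ⟨Hol.B i, fun a b => ?_⟩
    rw [genBracket_symm, genBracket_A_B, neg_neg]
    refine congrArg (jv J _) (ContMDiffMap.ext fun u => ?_)
    rw [preBr_apply, lie_skew, preOp, preOp, if_neg (not_prec_A_B i), if_neg (not_prec_B_A i)]; rfl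

theorem bracket_jv_const_jv_const {X Y Z : Hol n g}
    (hZ : ∀ a b, genBracket J (X, a) (Y, b) = jv J Z (preBr X Y (J a) (J b)))
    (ξ η : LieAlg E G) : bracket J (jv J X (constE n g ξ)) (jv J Y (constE n g η)) =
      jv J Z (preBr X Y ξ η) := by
  have hS := isSkewBider_bracket (n := n) (g := g) J
  have h1 : bracket J (jv J X (constE n g ξ)) (jv J Y (constE n g η)) =
      ∑ p : κ × κ, C (algebraMap ℝ (Fn E G n g) (J.repr ξ p.1 * J.repr η p.2)) *
        jv J Z (preBr X Y (J p.1) (J p.2)) := by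
    rw [jv_const, jv_const, hS.sum_left, Fintype.sum_prod_type]
    refine Finset.sum_congr rfl fun a _ => ?_
    rw [hS.sum_right]
    refine Finset.sum_congr rfl fun b _ => ?_
    rw [hS.smul_left, hS.smul_right, bracket_gen_gen, hZ, smul_smul, smul_eq_C_mul']
  rw [h1]
  refine sum_C_mul_jv J _ _ _ _ _ fun u => ?_
  have h2 : (-⁅preOp u X Y ξ, preOp u Y X η⁆ : LieAlg E G) =
      ∑ p : κ × κ, (J.repr ξ p.1 * J.repr η p.2) • -⁅preOp u X Y (J p.1), preOp u Y X (J p.2)⁆ := by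
    conv_lhs => rw [← sum_repr_smul J ξ, ← sum_repr_smul J η]
    rw [map_sum, map_sum, sum_lie, Fintype.sum_prod_type, ← Finset.sum_neg_distrib]
    refine Finset.sum_congr rfl fun a _ => ?_
    rw [lie_sum, ← Finset.sum_neg_distrib]
    refine Finset.sum_congr rfl fun b _ => ?_
    rw [map_smul, map_smul, smul_lie, lie_smul, smul_smul, smul_neg]
  exact congrArg (toE E) h2

end Vectors

/-! ### The action, its compatibility with the bracket, and conjugation in H -/

section Action
variable {E : Type*} [NormedAddCommGroup E] [NormedSpace ℝ E] [FiniteDimensional ℝ E]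
  {G : Type*} [TopologicalSpace G] [T2Space G] [ChartedSpace E G] [Group G] [LieGroup 𝓘(ℝ, E) ∞ G]
  {n g : ℕ} {κ : Type*} [Fintype κ] [DecidableEq κ] (J : Module.Basis κ ℝ (LieAlg E G))

theorem genAct_C (k : GenGauge E G) (F : Fn E G n g) :
    genAct J k (C F : FlowerAlg E G n g κ) = C (F.comp (conjAll k.h⁻¹)) :=
  MvPolynomial.aevalTower_C _ _ _

theorem genAct_gen (k : GenGauge E G) (X : Hol n g) (a : κ) :
    genAct J k (gen X a : FlowerAlg E G n g κ) = jv J X (constE n g (Ad k.h (J a))) +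
      C (vecField J X (Ad k.h (J a)) (k.f.comp Phi)) := by
  have h : genAct J k (gen X a : FlowerAlg E G n g κ) = ∑ b, adCoef J k.h a b •
      (gen X b + bracket J (gen X b) (C (k.f.comp Phi))) := MvPolynomial.aevalTower_X _ _ _
  refine h.trans ?_
  rw [← bracket_jv_const_C, jv_const, (isSkewBider_bracket J).sum_left, ← Finset.sum_add_distrib]
  refine Finset.sum_congr rfl fun b _ => ?_
  rw [(isSkewBider_bracket J).smul_left, ← smul_add]
  rfl

theorem sum_smul_jv_const (X : Hol n g) (c : κ → ℝ) (ξ : κ → LieAlg E G) :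
    ∑ b, c b • jv J X (constE n g (ξ b)) = jv J X (constE n g (∑ b, c b • ξ b)) := by
  simp only [smul_eq_C_mul']
  refine sum_C_mul_jv J _ _ _ _ _ fun u => ?_
  rfl

theorem sum_smul_vecField (X : Hol n g) (c : κ → ℝ) (ξ : κ → LieAlg E G) (F : Fn E G n g) :
    ∑ b, c b • vecField J X (ξ b) F = vecField J X (∑ b, c b • ξ b) F := by
  have h : ∀ ξ, (C (vecField J X ξ F) : FlowerAlg E G n g κ) =
      bracket J (jv J X (constE n g ξ)) (C F) := fun ξ => (bracket_jv_const_C J X ξ F).symm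
  apply C_injective (Hol n g × κ) (Fn E G n g)
  rw [h, ← sum_smul_jv_const, (isSkewBider_bracket J).sum_left, map_sum]
  refine Finset.sum_congr rfl fun b _ => ?_
  rw [(isSkewBider_bracket J).smul_left, ← h, smul_eq_C_mul', Algebra.smul_def, map_mul]

theorem genAct_jv_const (k : GenGauge E G) (X : Hol n g) (ξ : LieAlg E G) :
    genAct J k (jv J X (constE n g ξ)) = jv J X (constE n g (Ad k.h ξ)) +
      C (vecField J X (Ad k.h ξ) (k.f.comp Phi)) := by
  have h1 : Ad k.h ξ = ∑ b, J.repr ξ b • Ad k.h (J b) := by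
    conv_lhs => rw [← sum_repr_smul J ξ, map_sum]
    simp only [map_smul]
  rw [jv_const, map_sum]
  simp only [map_smul, genAct_gen, smul_add, Finset.sum_add_distrib]
  rw [sum_smul_jv_const, ← h1]
  congr 1
  rw [h1, ← sum_smul_vecField, map_sum]
  refine Finset.sum_congr rfl fun b _ => ?_
  rw [smul_eq_C_mul', Algebra.smul_def, map_mul]

theorem algHom_ext_C_gen {S : Type*} [CommRing S] [Algebra ℝ S]
    {f f' : FlowerAlg E G n g κ →ₐ[ℝ] S} (hC : ∀ F, f (C F) = f' (C F))
    (hX : ∀ X a, f (gen X a) = f' (gen X a)) : f = f' := by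
  have h : (f : FlowerAlg E G n g κ →+* S) = f' :=
    MvPolynomial.ringHom_ext hC fun p => hX p.1 p.2
  exact AlgHom.ext fun φ => congrArg (fun f : FlowerAlg E G n g κ →+* S => f φ) h

theorem genAct_one : genAct J (1 : GenGauge E G) = AlgHom.id ℝ (FlowerAlg E G n g κ) := by
  refine algHom_ext_C_gen (fun F => ?_) fun X a => ?_
  · rw [genAct_C, AlgHom.id_apply]
    refine congrArg C (ContMDiffMap.ext fun u => congrArg F (funext fun X => ?_))
    show (1 : G)⁻¹ * u X * (1 : G)⁻¹⁻¹ = u X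
    simp
  · have h0 : ((1 : GenGauge E G).f.comp Phi : Fn E G n g) = 0 := rfl
    have h1 : Ad (1 : GenGauge E G).h (J a) = J a := by
      show Ad (1 : G) (J a) = J a
      rw [Ad_one]; rfl
    rw [genAct_gen, h0, h1, jv_const]
    simp [vecField, Finsupp.single_apply]

/-- On generators the cocycle f + f'∘Ad_{h⁻¹} matches because both Φ_∞ and the vector fields of the
j^X are equivariant under conjugation. -/
theorem genAct_mul (k k' : GenGauge E G) :
    genAct J (k * k') = (genAct J k).comp (genAct J k' : FlowerAlg E G n g κ →ₐ[ℝ] _) := by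
  refine algHom_ext_C_gen (fun F => ?_) fun X a => ?_
  · rw [AlgHom.comp_apply, genAct_C, genAct_C, genAct_C]
    congr 1
    ext u
    refine congrArg F (funext fun X => ?_)
    show (k.h * k'.h)⁻¹ * u X * (k.h * k'.h)⁻¹⁻¹ = k'.h⁻¹ * (k.h⁻¹ * u X * k.h⁻¹⁻¹) * k'.h⁻¹⁻¹
    group
  · have h1 : Ad (k * k').h (J a) = Ad k.h (Ad k'.h (J a)) := by
      show Ad (k.h * k'.h) (J a) = _
      rw [Ad_mul]; rfl
    have h2 : ((k * k').f.comp Phi : Fn E G n g) =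
        k.f.comp Phi + (k'.f.comp Phi : Fn E G n g).comp (conjAll k.h⁻¹) := by
      ext u
      show k.f (uTot u) + k'.f (k.h⁻¹ * uTot u * k.h⁻¹⁻¹) =
        k.f (uTot u) + k'.f (uTot (conjAll (E := E) k.h⁻¹ u))
      rw [uTot_conjAll]
    rw [AlgHom.comp_apply, genAct_gen, genAct_gen, map_add, genAct_jv_const, genAct_C, h1, h2,
      vecField_add, vecField_conjAll, Ad_inv_Ad, map_add, add_assoc]

theorem genAct_jv (k : GenGauge E G) (hf : k.f = 0) (Z : Hol n g) (s r : FnE E G n g)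
    (h : ∀ u, r u = AdE E k.h (s (conjAll (E := E) k.h⁻¹ u))) :
    genAct J k (jv J Z s) = jv J Z r := by
  have h0 : (k.f.comp Phi : Fn E G n g) = 0 := by rw [hf]; rfl
  have h1 : ∀ b, genAct J k (C (compFn J b s) * gen Z b : FlowerAlg E G n g κ) =
      C ((compFn J b s).comp (conjAll k.h⁻¹)) * jv J Z (constE n g (Ad k.h (J b))) := fun b => by
    have h2 : vecField J Z (Ad k.h (J b)) (0 : Fn E G n g) = 0 := by simp [vecField]
    rw [map_mul, genAct_C, genAct_gen, h0, h2, map_zero, add_zero]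
  rw [jv, map_sum, Finset.sum_congr rfl fun b _ => h1 b]
  refine sum_C_mul_jv J _ _ _ _ _ fun u => ?_
  rw [h]
  have h3 := congrArg (AdE E k.h) (sum_coord_smul J (s (conjAll (E := E) k.h⁻¹ u))).symm
  rw [map_sum] at h3
  refine h3.trans (Finset.sum_congr rfl fun b _ => ?_)
  exact map_smul (AdE E k.h) _ _

theorem genAct_bracket_of_conj (k : GenGauge E G) (hf : k.f = 0) (φ ψ : FlowerAlg E G n g κ) :
    genAct J k (bracket J φ ψ) = bracket J (genAct J k φ) (genAct J k ψ) := by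
  have h0 : (k.f.comp Phi : Fn E G n g) = 0 := by rw [hf]; rfl
  have hv : ∀ X ξ, vecField J X ξ (0 : Fn E G n g) = 0 := fun X ξ => by simp [vecField]
  have hg : ∀ (X : Hol n g) a, genAct J k (MvPolynomial.X (X, a)) =
      jv J X (constE n g (Ad k.h (J a))) := fun X a => by
    refine (genAct_gen J k X a).trans ?_
    rw [h0, hv, map_zero, add_zero]
  refine map_br_of_X_C (isSkewBider_bracket J) (isSkewBider_bracket J)
    (genAct J k : FlowerAlg E G n g κ →ₐ[ℝ] _).toRingHom
    (fun F F' => ?_) (fun p F => ?_) (fun p q => ?_) φ ψ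
  · show genAct J k _ = bracket J (genAct J k _) (genAct J k _)
    rw [bracket_C_C, genAct_C, genAct_C, bracket_C_C, map_zero]
  · obtain ⟨X, a⟩ := p
    show genAct J k (bracket J (gen X a) _) = bracket J (genAct J k _) (genAct J k _)
    rw [bracket_gen_C, genAct_C, genAct_C, hg, bracket_jv_const_C, vecField_conjAll, Ad_inv_Ad]
    congr 2
    simp [vecField, Finsupp.single_apply]
  · obtain ⟨X, a⟩ := p
    obtain ⟨Y, b⟩ := q
    show genAct J k _ = bracket J (genAct J k _) (genAct J k _)
    obtain ⟨Z, hZ⟩ := exists_genBracket_eq (n := n) (g := g) J X Y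
    rw [hg, hg, bracket_jv_const_jv_const J hZ, bracket_gen_gen, hZ]
    refine genAct_jv J k hf Z _ _ fun u => ?_
    set w := conjAll (E := E) k.h⁻¹ u with hw
    have hu : u = conjAll (E := E) k.h w := by
      ext1 X
      simp only [hw, conjAll_apply]; group
    show toE E (-⁅preOp u X Y _, preOp u Y X _⁆) = toE E (Ad k.h (-⁅preOp w X Y (J a), preOp w Y X (J b)⁆))
    rw [hu, preOp_conjAll, preOp_conjAll, map_neg, Ad_lie]

/-- A translation fixes the coefficients, and these commute with f∘Φ_∞, so the rule for generators
extends to everything linear in them, in particular to {j^X_a, j^Y_b}. -/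
theorem genAct_jv_of_translate (k : GenGauge E G) (hh : k.h = 1) (Z : Hol n g) (s : FnE E G n g) :
    genAct J k (jv J Z s) = jv J Z s + bracket J (jv J Z s) (C (k.f.comp Phi)) := by
  have hS := isSkewBider_bracket (n := n) (g := g) J
  rw [jv, map_sum, hS.sum_left, ← Finset.sum_add_distrib]
  refine Finset.sum_congr rfl fun b _ => ?_
  have h1 : (compFn J b s).comp (conjAll k.h⁻¹) = compFn J b s := by
    ext u
    refine congrArg (compFn J b s) (funext fun X => ?_)
    show k.h⁻¹ * u X * k.h⁻¹⁻¹ = u X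
    rw [hh]; simp
  have h2 : jv J Z (constE n g (J b)) = (gen Z b : FlowerAlg E G n g κ) := by
    rw [jv_const]; simp [Finsupp.single_apply]
  have h3 : Ad k.h (J b) = J b := by rw [hh, Ad_one]; rfl
  rw [map_mul, genAct_C, h1, genAct_gen, h3, ← bracket_jv_const_C, h2, hS.leibniz_left,
    bracket_C_C, zero_mul, zero_add, mul_add]

/-- With D = {·, f∘Φ_∞} one needs {j+Dj, j'+Dj'} = {j,j'} + D{j,j'}. The Jacobi identity says that D
is a derivation of the bracket, and {Dj, Dj'} vanishes because both entries are functions. -/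
theorem genAct_bracket_of_translate (k : GenGauge E G) (hh : k.h = 1) (φ ψ : FlowerAlg E G n g κ) :
    genAct J k (bracket J φ ψ) = bracket J (genAct J k φ) (genAct J k ψ) := by
  have hS := isSkewBider_bracket (n := n) (g := g) J
  have hC : ∀ F : Fn E G n g, genAct J k (C F : FlowerAlg E G n g κ) = C F := fun F => by
    rw [genAct_C]
    congr 1
    ext u
    refine congrArg F (funext fun X => ?_)
    show k.h⁻¹ * u X * k.h⁻¹⁻¹ = u X
    rw [hh]; simp
  have hX : ∀ (X : Hol n g) a, genAct J k (MvPolynomial.X (X, a) : FlowerAlg E G n g κ) =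
      MvPolynomial.X (X, a) + bracket J (MvPolynomial.X (X, a)) (C (k.f.comp Phi)) := fun X a => by
    have h := genAct_jv_of_translate J k hh X (constE n g (J a))
    have h2 : jv J X (constE n g (J a)) = (gen X a : FlowerAlg E G n g κ) := by
      rw [jv_const]; simp [Finsupp.single_apply]
    rwa [h2] at h
  refine map_br_of_X_C hS hS (genAct J k : FlowerAlg E G n g κ →ₐ[ℝ] _).toRingHom
    (fun F F' => ?_) (fun p F => ?_) (fun p q => ?_) φ ψ
  · show genAct J k _ = bracket J (genAct J k _) (genAct J k _)
    rw [bracket_C_C, hC, hC, bracket_C_C, map_zero]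
  · obtain ⟨X, a⟩ := p
    show genAct J k (bracket J (gen X a) _) = bracket J (genAct J k _) (genAct J k _)
    rw [hC, hX, hS.add_left, bracket_gen_C, bracket_gen_C, hC, bracket_C_C, add_zero]
  · obtain ⟨X, a⟩ := p
    obtain ⟨Y, b⟩ := q
    show genAct J k _ = bracket J (genAct J k _) (genAct J k _)
    obtain ⟨Z, hZ⟩ := exists_genBracket_eq (n := n) (g := g) J X Y
    have hj := jac_bracket J (gen X a) (gen Y b) (C (k.f.comp Phi) : FlowerAlg E G n g κ)
    have h1 : bracket J (gen X a) (gen Y b) = jv J Z (preBr X Y (J a) (J b)) :=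
      (bracket_gen_gen J _ _).trans (hZ a b)
    rw [hX, hX]
    have h0 : bracket J (bracket J (gen X a) (C (k.f.comp Phi) : FlowerAlg E G n g κ))
        (bracket J (gen Y b) (C (k.f.comp Phi))) = 0 := by
      rw [bracket_gen_C, bracket_gen_C, bracket_C_C]
    rw [h1, genAct_jv_of_translate J k hh, ← h1, hS.add_left, hS.add_right, hS.add_right, h0]
    rw [IsSkewBider.jac, hS.skew (C _) (gen X a), hS.neg_right, hS.skew (C _) (bracket J _ _)] at hj
    rw [hS.skew (bracket J (gen X a) (C _)) (gen Y b)]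
    linear_combination -hj

theorem genAct_bracket (k : GenGauge E G) (φ ψ : FlowerAlg E G n g κ) :
    genAct J k (bracket J φ ψ) = bracket J (genAct J k φ) (genAct J k ψ) := by
  -- In this order the second summand 0∘Ad vanishes and f is left unchanged.
  have hk : k = (⟨1, k.f⟩ : GenGauge E G) * ⟨k.h, 0⟩ := by
    ext
    · show k.h = 1 * k.h
      rw [one_mul]
    · show _ = k.f _ + 0
      rw [add_zero]
  rw [hk, genAct_mul, AlgHom.comp_apply, AlgHom.comp_apply, AlgHom.comp_apply,
    genAct_bracket_of_conj J _ rfl, genAct_bracket_of_translate J _ rfl]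

/-- The action of `G ⋉ C^∞(G)` as a group homomorphism. -/
def genActHom : GenGauge E G →* (FlowerAlg E G n g κ ≃ₐ[ℝ] FlowerAlg E G n g κ) :=
  (AlgEquiv.algHomUnitsEquiv ℝ (FlowerAlg E G n g κ)).toMonoidHom.comp
    -- A monoid homomorphism from a group has values in the units, so multiplicativity already makes
    -- the endomorphisms invertible.
    (MonoidHom.toHomUnits
      { toFun := fun k => genAct J k
        map_one' := genAct_one J
        map_mul' := genAct_mul J })

theorem lieLog_conj (hexp : Bijective (lieExp : LieAlg E G → G)) (h u : G) :
    (lieLog (h * u * h⁻¹) : LieAlg E G) = Ad h (lieLog u) := by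
  apply hexp.1
  have h1 : ∀ v : G, lieExp (lieLog v : LieAlg E G) = v := rightInverse_invFun hexp.2
  rw [lieExp_Ad, h1, h1]

theorem contMDiff_coE_lieLog (hexp : Bijective (lieExp : LieAlg E G → G)) (q : CoLieAlg E G) :
    ContMDiff 𝓘(ℝ, E) 𝓘(ℝ, ℝ) ∞ (fun u : G => q (lieLog u)) :=
  (coE E q).contMDiff.comp (contMDiff_logE hexp)

/-- The group homomorphism `(h, q) ↦ (h, ⟨q, log ·⟩)`. -/
def gaugeHom (hexp : Bijective (lieExp : LieAlg E G → G)) : Gauge E G →* GenGauge E G :=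
  MonoidHom.mk' (fun k => ⟨k.u, ⟨fun u => k.a (lieLog u), contMDiff_coE_lieLog hexp k.a⟩⟩)
    fun k k' => by
      ext u
      · rfl
      · show k.a (lieLog u) + k'.a (Ad k.u⁻¹ (lieLog u)) =
          k.a (lieLog u) + k'.a (lieLog (k.u⁻¹ * u * k.u⁻¹⁻¹))
        rw [lieLog_conj hexp]

/-- Evaluating ⟨q, log ·⟩ at exp ξ recovers ⟨q, ξ⟩. -/
theorem gaugeHom_injective (hexp : Bijective (lieExp : LieAlg E G → G)) :
    Injective (gaugeHom (E := E) (G := G) hexp) := by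
  intro k k' h
  have h1 : k.u = k'.u := congrArg GenGauge.h h
  ext ξ
  · exact h1
  · have h2 := congrArg (fun f : C^∞⟮𝓘(ℝ, E), G; 𝓘(ℝ, ℝ), ℝ⟯ => f (lieExp ξ))
      (congrArg GenGauge.f h)
    have h3 : (lieLog (lieExp ξ : G) : LieAlg E G) = ξ := leftInverse_invFun hexp.1 ξ
    change k.a (lieLog (lieExp ξ : G)) = k'.a (lieLog (lieExp ξ : G)) at h2
    rwa [h3] at h2

theorem evalAt_C (m : Hol n g → Gauge E G) (F : Fn E G n g) :
    evalAt J m (C F : FlowerAlg E G n g κ) = F fun X => (m X).u :=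
  MvPolynomial.aevalTower_C _ _ _

theorem evalAt_gen (m : Hol n g → Gauge E G) (X : Hol n g) (a : κ) :
    evalAt J m (gen X a : FlowerAlg E G n g κ) = (-AdStar (m X).u (m X).a) (J a) :=
  MvPolynomial.aevalTower_X _ _ _

theorem evalAt_jv_const (m : Hol n g → Gauge E G) (X : Hol n g) (ξ : LieAlg E G) :
    evalAt J m (jv J X (constE n g ξ)) = (-AdStar (m X).u (m X).a) ξ := by
  rw [jv_const, map_sum]
  conv_rhs => rw [← sum_repr_smul J ξ, map_sum]
  refine Finset.sum_congr rfl fun b _ => ?_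
  rw [map_smul, map_smul, evalAt_gen]

theorem conj_u (h : G) (x : CoLieAlg E G) (m : Gauge E G) :
    ((⟨h, x⟩ : Gauge E G)⁻¹ * m * ⟨h, x⟩).u = h⁻¹ * m.u * h := rfl

/-- The vector part of (h,x)⁻¹ m (h,x) has three summands. Read as j = -Ad*(u)a, they involve Ad of
group words that collapse to u h, u h and h. -/
theorem conj_vector (h : G) (x : CoLieAlg E G) (m : Gauge E G) (ξ : LieAlg E G) :
    (-AdStar ((⟨h, x⟩ : Gauge E G)⁻¹ * m * ⟨h, x⟩).u ((⟨h, x⟩ : Gauge E G)⁻¹ * m * ⟨h, x⟩).a) ξ =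
      (-AdStar m.u m.a) (Ad h ξ) - x (subAd E m.u (Ad h ξ)) := by
  have h1 : ((⟨h, x⟩ : Gauge E G)⁻¹ * m * ⟨h, x⟩).a =
      -AdStar h x + AdStar h⁻¹⁻¹ m.a + AdStar (h⁻¹ * m.u)⁻¹ x := rfl
  rw [conj_u, h1]
  show -((-AdStar h x + AdStar h⁻¹⁻¹ m.a + AdStar (h⁻¹ * m.u)⁻¹ x) (Ad (h⁻¹ * m.u * h) ξ)) =
    -(m.a (Ad m.u (Ad h ξ))) - x (subAd E m.u (Ad h ξ))
  have h2 : (-AdStar h x + AdStar h⁻¹⁻¹ m.a + AdStar (h⁻¹ * m.u)⁻¹ x) (Ad (h⁻¹ * m.u * h) ξ) =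
      -x (Ad h (Ad (h⁻¹ * m.u * h) ξ)) + m.a (Ad h⁻¹⁻¹ (Ad (h⁻¹ * m.u * h) ξ)) +
        x (Ad (h⁻¹ * m.u)⁻¹ (Ad (h⁻¹ * m.u * h) ξ)) := rfl
  have h3 : ∀ (v w : G), Ad v (Ad w ξ) = Ad (v * w) ξ := fun v w => by rw [Ad_mul]; rfl
  rw [h2, subAd_apply, map_sub, h3, h3, h3, h3]
  have e1 : h * (h⁻¹ * m.u * h) = m.u * h := by group
  have e2 : h⁻¹⁻¹ * (h⁻¹ * m.u * h) = m.u * h := by group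
  have e3 : (h⁻¹ * m.u)⁻¹ * (h⁻¹ * m.u * h) = h := by group
  rw [e1, e2, e3]
  ring

end Action

end Flower

end

theorem mainTheorem12
    {E : Type*} [NormedAddCommGroup E] [NormedSpace ℝ E] [FiniteDimensional ℝ E]
    {G : Type*} [TopologicalSpace G] [T2Space G] [ChartedSpace E G] [Group G]
    [LieGroup 𝓘(ℝ, E) ∞ G]
    {κ : Type*} [Fintype κ] [DecidableEq κ] (J : Module.Basis κ ℝ (LieAlg E G))
    (n g : ℕ)
    (hexp : Function.Bijective (lieExp : LieAlg E G → G)) :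
    IsPoissonBracket (bracket J : FlowerAlg E G n g κ → FlowerAlg E G n g κ → _) ∧
    (∀ u : G, Function.Bijective (T u : CoLieAlg E G → CoLieAlg E G) ∧
      (T u).comp (adStar (lieLog u)) = ContinuousLinearMap.id ℝ (CoLieAlg E G) - AdStar u) ∧
    ∃ j : Gauge E G →* GenGauge E G, Function.Injective j ∧
      (∀ k : Gauge E G, (j k).h = k.u ∧ ∀ u : G, (j k).f u = k.a (lieLog u)) ∧
      ∃ ρ : Gauge E G →* (FlowerAlg E G n g κ ≃ₐ[ℝ] FlowerAlg E G n g κ),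
        (∀ k φ, ρ k φ = genAct J (j k) φ) ∧
        (∀ k φ ψ, ρ k (bracket J φ ψ) = bracket J (ρ k φ) (ρ k ψ)) ∧
        ∀ (h : G) (q : CoLieAlg E G), ∃ x : G → CoLieAlg E G,
          (∀ u, T u (x u) = q) ∧
          (∀ ξ : LieAlg E G, ContMDiff 𝓘(ℝ, E) 𝓘(ℝ, ℝ) ∞ fun u => x u ξ) ∧
          (∀ F : Fn E G n g,
            ρ ⟨h, q⟩ (MvPolynomial.C F) = MvPolynomial.C (F.comp (conjAll h⁻¹))) ∧
          (∀ (X : Hol n g) (a : κ), ∃ y : Fn E G n g,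
            (∀ u, y u = (AdStar h (x (uTot u)) - AdStar (u X * h) (x (uTot u))) (J a)) ∧
            ρ ⟨h, q⟩ (gen X a) = ∑ b, adCoef J h a b • gen X b - MvPolynomial.C y) ∧
          ∀ (m : Hol n g → Gauge E G) (φ : FlowerAlg E G n g κ),
            evalAt J m (ρ ⟨h, q⟩ φ) =
              evalAt J (fun X =>
                (⟨h, x (uTot fun Y => (m Y).u)⟩ : Gauge E G)⁻¹ * m X *
                  ⟨h, x (uTot fun Y => (m Y).u)⟩) φ := by
  refine ⟨isPoissonBracket_bracket J, fun u => ⟨T_bijective hexp.1 u, T_comp_adStar hexp u⟩,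
    gaugeHom hexp, gaugeHom_injective hexp, fun k => ⟨rfl, fun u => rfl⟩,
    (genActHom J).comp (gaugeHom hexp), fun k φ => rfl,
    fun k φ ψ => genAct_bracket J (gaugeHom hexp k) φ ψ, fun h q => ?_⟩
  set k := gaugeHom hexp ⟨h, q⟩ with hk
  have hgen : ∀ (X : Hol n g) (a : κ), genAct J k (gen X a : FlowerAlg E G n g κ) =
      jv J X (constE n g (Ad h (J a))) -
        MvPolynomial.C (-vecField J X (Ad h (J a)) (k.f.comp Phi)) := fun X a => by
    rw [map_neg, sub_neg_eq_add]
    exact genAct_gen J k X a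
  -- The sign in front of the bracket and the one from `dR_logE` cancel, so y is x(u_tot) paired
  -- with (1-Ad(u_X))Ad(h)J_a.
  have hy : ∀ (X : Hol n g) (a : κ) (u : Hol n g → G),
      (-vecField J X (Ad h (J a)) (k.f.comp Phi) : Fn E G n g) u =
        invT q (uTot u) (subAd E (u X) (Ad h (J a))) := fun X a u => by
    have h1 := (vecField_comp_Phi J X (Ad h (J a)) k.f u).trans
      (dR_logE hexp q (uTot u) (subAd E (u X) (Ad h (J a))))
    exact (congrArg (fun r : ℝ => -r) h1).trans (neg_neg _)
  refine ⟨invT q, T_invT hexp.1 q, contMDiff_invT hexp q, fun F => genAct_C J k F,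
    fun X a => ⟨_, fun u => (hy X a u).trans ?_, (hgen X a).trans ?_⟩, fun m φ => ?_⟩
  · rw [subAd_apply, map_sub]
    show _ = invT q (uTot u) (Ad h (J a)) - invT q (uTot u) (Ad (u X * h) (J a))
    rw [Ad_mul]; rfl
  · rw [jv_const]; rfl
  · set m' : Hol n g → Gauge E G := fun X =>
      (⟨h, invT q (uTot fun Y => (m Y).u)⟩ : Gauge E G)⁻¹ * m X *
        ⟨h, invT q (uTot fun Y => (m Y).u)⟩ with hm'
    -- The conjugating element depends on m, but for fixed m both sides are algebra homomorphisms to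
    -- ℝ, so coefficients and generators suffice.
    have h1 : (evalAt J m).comp (genAct J k) =
        (evalAt J m' : FlowerAlg E G n g κ →ₐ[ℝ] ℝ) := by
      refine algHom_ext_C_gen (fun F => ?_) fun X a => ?_
      · rw [AlgHom.comp_apply, genAct_C, evalAt_C, evalAt_C]
        refine congrArg F (funext fun X => ?_)
        show h⁻¹ * (m X).u * h⁻¹⁻¹ = h⁻¹ * (m X).u * h
        rw [inv_inv]
      · rw [AlgHom.comp_apply, hgen, map_sub, evalAt_jv_const, evalAt_C, hy, evalAt_gen]
        exact (conj_vector h _ (m X) (J a)).symm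
    exact congrArg (fun f : FlowerAlg E G n g κ →ₐ[ℝ] ℝ => f φ) h1
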